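/- Let $G$ be a second-countable locally compact group, $A$ a separable and $B$ a $\sigma$-unital $C^*$-algebra, $\alpha\colon G\curvearrowright A$ and $\beta\colon G\curvearrowright B$ point-norm continuous actions by $*$-automorphisms, and $\mathcal K$ the compact operators on $\ell^2(\mathbb N)$. A *cocycle representation* $(\phi,u)$ of $(A,\alpha)$ in $(\mathcal M(D),\delta)$, for an action $\delta\colon G\curvearrowright D$ (extended to the multiplier algebra $\mathcal M(D)$), consists of a $*$-homomorphism $\phi\colon A\to\mathcal M(D)$ and a strictly continuous map $u\colon G\to\mathcal U(\mathcal M(D))$ with $u_{gh}=u_g\delta_g(u_h)$ and $u_g\,\delta_g(\phi(a))\,u_g^*=\phi(\alpha_g(a))$ for all $g,h\in G$, $a\in A$. An $(\alpha,\beta)$-*Cuntz pair* is a pair $((\phi,u),(\psi,v))$ of cocycle representations in $(\mathcal M(B\otimes\mathcal K),\beta\otimes\mathrm{id}_{\mathcal K})$ such that $\phi(a)-\psi(a)\in B\otimes\mathcal K$ and $u_g-v_g\in B\otimes\mathcal K$ for all $a\in A$, $g\in G$; let $\mathbb E^G(\alpha,\beta)$ be the set of these. It is a *cocycle pair* if $\phi=\psi=0$.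 Two Cuntz pairs are *homotopic*, $x_0\sim_h x_1$, if some $(\alpha,\beta[0,1])$-Cuntz pair, where $\beta[0,1]$ is the pointwise action on $B[0,1]=C([0,1],B)$ and $B[0,1]\otimes\mathcal K$ is identified with $C([0,1],B\otimes\mathcal K)$, restricts to $x_0$ at $0$ and to $x_1$ at $1$. For isometries $t_1,t_2\in\mathcal M(B\otimes\mathcal K)^{\beta\otimes\mathrm{id}_{\mathcal K}}$ with $t_1t_1^*+t_2t_2^*=1$, the *Cuntz sum* $x\oplus_{t_1,t_2}y$ is formed by applying $(m,n)\mapsto t_1mt_1^*+t_2nt_2^*$ to all entries pointwise. Write $x\sim y$ if $x\oplus_{t_1,t_2} d_1\sim_h y\oplus_{t_1,t_2} d_2$ for some such $t_1,t_2$ and some cocycle pairs $d_1,d_2$. A Cuntz pair $((\phi,u),(\psi,v))$ is *anchored* if $((0,u),(0,v))\sim_h((0,1),(0,1))$; let $\mathbb E^G_0(\alpha,\beta)$ be the set of anchored Cuntz pairs. **Proposition.** Isometries $t_1,t_2$ as above exist, $\sim_h$ and $\sim$ are equivalence relations, Cuntz sums of anchored Cuntz pairs are anchored, and $\mathbb E^G(\alpha,\beta)/{\sim_h}$,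 $\mathbb E^G_0(\alpha,\beta)/{\sim_h}$ and $\mathbb E^G(\alpha,\beta)/{\sim}$ are abelian groups with addition $[x]+[y]=[x\oplus_{t_1,t_2}y]$ for every choice of such $t_1,t_2$. Moreover: 1. The classes of cocycle pairs form a subgroup of $\mathbb E^G(\alpha,\beta)/{\sim_h}$. 2. The inclusion $\mathbb E^G_0(\alpha,\beta)\subseteq\mathbb E^G(\alpha,\beta)$ induces an isomorphism of abelian groups $\mathbb E^G_0(\alpha,\beta)/{\sim_h}\cong\mathbb E^G(\alpha,\beta)/{\sim}$. 3. For $x,y\in\mathbb E^G_0(\alpha,\beta)$, one has $[x]=[y]$ in $KK^G(\alpha,\beta)$ if and only if $x\sim_h y$. Here $KK^G(\alpha,\beta)$ is taken in the Cuntz--Thomsen picture, i.e. as Thomsen's quotient $\mathbb E^G(\alpha,\beta)/{\sim}$; equivalently, for every isomorphism of abelian groups $\pi\colon\mathbb E^G(\alpha,\beta)/{\sim}\to K$ (such as Thomsen's natural isomorphism onto Kasparov's group $KK^G(\alpha,\beta)$), one has $\pi([x])=\pi([y])$ if and only if $x\sim_h y$. -/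

import Mathlib

open scoped TensorProduct MultiplierAlgebra

universe u v w

noncomputable section

namespace CuntzThomsen

/-! ### The compact operators on a separable infinite-dimensional Hilbert space -/

/-- The separable infinite-dimensional Hilbert space `ℓ²(ℕ)`. -/
abbrev EllTwo : Type := lp (fun _ : ℕ => ℂ) 2

/-- Schauder: the adjoint of a compact operator on a Hilbert space is compact. -/
theorem isCompactOperator_star {T : EllTwo →L[ℂ] EllTwo} (hT : IsCompactOperator T) :
    IsCompactOperator (star T : EllTwo →L[ℂ] EllTwo) := by
  have hTT : IsCompactOperator (T * star T : EllTwo →L[ℂ] EllTwo) :=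
    hT.comp_clm (star T)
  have hK := hTT.isCompact_closure_image_ball (𝕜₁ := ℂ) (f := (T * star T).toLinearMap) 1
  have hTB : TotallyBounded ((T * star T : EllTwo →L[ℂ] EllTwo) '' Metric.ball 0 1) :=
    hK.totallyBounded.subset subset_closure
  refine (isCompactOperator_iff_isCompact_closure_image_ball
    (𝕜₁ := ℂ) (star T).toLinearMap (r := 1) one_pos).2 ?_
  refine TotallyBounded.isCompact_of_isClosed (TotallyBounded.closure ?_) isClosed_closure
  rw [Metric.totallyBounded_iff]
  intro ε hε
  obtain ⟨t, htsub, htfin, hcov⟩ :=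
    Metric.finite_approx_of_totallyBounded hTB (ε ^ 2 / 4) (by positivity)
  choose! s hs hst using fun y (hy : y ∈ t) => htsub hy
  refine ⟨(fun y => star T (s y)) '' t, htfin.image _, ?_⟩
  rintro _ ⟨x, hx, rfl⟩
  have hx' := hcov ⟨x, hx, rfl⟩
  simp only [Set.mem_iUnion, Metric.mem_ball, exists_prop, Set.mem_image] at hx' ⊢
  obtain ⟨y, hy, hxy⟩ := hx'
  refine ⟨_, ⟨y, hy, rfl⟩, ?_⟩
  rw [← hst y hy] at hxy
  have h1 : ‖s y‖ < 1 := by simpa using hs y hy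
  have h2 : ‖x‖ < 1 := by simpa using hx
  have h3 : ‖x - s y‖ ≤ 2 := (norm_sub_le _ _).trans (by linarith)
  rw [dist_eq_norm] at hxy ⊢
  have key : ‖star T (x - s y)‖ ^ 2 ≤ ‖(T * star T) (x - s y)‖ * ‖x - s y‖ := by
    have : ‖star T (x - s y)‖ ^ 2 = RCLike.re (inner ℂ ((T * star T) (x - s y)) (x - s y)) := by
      rw [mul_apply_eq_comp, ← ContinuousLinearMap.adjoint_inner_right,
        ← ContinuousLinearMap.star_eq_adjoint, inner_self_eq_norm_sq]
    rw [this]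
    exact re_inner_le_norm _ _
  change ‖star T x - star T (s y)‖ < ε
  rw [← map_sub]
  rw [← map_sub] at hxy
  have h5 : ‖star T (x - s y)‖ ^ 2 < ε ^ 2 := by
    nlinarith [norm_nonneg ((T * star T) (x - s y)), norm_nonneg (x - s y)]
  exact lt_of_pow_lt_pow_left₀ 2 hε.le h5

/-- The C⋆-algebra `𝓚` of compact operators on `ℓ²(ℕ)`. -/
def compactOps : NonUnitalStarSubalgebra ℂ (EllTwo →L[ℂ] EllTwo) where
  carrier := {T | IsCompactOperator T}
  add_mem' hS hT := hS.add hT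
  zero_mem' := isCompactOperator_zero
  smul_mem' c _ hT := hT.smul c
  mul_mem' {_ T} hS _ := hS.comp_clm T
  star_mem' hT := isCompactOperator_star hT

instance isClosed_compactOps : IsClosed (compactOps : Set (EllTwo →L[ℂ] EllTwo)) :=
  isClosed_setOfPred_isCompactOperator

/-- The type of compact operators on `ℓ²(ℕ)`, a C⋆-algebra. -/
abbrev Compacts : Type := compactOps

/-! ### The tensor product of C⋆-algebras -/

section Tensor

/-- The algebraic tensor product `B ⊙ C` of two C⋆-algebras, as a ⋆-algebra. -/
def AlgTensor (B : Type u) (C : Type v) [NonUnitalCStarAlgebra B] [NonUnitalCStarAlgebra C] :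
    Type (max u v) := B ⊗[ℂ] C

variable {B : Type u} {C : Type v} [NonUnitalCStarAlgebra B] [NonUnitalCStarAlgebra C]

namespace AlgTensor

instance : NonUnitalRing (AlgTensor B C) := inferInstanceAs (NonUnitalRing (B ⊗[ℂ] C))
instance : Module ℂ (AlgTensor B C) := inferInstanceAs (Module ℂ (B ⊗[ℂ] C))
instance : IsScalarTower ℂ (AlgTensor B C) (AlgTensor B C) :=
  inferInstanceAs (IsScalarTower ℂ (B ⊗[ℂ] C) (B ⊗[ℂ] C))
instance : SMulCommClass ℂ (AlgTensor B C) (AlgTensor B C) :=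
  inferInstanceAs (SMulCommClass ℂ (B ⊗[ℂ] C) (B ⊗[ℂ] C))
instance : StarAddMonoid (AlgTensor B C) := inferInstanceAs (StarAddMonoid (B ⊗[ℂ] C))
instance : StarModule ℂ (AlgTensor B C) := inferInstanceAs (StarModule ℂ (B ⊗[ℂ] C))

/-- The elementary tensor `b ⊗ c`. -/
def tmul (b : B) (c : C) : AlgTensor B C := b ⊗ₜ[ℂ] c

theorem tmul_mul_tmul (b b' : B) (c c' : C) :
    tmul b c * tmul b' c' = tmul (b * b') (c * c') :=
  Algebra.TensorProduct.tmul_mul_tmul b b' c c'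

theorem star_tmul (b : B) (c : C) : star (tmul b c) = tmul (star b) (star c) :=
  TensorProduct.star_tmul b c

theorem induction {p : AlgTensor B C → Prop} (h0 : p 0) (ht : ∀ b c, p (tmul b c))
    (ha : ∀ x y, p x → p y → p (x + y)) (x : AlgTensor B C) : p x :=
  TensorProduct.induction_on x h0 ht ha

instance : StarRing (AlgTensor B C) where
  star_mul x y := by
    induction x using induction with
    | h0 => simp
    | ha x x' hx hx' => rw [add_mul, star_add, hx, hx', star_add, mul_add]
    | ht b c =>
      induction y using induction with
      | h0 => simp
      | ha y y' hy hy' => rw [mul_add, star_add, hy, hy', star_add, add_mul]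
      | ht b' c' => simp only [tmul_mul_tmul, star_tmul, star_mul]
  star_add := star_add

/-- The map `σ ⊙ id` on algebraic tensor products. -/
def mapLeft (σ : B →⋆ₙₐ[ℂ] B) : AlgTensor B C →ₗ[ℂ] AlgTensor B C :=
  TensorProduct.map (σ : B →ₗ[ℂ] B) LinearMap.id

theorem mapLeft_tmul (σ : B →⋆ₙₐ[ℂ] B) (b : B) (c : C) :
    mapLeft σ (tmul b c) = tmul (σ b) c := rfl

theorem mapLeft_mul (σ : B →⋆ₙₐ[ℂ] B) (x y : AlgTensor B C) :
    mapLeft σ (x * y) = mapLeft σ x * mapLeft σ y := by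
  induction x using induction with
  | h0 => simp
  | ha x x' hx hx' => rw [add_mul, map_add, hx, hx', map_add, add_mul]
  | ht b c =>
    induction y using induction with
    | h0 => simp
    | ha y y' hy hy' => rw [mul_add, map_add, hy, hy', map_add, mul_add]
    | ht b' c' => simp only [tmul_mul_tmul, mapLeft_tmul, map_mul]

theorem mapLeft_star (σ : B →⋆ₙₐ[ℂ] B) (x : AlgTensor B C) :
    mapLeft σ (star x) = star (mapLeft σ x) := by
  induction x using induction with
  | h0 => simp
  | ha x x' hx hx' => rw [star_add, map_add, hx, hx', map_add, star_add]
  | ht b c => simp only [star_tmul, mapLeft_tmul, map_star]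

/-- A C⋆-seminorm on the ⋆-algebra `B ⊙ C`. (The bound on elementary tensors in fact holds for
every C⋆-seminorm; it is recorded since it makes the maximal C⋆-norm visibly finite.) -/
structure IsCStarSeminorm (p : Seminorm ℂ (AlgTensor B C)) : Prop where
  mul_le : ∀ x y, p (x * y) ≤ p x * p y
  star_mul_self : ∀ x, p (star x * x) = p x ^ 2
  tmul_le : ∀ b c, p (tmul b c) ≤ ‖b‖ * ‖c‖

theorem isCStarSeminorm_zero : IsCStarSeminorm (0 : Seminorm ℂ (AlgTensor B C)) where
  mul_le x y := by simp
  star_mul_self x := by simp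
  tmul_le b c := by simp only [zero_apply]; positivity

theorem IsCStarSeminorm.apply_star {p : Seminorm ℂ (AlgTensor B C)} (hp : IsCStarSeminorm p)
    (x : AlgTensor B C) : p (star x) = p x := by
  have key : ∀ y, p y ≤ p (star y) := fun y => by
    by_contra! h
    have h1 := hp.star_mul_self y
    have h2 := hp.mul_le (star y) y
    nlinarith [apply_nonneg p y, apply_nonneg p (star y)]
  exact le_antisymm (by simpa using key (star x)) (key x)

theorem IsCStarSeminorm.comp_mapLeft {p : Seminorm ℂ (AlgTensor B C)} (hp : IsCStarSeminorm p)
    (σ : B →⋆ₙₐ[ℂ] B) : IsCStarSeminorm (p.comp (mapLeft σ)) where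
  mul_le x y := by simp only [Seminorm.comp_apply, mapLeft_mul]; exact hp.mul_le _ _
  star_mul_self x := by
    simp only [Seminorm.comp_apply, mapLeft_mul, mapLeft_star]; exact hp.star_mul_self _
  tmul_le b c := by
    simp only [Seminorm.comp_apply, mapLeft_tmul]
    refine (hp.tmul_le _ _).trans ?_
    gcongr
    exact NonUnitalStarAlgHom.norm_apply_le σ b

variable (B C) in
/-- The type of C⋆-seminorms on `B ⊙ C`. -/
abbrev CStarSeminorm := {p : Seminorm ℂ (AlgTensor B C) // IsCStarSeminorm p}

instance : Nonempty (CStarSeminorm B C) := ⟨⟨0, isCStarSeminorm_zero⟩⟩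

theorem bddAbove_cstarSeminorm (x : AlgTensor B C) :
    BddAbove (Set.range fun p : CStarSeminorm B C => p.1 x) := by
  suffices h : ∃ M : ℝ, ∀ p : CStarSeminorm B C, p.1 x ≤ M by
    obtain ⟨M, hM⟩ := h
    exact ⟨M, by rintro _ ⟨p, rfl⟩; exact hM p⟩
  induction x using induction with
  | h0 => exact ⟨0, fun p => by simp⟩
  | ht b c => exact ⟨_, fun p => p.2.tmul_le b c⟩
  | ha x y hx hy =>
    obtain ⟨M, hM⟩ := hx
    obtain ⟨N, hN⟩ := hy
    exact ⟨M + N, fun p => (map_add_le_add p.1 x y).trans (add_le_add (hM p) (hN p))⟩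

/-- The maximal C⋆-norm on `B ⊙ C`: the supremum of all C⋆-seminorms. -/
def maxNorm (x : AlgTensor B C) : ℝ := ⨆ p : CStarSeminorm B C, p.1 x

theorem le_maxNorm (p : CStarSeminorm B C) (x : AlgTensor B C) : p.1 x ≤ maxNorm x :=
  le_ciSup (bddAbove_cstarSeminorm x) p

theorem maxNorm_le {x : AlgTensor B C} {M : ℝ} (h : ∀ p : CStarSeminorm B C, p.1 x ≤ M) :
    maxNorm x ≤ M := ciSup_le h

theorem maxNorm_nonneg (x : AlgTensor B C) : 0 ≤ maxNorm x :=
  le_trans (by simp) (le_maxNorm ⟨0, isCStarSeminorm_zero⟩ x)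

instance : NonUnitalSeminormedRing (AlgTensor B C) :=
  { (inferInstance : NonUnitalRing (AlgTensor B C)),
    (({ toFun := maxNorm
        map_zero' := le_antisymm (maxNorm_le fun p => by simp) (maxNorm_nonneg 0)
        add_le' := fun x y => maxNorm_le fun p =>
          (map_add_le_add p.1 x y).trans (add_le_add (le_maxNorm p x) (le_maxNorm p y))
        neg' := fun x => by simp only [maxNorm, map_neg_eq_map] } :
      AddGroupSeminorm (AlgTensor B C)).toSeminormedAddCommGroup) with
    norm_mul_le := fun x y => maxNorm_le fun p => (p.2.mul_le x y).trans
      (mul_le_mul (le_maxNorm p x) (le_maxNorm p y) (apply_nonneg _ _) (maxNorm_nonneg _)) }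

theorem norm_def (x : AlgTensor B C) : ‖x‖ = maxNorm x := rfl

instance : NormedSpace ℂ (AlgTensor B C) where
  norm_smul_le c x := maxNorm_le fun p => by
    rw [map_smul_eq_mul]
    exact mul_le_mul_of_nonneg_left (le_maxNorm p x) (norm_nonneg c)

theorem norm_tmul_le (b : B) (c : C) : ‖tmul b c‖ ≤ ‖b‖ * ‖c‖ :=
  maxNorm_le fun p => p.2.tmul_le b c

theorem norm_star (x : AlgTensor B C) : ‖star x‖ = ‖x‖ := by
  simp only [norm_def, maxNorm, fun p : CStarSeminorm B C => p.2.apply_star x]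

theorem norm_sq_le (x : AlgTensor B C) : ‖x‖ * ‖x‖ ≤ ‖star x * x‖ := by
  have h : ‖x‖ ≤ Real.sqrt ‖star x * x‖ := maxNorm_le fun p => by
    refine Real.le_sqrt_of_sq_le ?_
    rw [← p.2.star_mul_self]
    exact le_maxNorm p _
  calc ‖x‖ * ‖x‖ ≤ Real.sqrt ‖star x * x‖ * Real.sqrt ‖star x * x‖ := by gcongr
    _ = ‖star x * x‖ := Real.mul_self_sqrt (norm_nonneg _)

theorem norm_mapLeft_le (σ : B →⋆ₙₐ[ℂ] B) (x : AlgTensor B C) : ‖mapLeft σ x‖ ≤ ‖x‖ :=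
  maxNorm_le fun p => le_maxNorm ⟨_, p.2.comp_mapLeft σ⟩ x

end AlgTensor

open UniformSpace

variable (B C) in
/-- The C⋆-algebraic (maximal) tensor product of `B` and `C`: the Hausdorff completion of the
algebraic tensor product for the maximal C⋆-norm. If `B` or `C` is nuclear, as is the algebra of
compact operators, this is the unique C⋆-completion of the algebraic tensor product. -/
def CStarTensor : Type (max u v) := Completion (AlgTensor B C)

namespace CStarTensor

instance : NormedAddCommGroup (CStarTensor B C) :=
  inferInstanceAs (NormedAddCommGroup (Completion (AlgTensor B C)))
instance : NormedSpace ℂ (CStarTensor B C) :=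
  inferInstanceAs (NormedSpace ℂ (Completion (AlgTensor B C)))
instance : CompleteSpace (CStarTensor B C) :=
  inferInstanceAs (CompleteSpace (Completion (AlgTensor B C)))

/-- The canonical linear map from the algebraic tensor product to its completion. -/
def ofAlg : AlgTensor B C →L[ℂ] CStarTensor B C := Completion.toComplL

theorem norm_ofAlg (x : AlgTensor B C) : ‖ofAlg x‖ = ‖x‖ := Completion.norm_coe x

theorem isDenseInducing_ofAlg : IsDenseInducing (ofAlg : AlgTensor B C → CStarTensor B C) :=
  Completion.isDenseInducing_coe

theorem denseRange_ofAlg : DenseRange (ofAlg : AlgTensor B C → CStarTensor B C) :=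
  isDenseInducing_ofAlg.dense

/-- The elementary tensor `b ⊗ c`. -/
def tmul (b : B) (c : C) : CStarTensor B C := ofAlg (AlgTensor.tmul b c)

/-- The multiplication is the continuous extension of that of `B ⊙ C`. -/
instance : Mul (CStarTensor B C) :=
  ⟨Function.curry <| ((isDenseInducing_ofAlg (B := B) (C := C)).prodMap
    (isDenseInducing_ofAlg (B := B) (C := C))).extend
      (fun p : AlgTensor B C × AlgTensor B C => ofAlg (p.1 * p.2))⟩

/-- The adjoint is the continuous extension of that of `B ⊙ C`. -/
instance : Star (CStarTensor B C) :=
  ⟨(isDenseInducing_ofAlg (B := B) (C := C)).extend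
      (fun x : AlgTensor B C => ofAlg (star x))⟩

theorem ofAlg_mul (x y : AlgTensor B C) : ofAlg (x * y) = ofAlg x * ofAlg y :=
  (((isDenseInducing_ofAlg (B := B) (C := C)).prodMap
    (isDenseInducing_ofAlg (B := B) (C := C))).extend_eq
      (f := fun p : AlgTensor B C × AlgTensor B C => ofAlg (p.1 * p.2))
      (by fun_prop) (x, y)).symm

theorem continuous_algStar : Continuous (star : AlgTensor B C → AlgTensor B C) :=
  (AddMonoidHomClass.isometry_of_norm (starAddEquiv : AlgTensor B C ≃+ AlgTensor B C)
    AlgTensor.norm_star).continuous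

theorem ofAlg_star (x : AlgTensor B C) : ofAlg (star x) = star (ofAlg x) :=
  ((isDenseInducing_ofAlg (B := B) (C := C)).extend_eq
      (f := fun x : AlgTensor B C => ofAlg (star x))
      (ofAlg.continuous.comp continuous_algStar) x).symm

instance : ContinuousMul (CStarTensor B C) where
  continuous_mul := by
    let m : AlgTensor B C →+ AlgTensor B C →+ CStarTensor B C :=
      (AddMonoidHom.mul : AlgTensor B C →+ AlgTensor B C →+ AlgTensor B C).compr₂
        (ofAlg : AlgTensor B C →L[ℂ] CStarTensor B C).toLinearMap.toAddMonoidHom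
    have hm : Continuous fun p : AlgTensor B C × AlgTensor B C => m p.1 p.2 :=
      ofAlg.continuous.comp continuous_mul
    have di : IsDenseInducing
        ((ofAlg : AlgTensor B C →L[ℂ] CStarTensor B C).toLinearMap.toAddMonoidHom :
          AlgTensor B C → CStarTensor B C) := isDenseInducing_ofAlg
    exact di.extend_Z_bilin di hm

instance : ContinuousStar (CStarTensor B C) where
  continuous_star := by
    have h : UniformContinuous (fun x : AlgTensor B C => ofAlg (star x)) :=
      ofAlg.uniformContinuous.comp
        (AddMonoidHomClass.isometry_of_norm (starAddEquiv : AlgTensor B C ≃+ AlgTensor B C)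
          AlgTensor.norm_star).uniformContinuous
    exact (uniformContinuous_uniformly_extend
      (Completion.isUniformInducing_coe _) denseRange_ofAlg h).continuous

theorem induction {p : CStarTensor B C → Prop} (hp : IsClosed {x | p x})
    (h : ∀ x, p (ofAlg x)) (x : CStarTensor B C) : p x :=
  denseRange_ofAlg.induction_on x hp h

theorem induction₂ {p : CStarTensor B C → CStarTensor B C → Prop}
    (hp : IsClosed {x : CStarTensor B C × CStarTensor B C | p x.1 x.2})
    (h : ∀ x y, p (ofAlg x) (ofAlg y)) (x y : CStarTensor B C) : p x y :=
  denseRange_ofAlg.induction_on₂ hp h x y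

theorem induction₃ {p : CStarTensor B C → CStarTensor B C → CStarTensor B C → Prop}
    (hp : IsClosed {x : CStarTensor B C × CStarTensor B C × CStarTensor B C | p x.1 x.2.1 x.2.2})
    (h : ∀ x y z, p (ofAlg x) (ofAlg y) (ofAlg z)) (x y z : CStarTensor B C) : p x y z :=
  denseRange_ofAlg.induction_on₃ hp h x y z

instance : NonUnitalNormedRing (CStarTensor B C) :=
  { (inferInstance : NormedAddCommGroup (CStarTensor B C)),
    (inferInstance : Mul (CStarTensor B C)) with
    zero_mul := induction (isClosed_eq (by fun_prop) (by fun_prop)) fun x => by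
      rw [← map_zero ofAlg, ← ofAlg_mul, zero_mul]
    mul_zero := induction (isClosed_eq (by fun_prop) (by fun_prop)) fun x => by
      rw [← map_zero ofAlg, ← ofAlg_mul, mul_zero]
    mul_assoc := induction₃ (isClosed_eq (by fun_prop) (by fun_prop)) fun x y z => by
      simp only [← ofAlg_mul, mul_assoc]
    left_distrib := induction₃ (isClosed_eq (by fun_prop) (by fun_prop)) fun x y z => by
      simp only [← ofAlg_mul, ← map_add, mul_add]
    right_distrib := induction₃ (isClosed_eq (by fun_prop) (by fun_prop)) fun x y z => by
      simp only [← ofAlg_mul, ← map_add, add_mul]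
    norm_mul_le := induction₂ (isClosed_le (by fun_prop) (by fun_prop)) fun x y => by
      simp only [← ofAlg_mul, norm_ofAlg]
      exact norm_mul_le x y }

instance : StarRing (CStarTensor B C) where
  star_involutive := induction (isClosed_eq (by fun_prop) (by fun_prop)) fun x => by
    simp only [← ofAlg_star, star_star]
  star_mul := induction₂ (isClosed_eq (by fun_prop) (by fun_prop)) fun x y => by
    simp only [← ofAlg_star, ← ofAlg_mul, star_mul]
  star_add := induction₂ (isClosed_eq (by fun_prop) (by fun_prop)) fun x y => by
    simp only [← ofAlg_star, ← map_add, star_add]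

instance : NonUnitalCStarAlgebra (CStarTensor B C) where
  norm_mul_self_le := induction (isClosed_le (by fun_prop) (by fun_prop)) fun x => by
    simp only [← ofAlg_star, ← ofAlg_mul, norm_ofAlg]
    exact AlgTensor.norm_sq_le x
  smul_assoc c := induction₂ (isClosed_eq
      ((continuous_fst.const_smul c).mul continuous_snd)
      ((continuous_fst.mul continuous_snd).const_smul c)) fun x y => by
    simp only [smul_eq_mul, ← map_smul, ← ofAlg_mul, smul_mul_assoc]
  smul_comm c := induction₂ (isClosed_eq
      ((continuous_fst.mul continuous_snd).const_smul c)
      (continuous_fst.mul (continuous_snd.const_smul c))) fun x y => by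
    simp only [smul_eq_mul, ← map_smul, ← ofAlg_mul, mul_smul_comm]
  star_smul c := induction (isClosed_eq
      (continuous_star.comp (continuous_id.const_smul c))
      (continuous_star.const_smul (star c))) fun x => by
    simp only [← ofAlg_star, ← map_smul, star_smul]

theorem tmul_mul_tmul (b b' : B) (c c' : C) :
    tmul b c * tmul b' c' = tmul (b * b') (c * c') := by
  simp only [tmul, ← ofAlg_mul, AlgTensor.tmul_mul_tmul]

theorem star_tmul (b : B) (c : C) : star (tmul b c) = tmul (star b) (star c) := by
  simp only [tmul, ← ofAlg_star, AlgTensor.star_tmul]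

/-- `σ ⊙ id` as a contraction for the maximal norm. -/
def mapLeftAlg (σ : B →⋆ₙₐ[ℂ] B) : AlgTensor B C →L[ℂ] AlgTensor B C :=
  (AlgTensor.mapLeft σ).mkContinuous 1 fun x => by
    rw [one_mul]; exact AlgTensor.norm_mapLeft_le σ x

/-- The continuous extension of `σ ⊙ id` to `B ⊗ C`. -/
def mapLeftFun (σ : B →⋆ₙₐ[ℂ] B) : CStarTensor B C → CStarTensor B C :=
  Completion.map (mapLeftAlg σ)

theorem continuous_mapLeftFun (σ : B →⋆ₙₐ[ℂ] B) :
    Continuous (mapLeftFun σ : CStarTensor B C → CStarTensor B C) := Completion.continuous_map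

theorem mapLeftFun_ofAlg (σ : B →⋆ₙₐ[ℂ] B) (x : AlgTensor B C) :
    mapLeftFun σ (ofAlg x) = ofAlg (AlgTensor.mapLeft σ x) :=
  Completion.map_coe (mapLeftAlg σ).uniformContinuous x

/-- The ⋆-homomorphism `σ ⊗ id` on `B ⊗ C` induced by a ⋆-homomorphism `σ` of `B`. -/
def mapLeft (σ : B →⋆ₙₐ[ℂ] B) : CStarTensor B C →⋆ₙₐ[ℂ] CStarTensor B C :=
  have hc := continuous_mapLeftFun (C := C) σ
  have he := mapLeftFun_ofAlg (C := C) σ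
  { toFun := mapLeftFun σ
    map_smul' := fun c => induction (isClosed_eq (hc.comp (continuous_id.const_smul c))
        (hc.const_smul c)) fun x => by
      simp only [← map_smul, he, MonoidHom.id_apply]
    map_zero' := by rw [← map_zero ofAlg, he, map_zero]
    map_add' := induction₂ (isClosed_eq (by fun_prop) (by fun_prop)) fun x y => by
      simp only [← map_add, he]
    map_mul' := induction₂ (isClosed_eq (by fun_prop) (by fun_prop)) fun x y => by
      simp only [← ofAlg_mul, he, AlgTensor.mapLeft_mul]
    map_star' := induction (isClosed_eq (by fun_prop) (by fun_prop)) fun x => by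
      simp only [← ofAlg_star, he, AlgTensor.mapLeft_star] }

theorem mapLeft_ofAlg (σ : B →⋆ₙₐ[ℂ] B) (x : AlgTensor B C) :
    mapLeft σ (ofAlg x) = ofAlg (AlgTensor.mapLeft σ x) :=
  mapLeftFun_ofAlg σ x

theorem mapLeft_tmul (σ : B →⋆ₙₐ[ℂ] B) (b : B) (c : C) :
    mapLeft σ (tmul b c) = tmul (σ b) c := mapLeft_ofAlg σ _

theorem continuous_mapLeft (σ : B →⋆ₙₐ[ℂ] B) :
    Continuous (mapLeft σ : CStarTensor B C → CStarTensor B C) := continuous_mapLeftFun σ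

theorem tmul_induction {p : CStarTensor B C → Prop} (hp : IsClosed {x | p x})
    (ht : ∀ b c, p (tmul b c)) (h0 : p 0) (ha : ∀ x y, p x → p y → p (x + y))
    (x : CStarTensor B C) : p x := by
  refine induction hp (fun x => ?_) x
  induction x using AlgTensor.induction with
  | h0 => rwa [map_zero]
  | ht b c => exact ht b c
  | ha x y hx hy => rw [map_add]; exact ha _ _ hx hy

theorem mapLeft_mapLeft (σ τ : B →⋆ₙₐ[ℂ] B) (x : CStarTensor B C) :
    mapLeft σ (mapLeft τ x) = mapLeft (σ.comp τ) x := by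
  induction x using tmul_induction with
  | hp =>
    have h1 := (continuous_mapLeft (C := C) σ).comp (continuous_mapLeft τ)
    exact isClosed_eq h1 (continuous_mapLeft (σ.comp τ))
  | ht b c => simp only [mapLeft_tmul, NonUnitalStarAlgHom.comp_apply]
  | h0 => simp only [map_zero]
  | ha x y hx hy => simp only [map_add, hx, hy]

theorem mapLeft_of_eq_id {σ : B →⋆ₙₐ[ℂ] B} (h : ∀ b, σ b = b) (x : CStarTensor B C) :
    mapLeft σ x = x := by
  induction x using tmul_induction with
  | hp => exact isClosed_eq (continuous_mapLeft (C := C) σ) continuous_id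
  | ht b c => rw [mapLeft_tmul, h]
  | h0 => simp only [map_zero]
  | ha x y hx hy => simp only [map_add, hx, hy]

variable (C) in
/-- The automorphism `σ ⊗ id` of `B ⊗ C` induced by an automorphism `σ` of `B`. -/
def congrLeft (σ : B ≃⋆ₐ[ℂ] B) : CStarTensor B C ≃⋆ₐ[ℂ] CStarTensor B C :=
  StarAlgEquiv.ofBijective (mapLeft (σ : B →⋆ₙₐ[ℂ] B))
    (Function.bijective_iff_has_inverse.2 ⟨mapLeft (σ.symm : B →⋆ₙₐ[ℂ] B),
      fun x => by rw [mapLeft_mapLeft]; exact mapLeft_of_eq_id (fun b => by simp) x,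
      fun x => by rw [mapLeft_mapLeft]; exact mapLeft_of_eq_id (fun b => by simp) x⟩)

theorem congrLeft_apply (σ : B ≃⋆ₐ[ℂ] B) (x : CStarTensor B C) :
    congrLeft C σ x = mapLeft (σ : B →⋆ₙₐ[ℂ] B) x := rfl

theorem congrLeft_tmul (σ : B ≃⋆ₐ[ℂ] B) (b : B) (c : C) :
    congrLeft C σ (tmul b c) = tmul (σ b) c := mapLeft_tmul _ b c

end CStarTensor
end Tensor

/-! ### Actions on C⋆-algebras -/

/-- An action of `G` on a C⋆-algebra `D`: a point-norm continuous homomorphism from `G` to the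
group of ⋆-automorphisms of `D`. -/
structure CStarAction (G : Type u) (D : Type v) [Group G] [TopologicalSpace G]
    [NonUnitalCStarAlgebra D] where
  /-- the homomorphism `G → Aut(D)` -/
  aut : G →* (D ≃⋆ₐ[ℂ] D)
  continuous_apply : ∀ d : D, Continuous fun g => aut g d

section Actions

variable {G : Type u} [Group G] [TopologicalSpace G]
variable {D : Type v} [NonUnitalCStarAlgebra D]

theorem norm_aut (s : D ≃⋆ₐ[ℂ] D) (d : D) : ‖s d‖ = ‖d‖ := by
  refine le_antisymm (NonUnitalStarAlgHom.norm_apply_le (s : D →⋆ₙₐ[ℂ] D) d) ?_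
  simpa using NonUnitalStarAlgHom.norm_apply_le (s.symm : D →⋆ₙₐ[ℂ] D) (s d)

theorem isometry_aut (s : D ≃⋆ₐ[ℂ] D) : Isometry s :=
  AddMonoidHomClass.isometry_of_norm s (norm_aut s)

theorem CStarAction.continuous_uncurry (δ : CStarAction G D) :
    Continuous fun p : G × D => δ.aut p.1 p.2 := by
  rw [continuous_iff_continuousAt]
  rintro ⟨g, d⟩
  rw [ContinuousAt, tendsto_iff_dist_tendsto_zero]
  have h1 : Filter.Tendsto (fun p : G × D => dist p.2 d + dist (δ.aut p.1 d) (δ.aut g d))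
      (nhds (g, d)) (nhds 0) := by
    have h : Continuous fun p : G × D => dist p.2 d + dist (δ.aut p.1 d) (δ.aut g d) :=
      (continuous_snd.dist continuous_const).add
        (((δ.continuous_apply d).comp continuous_fst).dist continuous_const)
    simpa using h.tendsto (g, d)
  refine squeeze_zero (fun _ => dist_nonneg) (fun p => ?_) h1
  calc dist (δ.aut p.1 p.2) (δ.aut g d)
      ≤ dist (δ.aut p.1 p.2) (δ.aut p.1 d) + dist (δ.aut p.1 d) (δ.aut g d) := dist_triangle _ _ _
    _ = _ := by rw [(isometry_aut (δ.aut p.1)).dist_eq]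

/-- The stabilization `B ⊗ 𝓚` of a C⋆-algebra. -/
abbrev Stab (B : Type v) [NonUnitalCStarAlgebra B] : Type v := CStarTensor B Compacts

/-- The action `β ⊗ id_𝓚` on `B ⊗ 𝓚`. -/
def CStarAction.stab (β : CStarAction G D) : CStarAction G (Stab D) where
  aut :=
    { toFun := fun g => CStarTensor.congrLeft Compacts (β.aut g)
      map_one' := by
        ext x
        exact CStarTensor.mapLeft_of_eq_id (fun b => by simp) x
      map_mul' := fun g h => by
        ext x
        rw [StarAlgEquiv.mul_apply, CStarTensor.congrLeft_apply, CStarTensor.congrLeft_apply,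
          CStarTensor.congrLeft_apply, CStarTensor.mapLeft_mapLeft, map_mul]
        rfl }
  continuous_apply x := by
    change Continuous fun g => CStarTensor.congrLeft Compacts (β.aut g) x
    induction x using CStarTensor.tmul_induction with
    | hp =>
      let e : Stab D → G → Stab D := fun x g => CStarTensor.congrLeft Compacts (β.aut g) x
      refine isClosed_of_closure_subset fun x hx => ?_
      rw [Metric.mem_closure_iff] at hx
      refine continuous_of_uniform_approx_of_continuous (f := e x) fun u hu => ?_
      obtain ⟨ε, hε, hu⟩ := Metric.mem_uniformity_dist.1 hu
      obtain ⟨y, hy, hxy⟩ := hx ε hε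
      refine ⟨e y, hy, fun g => hu ?_⟩
      rwa [(isometry_aut _).dist_eq]
    | ht b c =>
      simp only [CStarTensor.congrLeft_tmul]
      have h : Continuous fun b : D => AlgTensor.tmul b c := by
        let f : D →ₗ[ℂ] AlgTensor D Compacts := (TensorProduct.mk ℂ D Compacts).flip c
        exact (f.mkContinuous ‖c‖ fun b => by
          rw [mul_comm]; exact AlgTensor.norm_tmul_le b c).continuous
      exact CStarTensor.ofAlg.continuous.comp (h.comp (β.continuous_apply b))
    | h0 => simp only [map_zero]; exact continuous_const
    | ha x y hx hy => simp only [map_add]; exact hx.add hy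

/-- The C⋆-algebra `D[0,1]` of continuous functions `[0,1] → D`. -/
abbrev Cyl (D : Type v) [NonUnitalCStarAlgebra D] : Type v := C(unitInterval, D)

/-- The automorphism `f ↦ s ∘ f` of `D[0,1]`. -/
def cylAut (s : D ≃⋆ₐ[ℂ] D) : Cyl D ≃⋆ₐ[ℂ] Cyl D where
  toFun f := ⟨fun t => s (f t), (isometry_aut s).continuous.comp f.continuous⟩
  invFun f := ⟨fun t => s.symm (f t), (isometry_aut s.symm).continuous.comp f.continuous⟩
  left_inv f := by ext t; simp
  right_inv f := by ext t; simp
  map_mul' f g := by ext t; simp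
  map_add' f g := by ext t; simp
  map_star' f := by ext t; simp [map_star]
  map_smul' c f := by ext t; simp [map_smul]

/-- The action `δ[0,1]` on `D[0,1]`, given pointwise by `δ`. -/
def CStarAction.cyl (δ : CStarAction G D) : CStarAction G (Cyl D) where
  aut :=
    { toFun := fun g => cylAut (δ.aut g)
      map_one' := by ext f t; simp [cylAut]
      map_mul' := fun g h => by ext f t; simp [cylAut] }
  continuous_apply f := by
    refine ContinuousMap.continuous_of_continuous_uncurry _ ?_
    exact δ.continuous_uncurry.comp
      (continuous_fst.prodMk (f.continuous.comp continuous_snd))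

/-! ### Multipliers -/

/-- The canonical extension of an automorphism `s` of `D` to the multiplier algebra:
`s(m) d = s(m s⁻¹(d))` and `d s(m) = s(s⁻¹(d) m)`. -/
def multAut (s : D ≃⋆ₐ[ℂ] D) (m : 𝓜(ℂ, D)) : 𝓜(ℂ, D) where
  fst :=
    { toFun := fun d => s (m.fst (s.symm d))
      map_add' := by simp
      map_smul' := by simp [map_smul]
      cont := (isometry_aut s).continuous.comp
        (m.fst.continuous.comp (isometry_aut s.symm).continuous) }
  snd :=
    { toFun := fun d => s (m.snd (s.symm d))
      map_add' := by simp
      map_smul' := by simp [map_smul]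
      cont := (isometry_aut s).continuous.comp
        (m.snd.continuous.comp (isometry_aut s.symm).continuous) }
  central x y := by
    have h := congr_arg s (m.central (s.symm x) (s.symm y))
    rw [map_mul, map_mul, s.apply_symm_apply, s.apply_symm_apply] at h
    exact h

theorem mult_ext {m n : 𝓜(ℂ, D)} (h1 : ∀ d, m.fst d = n.fst d) (h2 : ∀ d, m.snd d = n.snd d) :
    m = n :=
  DoubleCentralizer.ext _ _ _ _
    (Prod.ext (ContinuousLinearMap.ext h1) (ContinuousLinearMap.ext h2))

theorem mult_fst_mul (m : 𝓜(ℂ, D)) (x y : D) : m.fst (x * y) = m.fst x * y := by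
  rw [← sub_eq_zero, ← CStarRing.star_mul_self_eq_zero_iff, mul_sub, sub_eq_zero,
    ← mul_assoc, ← m.central, ← m.central, mul_assoc]

theorem mult_snd_mul (m : 𝓜(ℂ, D)) (x y : D) : m.snd (x * y) = x * m.snd y := by
  rw [← sub_eq_zero, ← CStarRing.mul_star_self_eq_zero_iff, sub_mul, sub_eq_zero,
    mul_assoc, m.central, m.central, mul_assoc]

theorem multAut_fst (s : D ≃⋆ₐ[ℂ] D) (m : 𝓜(ℂ, D)) (d : D) :
    (multAut s m).fst d = s (m.fst (s.symm d)) := rfl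

theorem multAut_snd (s : D ≃⋆ₐ[ℂ] D) (m : 𝓜(ℂ, D)) (d : D) :
    (multAut s m).snd d = s (m.snd (s.symm d)) := rfl

theorem multAut_mul (s : D ≃⋆ₐ[ℂ] D) (m n : 𝓜(ℂ, D)) :
    multAut s (m * n) = multAut s m * multAut s n := by
  refine mult_ext (fun d => ?_) fun d => ?_
  · change s (m.fst (n.fst (s.symm d))) = s (m.fst (s.symm (s (n.fst (s.symm d)))))
    rw [s.symm_apply_apply]
  · change s (n.snd (m.snd (s.symm d))) = s (n.snd (s.symm (s (m.snd (s.symm d)))))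
    rw [s.symm_apply_apply]

theorem multAut_add (s : D ≃⋆ₐ[ℂ] D) (m n : 𝓜(ℂ, D)) :
    multAut s (m + n) = multAut s m + multAut s n :=
  mult_ext (fun d => map_add s (m.fst (s.symm d)) (n.fst (s.symm d)))
    fun d => map_add s (m.snd (s.symm d)) (n.snd (s.symm d))

theorem multAut_one (s : D ≃⋆ₐ[ℂ] D) : multAut s (1 : 𝓜(ℂ, D)) = 1 :=
  mult_ext s.apply_symm_apply s.apply_symm_apply

theorem multAut_zero (s : D ≃⋆ₐ[ℂ] D) : multAut s (0 : 𝓜(ℂ, D)) = 0 :=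
  mult_ext (fun _ => map_zero s) fun _ => map_zero s

theorem multAut_star (s : D ≃⋆ₐ[ℂ] D) (m : 𝓜(ℂ, D)) :
    multAut s (star m) = star (multAut s m) := by
  refine mult_ext (fun d => ?_) fun d => ?_
  · have h : s.symm (star d) = star (s.symm d) := map_star s.symm d
    change s (star (m.snd (star (s.symm d)))) = star (s (m.snd (s.symm (star d))))
    rw [h]
    exact map_star s (m.snd (star (s.symm d)))
  · have h : s.symm (star d) = star (s.symm d) := map_star s.symm d
    change s (star (m.fst (star (s.symm d)))) = star (s (m.fst (s.symm (star d))))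
    rw [h]
    exact map_star s (m.fst (star (s.symm d)))

/-- A map `u : X → 𝓜(D)` is strictly continuous: `x ↦ u x * d` and `x ↦ d * u x` are
norm-continuous for every `d : D`. -/
def StrictlyContinuous {X : Type*} [TopologicalSpace X] (u : X → 𝓜(ℂ, D)) : Prop :=
  ∀ d : D, Continuous (fun x => (u x).fst d) ∧ Continuous (fun x => (u x).snd d)

/-- The multiplier `m` lies in the ideal `D` of `𝓜(D)`. -/
def InIdeal (m : 𝓜(ℂ, D)) : Prop := ∃ d : D, m = (d : 𝓜(ℂ, D))

end Actions

/-! ### Cocycle representations and Cuntz pairs -/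

section Pairs

variable {G : Type u} [Group G] [TopologicalSpace G]
variable {A : Type v} [NonUnitalCStarAlgebra A] {D : Type w} [NonUnitalCStarAlgebra D]

/-- A cocycle representation `(φ, u) : (A, α) → (𝓜(D), δ)`: a ⋆-homomorphism `φ : A → 𝓜(D)` and a
strictly continuous unitary `δ`-cocycle `u` with `Ad(u_g) ∘ δ_g ∘ φ = φ ∘ α_g` for all `g`. -/
structure CocycleRep (α : CStarAction G A) (δ : CStarAction G D) where
  /-- the ⋆-homomorphism -/
  hom : A →⋆ₙₐ[ℂ] 𝓜(ℂ, D)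
  /-- the cocycle -/
  cocycle : G → 𝓜(ℂ, D)
  cocycle_unitary : ∀ g, cocycle g ∈ unitary 𝓜(ℂ, D)
  cocycle_continuous : StrictlyContinuous cocycle
  cocycle_mul : ∀ g h, cocycle (g * h) = cocycle g * multAut (δ.aut g) (cocycle h)
  covariant : ∀ g a,
    cocycle g * multAut (δ.aut g) (hom a) * star (cocycle g) = hom (α.aut g a)

/-- A pair of cocycle representations `(φ, u), (ψ, v) : (A, α) → (𝓜(D), δ)` whose pointwise
differences `φ - ψ` and `u - v` take values in `D`. -/
structure PairIn (α : CStarAction G A) (δ : CStarAction G D) where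
  /-- the first cocycle representation -/
  fst : CocycleRep α δ
  /-- the second cocycle representation -/
  snd : CocycleRep α δ
  hom_sub : ∀ a, InIdeal (fst.hom a - snd.hom a)
  cocycle_sub : ∀ g, InIdeal (fst.cocycle g - snd.cocycle g)

/-- Two isometries in the fixed point algebra `𝓜(D)^δ` whose range projections add up to `1`,
i.e. the generators of a unital copy of the Cuntz algebra `𝓞₂`. -/
structure CuntzIsometries (δ : CStarAction G D) where
  t₁ : 𝓜(ℂ, D)
  t₂ : 𝓜(ℂ, D)
  fixed₁ : ∀ g, multAut (δ.aut g) t₁ = t₁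
  fixed₂ : ∀ g, multAut (δ.aut g) t₂ = t₂
  isometry₁ : star t₁ * t₁ = 1
  isometry₂ : star t₂ * t₂ = 1
  sum_range : t₁ * star t₁ + t₂ * star t₂ = 1

variable {α : CStarAction G A} {δ : CStarAction G D}

namespace CuntzIsometries

variable (T : CuntzIsometries δ)

/-- The Cuntz sum `t₁ m t₁* + t₂ n t₂*` of two multipliers. -/
def sum (m n : 𝓜(ℂ, D)) : 𝓜(ℂ, D) := T.t₁ * m * star T.t₁ + T.t₂ * n * star T.t₂

theorem orth₁₂ : star T.t₁ * T.t₂ = 0 := by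
  have h : star T.t₁ * (T.t₁ * star T.t₁ + T.t₂ * star T.t₂) * T.t₂ = star T.t₁ * T.t₂ := by
    rw [T.sum_range, mul_one]
  have h' : star T.t₁ * (T.t₁ * star T.t₁ + T.t₂ * star T.t₂) * T.t₂
      = (star T.t₁ * T.t₁) * (star T.t₁ * T.t₂) + (star T.t₁ * T.t₂) * (star T.t₂ * T.t₂) := by
    noncomm_ring
  rw [h', T.isometry₁, T.isometry₂, one_mul, mul_one] at h
  simpa using h

theorem orth₂₁ : star T.t₂ * T.t₁ = 0 := by
  have h := congr_arg star T.orth₁₂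
  simpa using h

theorem sum_mul_sum (m n m' n' : 𝓜(ℂ, D)) :
    T.sum m n * T.sum m' n' = T.sum (m * m') (n * n') := by
  have h : T.sum m n * T.sum m' n'
      = T.t₁ * m * (star T.t₁ * T.t₁) * m' * star T.t₁
        + T.t₁ * m * (star T.t₁ * T.t₂) * n' * star T.t₂
        + T.t₂ * n * (star T.t₂ * T.t₁) * m' * star T.t₁
        + T.t₂ * n * (star T.t₂ * T.t₂) * n' * star T.t₂ := by
    simp only [sum]; noncomm_ring
  rw [h, T.isometry₁, T.isometry₂, T.orth₁₂, T.orth₂₁]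
  simp only [sum]; noncomm_ring

theorem star_sum (m n : 𝓜(ℂ, D)) : star (T.sum m n) = T.sum (star m) (star n) := by
  simp only [sum, star_add, star_mul, star_star, mul_assoc]

theorem sum_one : T.sum 1 1 = 1 := by simp only [sum, mul_one, T.sum_range]

theorem sum_sub (m n m' n' : 𝓜(ℂ, D)) :
    T.sum m n - T.sum m' n' = T.sum (m - m') (n - n') := by
  simp only [sum]; noncomm_ring

theorem multAut_sum (g : G) (m n : 𝓜(ℂ, D)) :
    multAut (δ.aut g) (T.sum m n) = T.sum (multAut (δ.aut g) m) (multAut (δ.aut g) n) := by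
  simp only [sum, multAut_add, multAut_mul, multAut_star, T.fixed₁, T.fixed₂]

theorem inIdeal_sum {m n : 𝓜(ℂ, D)} (hm : InIdeal m) (hn : InIdeal n) : InIdeal (T.sum m n) := by
  obtain ⟨c, rfl⟩ := hm
  obtain ⟨d, rfl⟩ := hn
  have key : ∀ (t : 𝓜(ℂ, D)) (c : D), t * (c : 𝓜(ℂ, D)) * star t
      = ((t.fst ((star t).snd c) : D) : 𝓜(ℂ, D)) := by
    intro t c
    refine mult_ext (fun d => ?_) fun d => ?_
    · change t.fst (c * (star t).fst d) = t.fst ((star t).snd c) * d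
      rw [← (star t).central, mult_fst_mul]
    · change (star t).snd (t.snd d * c) = d * t.fst ((star t).snd c)
      rw [mult_snd_mul, t.central]
  refine ⟨T.t₁.fst ((star T.t₁).snd c) + T.t₂.fst ((star T.t₂).snd d), ?_⟩
  rw [sum, key, key]
  exact (map_add (DoubleCentralizer.coeHom (𝕜 := ℂ) (A := D)) _ _).symm

theorem strictlyContinuous_sum {X : Type*} [TopologicalSpace X] {u v : X → 𝓜(ℂ, D)}
    (hu : StrictlyContinuous u) (hv : StrictlyContinuous v) :
    StrictlyContinuous fun x => T.sum (u x) (v x) := by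
  intro d
  constructor
  · exact (T.t₁.fst.continuous.comp (hu ((star T.t₁).fst d)).1).add
      (T.t₂.fst.continuous.comp (hv ((star T.t₂).fst d)).1)
  · exact ((star T.t₁).snd.continuous.comp (hu (T.t₁.snd d)).2).add
      ((star T.t₂).snd.continuous.comp (hv (T.t₂.snd d)).2)

end CuntzIsometries

/-- The Cuntz sum of two cocycle representations with respect to `t₁, t₂`. -/
def CocycleRep.cuntzSum (T : CuntzIsometries δ) (x y : CocycleRep α δ) : CocycleRep α δ where
  hom :=
    { toFun := fun a => T.sum (x.hom a) (y.hom a)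
      map_smul' := fun c a => by
        simp only [map_smul, CuntzIsometries.sum, MonoidHom.id_apply, smul_add,
          mul_smul_comm, smul_mul_assoc]
      map_zero' := by simp [CuntzIsometries.sum]
      map_add' := fun a b => by
        simp only [map_add, CuntzIsometries.sum]; noncomm_ring
      map_mul' := fun a b => by simp only [map_mul, T.sum_mul_sum]
      map_star' := fun a => by simp only [map_star, T.star_sum] }
  cocycle g := T.sum (x.cocycle g) (y.cocycle g)
  cocycle_unitary g := by
    have hx := Unitary.mem_iff.1 (x.cocycle_unitary g)
    have hy := Unitary.mem_iff.1 (y.cocycle_unitary g)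
    rw [Unitary.mem_iff]
    constructor
    · rw [T.star_sum, T.sum_mul_sum, hx.1, hy.1, T.sum_one]
    · rw [T.star_sum, T.sum_mul_sum, hx.2, hy.2, T.sum_one]
  cocycle_continuous := T.strictlyContinuous_sum x.cocycle_continuous y.cocycle_continuous
  cocycle_mul g h := by
    rw [T.multAut_sum, T.sum_mul_sum, x.cocycle_mul, y.cocycle_mul]
  covariant g a := by
    change T.sum _ _ * multAut _ (T.sum (x.hom a) (y.hom a)) * star (T.sum _ _)
      = T.sum (x.hom (α.aut g a)) (y.hom (α.aut g a))
    rw [T.multAut_sum, T.star_sum, T.sum_mul_sum, T.sum_mul_sum, x.covariant, y.covariant]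

/-- The Cuntz sum `x ⊕ y` of two pairs with respect to `t₁, t₂`. -/
def PairIn.cuntzSum (T : CuntzIsometries δ) (x y : PairIn α δ) : PairIn α δ where
  fst := x.fst.cuntzSum T y.fst
  snd := x.snd.cuntzSum T y.snd
  hom_sub a := by
    change InIdeal (T.sum _ _ - T.sum _ _)
    rw [T.sum_sub]; exact T.inIdeal_sum (x.hom_sub a) (y.hom_sub a)
  cocycle_sub g := by
    change InIdeal (T.sum _ _ - T.sum _ _)
    rw [T.sum_sub]; exact T.inIdeal_sum (x.cocycle_sub g) (y.cocycle_sub g)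

theorem inIdeal_zero : InIdeal (0 : 𝓜(ℂ, D)) :=
  ⟨0, (map_zero (DoubleCentralizer.coeHom (𝕜 := ℂ) (A := D))).symm⟩

/-- The cocycle representation `(0, u)` associated with `(φ, u)`. -/
def CocycleRep.cocyclePart (x : CocycleRep α δ) : CocycleRep α δ where
  hom := 0
  cocycle := x.cocycle
  cocycle_unitary := x.cocycle_unitary
  cocycle_continuous := x.cocycle_continuous
  cocycle_mul := x.cocycle_mul
  covariant g a := by simp [multAut_zero]

variable (α δ) in
/-- The zero representation `(0, 1)`. -/
def CocycleRep.trivial : CocycleRep α δ where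
  hom := 0
  cocycle _ := 1
  cocycle_unitary _ := one_mem _
  cocycle_continuous _ := ⟨continuous_const, continuous_const⟩
  cocycle_mul g h := by rw [multAut_one, mul_one]
  covariant g a := by simp [multAut_zero]

/-- The cocycle pair `((0, u), (0, v))` associated with a pair `((φ, u), (ψ, v))`. -/
def PairIn.cocyclePart (x : PairIn α δ) : PairIn α δ where
  fst := x.fst.cocyclePart
  snd := x.snd.cocyclePart
  hom_sub a := by simpa [CocycleRep.cocyclePart] using inIdeal_zero
  cocycle_sub := x.cocycle_sub

variable (α δ) in
/-- The trivial pair `((0, 1), (0, 1))`. -/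
def PairIn.trivial : PairIn α δ where
  fst := CocycleRep.trivial α δ
  snd := CocycleRep.trivial α δ
  hom_sub a := by rw [sub_self]; exact inIdeal_zero
  cocycle_sub g := by rw [sub_self]; exact inIdeal_zero

/-- A cocycle pair is a pair whose two ⋆-homomorphisms vanish. -/
def PairIn.IsCocyclePair (x : PairIn α δ) : Prop := x.fst.hom = 0 ∧ x.snd.hom = 0

/-! ### Homotopy -/

/-- Evaluation at `t` maps the multiplier `m` of `D[0,1]` to the multiplier `n` of `D`, i.e. `n` is
the image of `m` under the extension `𝓜(D[0,1]) → 𝓜(D)` of the surjection `f ↦ f t`. -/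
def EvaluatesTo (t : unitInterval) (m : 𝓜(ℂ, Cyl D)) (n : 𝓜(ℂ, D)) : Prop :=
  ∀ f : Cyl D, (m.fst f) t = n.fst (f t) ∧ (m.snd f) t = n.snd (f t)

/-- A cocycle representation in `𝓜(D[0,1])` restricts to one in `𝓜(D)` upon evaluation at `t`. -/
def CocycleRep.RestrictsTo (t : unitInterval) (X : CocycleRep α δ.cyl) (x : CocycleRep α δ) :
    Prop :=
  (∀ a, EvaluatesTo t (X.hom a) (x.hom a)) ∧ ∀ g, EvaluatesTo t (X.cocycle g) (x.cocycle g)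

/-- Two pairs `x₀, x₁` with values in `𝓜(D)` are homotopic if there is a pair with values in
`𝓜(D[0,1])` that restricts to `x₀` at `0` and to `x₁` at `1`. -/
def PairIn.Homotopic (x₀ x₁ : PairIn α δ) : Prop :=
  ∃ X : PairIn α δ.cyl,
    (X.fst.RestrictsTo 0 x₀.fst ∧ X.snd.RestrictsTo 0 x₀.snd) ∧
    (X.fst.RestrictsTo 1 x₁.fst ∧ X.snd.RestrictsTo 1 x₁.snd)

/-- A pair is anchored if its associated cocycle pair is homotopic to the trivial one. -/
def PairIn.IsAnchored (x : PairIn α δ) : Prop := x.cocyclePart.Homotopic (PairIn.trivial α δ)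

/-- Thomsen's relation: `x ∼ y` if `x ⊕ d₁` and `y ⊕ d₂` are homotopic for some cocycle pairs
`d₁, d₂`. -/
def PairIn.ThomsenEquiv (x y : PairIn α δ) : Prop :=
  ∃ (T : CuntzIsometries δ) (d₁ d₂ : PairIn α δ), d₁.IsCocyclePair ∧ d₂.IsCocyclePair ∧
    (x.cuntzSum T d₁).Homotopic (y.cuntzSum T d₂)

end Pairs

section KK

variable {G : Type u} [Group G] [TopologicalSpace G]
variable {A : Type v} [NonUnitalCStarAlgebra A] {B : Type w} [NonUnitalCStarAlgebra B]

/-- The set `𝔼^G(α, β)` of `(α, β)`-Cuntz pairs, with values in `𝓜(B ⊗ 𝓚)`. Under the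
identification `B[0,1] ⊗ 𝓚 = (B ⊗ 𝓚)[0,1]`, the relation `PairIn.Homotopic` on it is given by
elements of `𝔼^G(α, β[0,1])`. -/
abbrev CuntzPair (α : CStarAction G A) (β : CStarAction G B) := PairIn α β.stab

/-- The set `𝔼₀^G(α, β)` of anchored `(α, β)`-Cuntz pairs. -/
abbrev AnchoredPair (α : CStarAction G A) (β : CStarAction G B) :=
  {x : CuntzPair α β // x.IsAnchored}

/-- The quotient of `𝔼^G(α, β)` by homotopy. -/
abbrev HomotopyClasses (α : CStarAction G A) (β : CStarAction G B) :=
  Quot (PairIn.Homotopic : CuntzPair α β → CuntzPair α β → Prop)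

/-- The quotient of `𝔼₀^G(α, β)` by homotopy (of Cuntz pairs). -/
abbrev AnchoredClasses (α : CStarAction G A) (β : CStarAction G B) :=
  Quot (fun x y : AnchoredPair α β => x.1.Homotopic y.1)

/-- The equivariant `KK`-group `KK^G(α, β)` in the Cuntz--Thomsen picture: Thomsen's quotient
`𝔼^G(α, β)/∼`. -/
abbrev KKG (α : CStarAction G A) (β : CStarAction G B) :=
  Quot (PairIn.ThomsenEquiv : CuntzPair α β → CuntzPair α β → Prop)

/-- The class of a Cuntz pair in `𝔼^G(α, β)/∼ₕ`. -/
def homotopyClass {α : CStarAction G A} {β : CStarAction G B} (x : CuntzPair α β) :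
    HomotopyClasses α β := Quot.mk _ x

/-- The class of an anchored Cuntz pair in `𝔼₀^G(α, β)/∼ₕ`. -/
def anchoredClass {α : CStarAction G A} {β : CStarAction G B} (x : AnchoredPair α β) :
    AnchoredClasses α β := Quot.mk _ x

/-- The class of a Cuntz pair in `KK^G(α, β)`. -/
def kkClass {α : CStarAction G A} {β : CStarAction G B} (x : CuntzPair α β) :
    KKG α β := Quot.mk _ x

/-- A C⋆-algebra is `σ`-unital if it has a countable approximate unit, here a sequence of positive
contractions `cₙ* cₙ`. -/
def IsSigmaUnital (B : Type w) [NonUnitalCStarAlgebra B] : Prop :=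
  ∃ c : ℕ → B, (∀ n, ‖c n‖ ≤ 1) ∧
    ∀ b, Filter.Tendsto (fun n => star (c n) * c n * b) Filter.atTop (nhds b)

end KK

end CuntzThomsen

end

open CuntzThomsen

noncomputable section

namespace CuntzThomsen

/-! ### Strict continuity -/

section Strict

variable {D : Type w} [NonUnitalCStarAlgebra D]

/-! The argument separates analysis from algebra. The analysis concerns an arbitrary action `δ` on
`D` that is absorbing in the sense of `IsAbsorbing`: its fixed multipliers contain a path of
isometries `E` degenerating to `0` at one end and equal to `1` at the other (a squeeze), and a
strictly continuous path of isometries from some `t₁` to `1`. Pairs are moved by compression `(φ, u)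
↦ (V φ V*, V u V* + 1 - V V*)`, and `PairIn.homotopic_iff` allows homotopies to be handled as paths
of pairs.

A strictly continuous path of isometries gives a homotopy of arbitrary pairs. A squeeze gives one
only for diagonal pairs `(r, r)`, since `V c V*` keeps the norm of `c` and so does not tend to `0`
with the squeeze unless `c = 0`. This is enough. Any fixed unitary `W` is joined to `1` by the path
`E W E* + 1 - E E*`, so conjugation by `W` does not change the homotopy class; hence the Cuntz sum
is independent of the isometries, commutative and associative up to homotopy. Compression by `t₁` is
the sum with the trivial pair, so the path from `t₁` to `1` makes the trivial pair neutral. Rotating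
the second entry of `x ⊕ x.swap` turns it into a diagonal pair, which the squeeze contracts to the
trivial one, so swapping the entries gives inverses.

For `β ⊗ id` on `B ⊗ 𝓚` take `t₁ = 1 ⊗ s` with `s` an isometry of `ℓ²(ℕ)` such that the powers of
`s*` tend strongly to `0` (`exists_cuntzIsometries`). The Cayley path `(S + a)(1 + a S)⁻¹` joins `S
= t₁` to `1` through fixed isometries; its strict continuity at `a = 1` is a resolvent estimate
(`tendsto_cayley`). Running through `1, S, S², …` by these steps, reparametrised to finite time, is
the squeeze (`IsFixedShift.isSqueeze`).

The algebra is then short. On the group of homotopy classes, `[((φ, u), (ψ, v))] ↦ [((0, u), (0,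
v))]` is an idempotent endomorphism `P`. Its range consists of the classes of cocycle pairs, its
kernel of the anchored classes, and Thomsen's relation is equality modulo the range
(`thomsenEquiv_iff`). For an idempotent endomorphism the kernel maps isomorphically onto the
quotient by the range, which is the comparison of anchored classes with Thomsen's quotient. -/

theorem mult_fst_apply (m n : 𝓜(ℂ, D)) (d : D) : (m * n).fst d = m.fst (n.fst d) := rfl

theorem mult_snd_apply (m n : 𝓜(ℂ, D)) (d : D) : (m * n).snd d = n.snd (m.snd d) := rfl

theorem norm_fst_apply_le (m : 𝓜(ℂ, D)) (d : D) : ‖m.fst d‖ ≤ ‖m‖ * ‖d‖ := by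
  simpa [DoubleCentralizer.norm_fst] using m.fst.le_opNorm d

theorem norm_snd_apply_le (m : 𝓜(ℂ, D)) (d : D) : ‖m.snd d‖ ≤ ‖m‖ * ‖d‖ := by
  simpa [DoubleCentralizer.norm_snd] using m.snd.le_opNorm d

/-- The norm of a double centralizer is the norm of either component, so a multiplier with vanishing
left action is zero. -/
theorem mult_ext_fst {m n : 𝓜(ℂ, D)} (h : ∀ d, m.fst d = n.fst d) : m = n := by
  rw [← sub_eq_zero, ← norm_eq_zero, ← DoubleCentralizer.norm_fst, norm_eq_zero]
  ext d
  simp [h d]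

theorem coe_injective {c d : D} (h : (c : 𝓜(ℂ, D)) = (d : 𝓜(ℂ, D))) : c = d := by
  rw [← sub_eq_zero, ← CStarRing.mul_star_self_eq_zero_iff, sub_mul, sub_eq_zero]
  exact congr_arg (fun m : 𝓜(ℂ, D) => m.fst (star (c - d))) h

theorem coe_sub (c d : D) : ((c - d : D) : 𝓜(ℂ, D)) = (c : 𝓜(ℂ, D)) - (d : 𝓜(ℂ, D)) :=
  map_sub (DoubleCentralizer.coeHom (𝕜 := ℂ) (A := D)) c d

theorem coe_add (c d : D) : ((c + d : D) : 𝓜(ℂ, D)) = (c : 𝓜(ℂ, D)) + (d : 𝓜(ℂ, D)) :=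
  map_add (DoubleCentralizer.coeHom (𝕜 := ℂ) (A := D)) c d

theorem coe_zero : ((0 : D) : 𝓜(ℂ, D)) = 0 :=
  map_zero (DoubleCentralizer.coeHom (𝕜 := ℂ) (A := D))

theorem mul_coe (m : 𝓜(ℂ, D)) (c : D) : m * (c : 𝓜(ℂ, D)) = ((m.fst c : D) : 𝓜(ℂ, D)) :=
  mult_ext_fst fun d => mult_fst_mul m c d

theorem coe_mul_mult (m : 𝓜(ℂ, D)) (c : D) : (c : 𝓜(ℂ, D)) * m = ((m.snd c : D) : 𝓜(ℂ, D)) :=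
  mult_ext_fst fun d => (m.central c d).symm

/-- Only an inequality is available, because `D` may be zero and then `1 = 0`. -/
theorem mult_norm_one_le : ‖(1 : 𝓜(ℂ, D))‖ ≤ 1 := by
  rcases subsingleton_or_nontrivial 𝓜(ℂ, D) with h | h
  · rw [Subsingleton.elim (1 : 𝓜(ℂ, D)) 0]; simp
  · exact CStarRing.norm_one.le

theorem norm_le_one_of_isometry {V : 𝓜(ℂ, D)} (h : star V * V = 1) : ‖V‖ ≤ 1 := by
  have h1 := CStarRing.norm_star_mul_self (x := V)
  rw [h] at h1
  have h2 := mult_norm_one_le (D := D)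
  nlinarith [norm_nonneg V]

theorem norm_le_one_of_unitary {V : 𝓜(ℂ, D)} (h : V ∈ unitary 𝓜(ℂ, D)) : ‖V‖ ≤ 1 :=
  norm_le_one_of_isometry (Unitary.mem_iff.1 h).1

/-- A family of multipliers that is uniformly bounded. -/
def UniformlyBounded {X : Type*} (u : X → 𝓜(ℂ, D)) : Prop := ∃ C : ℝ, ∀ x, ‖u x‖ ≤ C

namespace UniformlyBounded

variable {X : Type*} {u : X → 𝓜(ℂ, D)}

theorem const (m : 𝓜(ℂ, D)) : UniformlyBounded fun _ : X => m := ⟨‖m‖, fun _ => le_rfl⟩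

theorem star (hu : UniformlyBounded u) : UniformlyBounded fun x => star (u x) := by
  obtain ⟨C, hC⟩ := hu
  exact ⟨C, fun x => by rw [norm_star]; exact hC x⟩

theorem comp {Y : Type*} (hu : UniformlyBounded u) (f : Y → X) :
    UniformlyBounded fun y => u (f y) := by
  obtain ⟨C, hC⟩ := hu
  exact ⟨C, fun y => hC _⟩

end UniformlyBounded

variable {X : Type*} [TopologicalSpace X] {u v : X → 𝓜(ℂ, D)}

/-- The uniform bound gives `‖T y (f y) - T x (f x)‖ ≤ C ‖f y - f x‖ + ‖T y (f x) - T x (f x)‖`.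
This is the source of all joint continuity for strictly continuous families. -/
theorem continuous_of_uniform_of_pointwise {T : X → D →L[ℂ] D} {C : ℝ} (hC : ∀ x, ‖T x‖ ≤ C)
    (hT : ∀ d, Continuous fun x => T x d) {f : X → D} (hf : Continuous f) :
    Continuous fun x => T x (f x) := by
  rw [continuous_iff_continuousAt]
  intro x
  rw [ContinuousAt, tendsto_iff_dist_tendsto_zero]
  have h1 : Filter.Tendsto (fun y => C * dist (f y) (f x) + dist (T y (f x)) (T x (f x)))
      (nhds x) (nhds 0) := by
    have h : Continuous fun y => C * dist (f y) (f x) + dist (T y (f x)) (T x (f x)) :=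
      (continuous_const.mul (hf.dist continuous_const)).add ((hT (f x)).dist continuous_const)
    simpa using h.tendsto x
  refine squeeze_zero (fun _ => dist_nonneg) (fun y => ?_) h1
  refine (dist_triangle _ (T y (f x)) _).trans (add_le_add ?_ le_rfl)
  rw [dist_eq_norm, dist_eq_norm, ← map_sub]
  exact ((T y).le_opNorm _).trans (mul_le_mul_of_nonneg_right (hC y) (norm_nonneg _))

namespace StrictlyContinuous

theorem fst_apply (hu : StrictlyContinuous u) (hb : UniformlyBounded u) {f : X → D}
    (hf : Continuous f) : Continuous fun x => (u x).fst (f x) := by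
  obtain ⟨C, hC⟩ := hb
  exact continuous_of_uniform_of_pointwise (T := fun x => (u x).fst) (C := C)
    (fun x => by rw [DoubleCentralizer.norm_fst]; exact hC x) (fun d => (hu d).1) hf

theorem snd_apply (hu : StrictlyContinuous u) (hb : UniformlyBounded u) {f : X → D}
    (hf : Continuous f) : Continuous fun x => (u x).snd (f x) := by
  obtain ⟨C, hC⟩ := hb
  exact continuous_of_uniform_of_pointwise (T := fun x => (u x).snd) (C := C)
    (fun x => by rw [DoubleCentralizer.norm_snd]; exact hC x) (fun d => (hu d).2) hf

theorem const (m : 𝓜(ℂ, D)) : StrictlyContinuous fun _ : X => m :=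
  fun _ => ⟨continuous_const, continuous_const⟩

theorem star (hu : StrictlyContinuous u) : StrictlyContinuous fun x => star (u x) :=
  fun d => ⟨continuous_star.comp (hu (Star.star d)).2, continuous_star.comp (hu (Star.star d)).1⟩

theorem add (hu : StrictlyContinuous u) (hv : StrictlyContinuous v) :
    StrictlyContinuous fun x => u x + v x :=
  fun d => ⟨(hu d).1.add (hv d).1, (hu d).2.add (hv d).2⟩

theorem sub (hu : StrictlyContinuous u) (hv : StrictlyContinuous v) :
    StrictlyContinuous fun x => u x - v x :=
  fun d => ⟨(hu d).1.sub (hv d).1, (hu d).2.sub (hv d).2⟩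

theorem mul (hu : StrictlyContinuous u) (hbu : UniformlyBounded u)
    (hv : StrictlyContinuous v) (hbv : UniformlyBounded v) :
    StrictlyContinuous fun x => u x * v x :=
  fun d => ⟨hu.fst_apply hbu (hv d).1, hv.snd_apply hbv (hu d).2⟩

theorem comp {Y : Type*} [TopologicalSpace Y] (hu : StrictlyContinuous u) {f : Y → X}
    (hf : Continuous f) : StrictlyContinuous fun y => u (f y) :=
  fun d => ⟨(hu d).1.comp hf, (hu d).2.comp hf⟩

theorem of_continuous (hu : Continuous u) : StrictlyContinuous u := by
  intro d
  constructor
  · refine continuous_iff_continuousAt.2 fun x => ?_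
    rw [ContinuousAt, tendsto_iff_norm_sub_tendsto_zero]
    have h : Filter.Tendsto (fun y => ‖u y - u x‖ * ‖d‖) (nhds x) (nhds 0) := by
      have : Continuous fun y => ‖u y - u x‖ * ‖d‖ := by fun_prop
      simpa using this.tendsto x
    exact squeeze_zero (fun _ => norm_nonneg _) (fun y => norm_fst_apply_le (u y - u x) d) h
  · refine continuous_iff_continuousAt.2 fun x => ?_
    rw [ContinuousAt, tendsto_iff_norm_sub_tendsto_zero]
    have h : Filter.Tendsto (fun y => ‖u y - u x‖ * ‖d‖) (nhds x) (nhds 0) := by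
      have : Continuous fun y => ‖u y - u x‖ * ‖d‖ := by fun_prop
      simpa using this.tendsto x
    exact squeeze_zero (fun _ => norm_nonneg _) (fun y => norm_snd_apply_le (u y - u x) d) h

end StrictlyContinuous

end Strict

/-! ### Multipliers of the cylinder -/

section Cylinder

variable {D : Type w} [NonUnitalCStarAlgebra D]

namespace EvaluatesTo

variable {t : unitInterval} {m m' : 𝓜(ℂ, Cyl D)} {n n' : 𝓜(ℂ, D)}

/-- Constant functions take every value in `D` at `t`. -/
theorem unique (h : EvaluatesTo t m n) (h' : EvaluatesTo t m n') : n = n' :=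
  mult_ext_fst fun d => by
    have h1 := (h (ContinuousMap.const _ d)).1
    have h2 := (h' (ContinuousMap.const _ d)).1
    rw [h1] at h2
    exact h2

theorem zero : EvaluatesTo t (0 : 𝓜(ℂ, Cyl D)) 0 := fun _ => ⟨rfl, rfl⟩

theorem one : EvaluatesTo t (1 : 𝓜(ℂ, Cyl D)) 1 := fun _ => ⟨rfl, rfl⟩

theorem add (h : EvaluatesTo t m n) (h' : EvaluatesTo t m' n') :
    EvaluatesTo t (m + m') (n + n') := fun f =>
  ⟨congr_arg₂ (· + ·) (h f).1 (h' f).1, congr_arg₂ (· + ·) (h f).2 (h' f).2⟩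

theorem sub (h : EvaluatesTo t m n) (h' : EvaluatesTo t m' n') :
    EvaluatesTo t (m - m') (n - n') := fun f =>
  ⟨congr_arg₂ (· - ·) (h f).1 (h' f).1, congr_arg₂ (· - ·) (h f).2 (h' f).2⟩

theorem smul (c : ℂ) (h : EvaluatesTo t m n) : EvaluatesTo t (c • m) (c • n) := fun f =>
  ⟨congr_arg (c • ·) (h f).1, congr_arg (c • ·) (h f).2⟩

theorem mul (h : EvaluatesTo t m n) (h' : EvaluatesTo t m' n') :
    EvaluatesTo t (m * m') (n * n') := fun f => by
  constructor
  · rw [mult_fst_apply, mult_fst_apply, (h _).1, (h' _).1]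
  · rw [mult_snd_apply, mult_snd_apply, (h' _).2, (h _).2]

theorem star (h : EvaluatesTo t m n) : EvaluatesTo t (star m) (star n) := fun f =>
  ⟨congr_arg Star.star (h (Star.star f)).2, congr_arg Star.star (h (Star.star f)).1⟩

theorem multAut (s : D ≃⋆ₐ[ℂ] D) (h : EvaluatesTo t m n) :
    EvaluatesTo t (multAut (cylAut s) m) (multAut s n) := fun f =>
  ⟨congr_arg s (h ((cylAut s).symm f)).1, congr_arg s (h ((cylAut s).symm f)).2⟩

theorem coe (f : Cyl D) : EvaluatesTo t (f : 𝓜(ℂ, Cyl D)) ((f t : D) : 𝓜(ℂ, D)) :=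
  fun _ => ⟨rfl, rfl⟩

end EvaluatesTo

/-- The image of a multiplier of `D[0,1]` under evaluation at `t`. -/
def evalMult (t : unitInterval) (m : 𝓜(ℂ, Cyl D)) : 𝓜(ℂ, D) where
  fst :=
    { toFun := fun d => m.fst (ContinuousMap.const _ d) t
      map_add' := fun c d => by
        rw [← ContinuousMap.add_apply, ← map_add]; rfl
      map_smul' := fun c d => by
        rw [RingHom.id_apply, ← ContinuousMap.smul_apply, ← map_smul]; rfl
      cont := (continuous_eval_const t).comp
        (m.fst.continuous.comp ContinuousMap.continuous_const') }
  snd :=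
    { toFun := fun d => m.snd (ContinuousMap.const _ d) t
      map_add' := fun c d => by
        rw [← ContinuousMap.add_apply, ← map_add]; rfl
      map_smul' := fun c d => by
        rw [RingHom.id_apply, ← ContinuousMap.smul_apply, ← map_smul]; rfl
      cont := (continuous_eval_const t).comp
        (m.snd.continuous.comp ContinuousMap.continuous_const') }
  central x y := by
    have h := m.central (ContinuousMap.const _ x) (ContinuousMap.const _ y)
    exact congr_arg (fun f : Cyl D => f t) h

/-- Multipliers act locally: pairing `m f` with a constant function moves `m` onto that constant by
centrality, so the value at `t` depends on `f` only through `f t`. Taking the constant to be the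
adjoint of the error `e` yields `e* e = 0`, respectively `e e* = 0`. -/
theorem evaluatesTo_evalMult (t : unitInterval) (m : 𝓜(ℂ, Cyl D)) :
    EvaluatesTo t m (evalMult t m) := by
  intro f
  constructor
  · rw [← sub_eq_zero, ← CStarRing.star_mul_self_eq_zero_iff]
    set e := m.fst f t - (evalMult t m).fst (f t) with he
    have h1 := congr_arg (fun f : Cyl D => f t) (m.central (ContinuousMap.const _ (star e)) f)
    have h2 := congr_arg (fun f : Cyl D => f t)
      (m.central (ContinuousMap.const _ (star e)) (ContinuousMap.const _ (f t)))
    change _ = star e * m.fst f t at h1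
    change _ = star e * (evalMult t m).fst (f t) at h2
    nth_rewrite 2 [he]
    rw [mul_sub, ← h1, ← h2]
    exact sub_self _
  · rw [← sub_eq_zero, ← CStarRing.mul_star_self_eq_zero_iff]
    set e := m.snd f t - (evalMult t m).snd (f t) with he
    have h1 := congr_arg (fun f : Cyl D => f t) (m.central f (ContinuousMap.const _ (star e)))
    have h2 := congr_arg (fun f : Cyl D => f t)
      (m.central (ContinuousMap.const _ (f t)) (ContinuousMap.const _ (star e)))
    change m.snd f t * star e = _ at h1
    change (evalMult t m).snd (f t) * star e = _ at h2
    nth_rewrite 1 [he]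
    rw [sub_mul, h1, h2]
    exact sub_self _

theorem mult_cyl_ext {m m' : 𝓜(ℂ, Cyl D)}
    (h : ∀ t, ∃ n, EvaluatesTo t m n ∧ EvaluatesTo t m' n) : m = m' := by
  refine mult_ext_fst fun f => ContinuousMap.ext fun t => ?_
  obtain ⟨n, h1, h2⟩ := h t
  rw [(h1 f).1, (h2 f).1]

/-- The multiplier of `D[0,1]` given by a strictly continuous path of multipliers of `D`. -/
def multPath (m : unitInterval → 𝓜(ℂ, D)) (hm : StrictlyContinuous m) (hb : UniformlyBounded m) :
    𝓜(ℂ, Cyl D) where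
  fst := LinearMap.mkContinuousOfExistsBound
    { toFun := fun f : Cyl D => (⟨fun t => (m t).fst (f t), hm.fst_apply hb f.continuous⟩ : Cyl D)
      map_add' := fun f g => by ext t; simp
      map_smul' := fun c f => by ext t; simp } (by
    obtain ⟨C, hC⟩ := hb
    have hC0 : 0 ≤ C := (norm_nonneg _).trans (hC 0)
    refine ⟨C, fun f => (ContinuousMap.norm_le _ (by positivity)).2 fun t => ?_⟩
    exact (norm_fst_apply_le (m t) (f t)).trans
      (mul_le_mul (hC t) (f.norm_coe_le_norm t) (norm_nonneg _) hC0))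
  snd := LinearMap.mkContinuousOfExistsBound
    { toFun := fun f : Cyl D => (⟨fun t => (m t).snd (f t), hm.snd_apply hb f.continuous⟩ : Cyl D)
      map_add' := fun f g => by ext t; simp
      map_smul' := fun c f => by ext t; simp } (by
    obtain ⟨C, hC⟩ := hb
    have hC0 : 0 ≤ C := (norm_nonneg _).trans (hC 0)
    refine ⟨C, fun f => (ContinuousMap.norm_le _ (by positivity)).2 fun t => ?_⟩
    exact (norm_snd_apply_le (m t) (f t)).trans
      (mul_le_mul (hC t) (f.norm_coe_le_norm t) (norm_nonneg _) hC0))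
  central f g := ContinuousMap.ext fun t => (m t).central (f t) (g t)

theorem evaluatesTo_multPath (m : unitInterval → 𝓜(ℂ, D)) (hm : StrictlyContinuous m)
    (hb : UniformlyBounded m) (t : unitInterval) : EvaluatesTo t (multPath m hm hb) (m t) :=
  fun _ => ⟨rfl, rfl⟩

end Cylinder

/-! ### Homotopies as paths of pairs -/

section Paths

variable {G : Type u} [Group G] [TopologicalSpace G]
variable {A : Type v} [NonUnitalCStarAlgebra A] {D : Type w} [NonUnitalCStarAlgebra D]
variable {α : CStarAction G A} {δ : CStarAction G D}

theorem CocycleRep.eq_of {x y : CocycleRep α δ} (h : ∀ a, x.hom a = y.hom a)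
    (h' : ∀ g, x.cocycle g = y.cocycle g) : x = y := by
  obtain ⟨φ, u, _, _, _, _⟩ := x
  obtain ⟨ψ, v, _, _, _, _⟩ := y
  obtain rfl : φ = ψ := NonUnitalStarAlgHom.ext h
  obtain rfl : u = v := funext h'
  rfl

theorem PairIn.eq_of {x y : PairIn α δ} (h : x.fst = y.fst) (h' : x.snd = y.snd) : x = y := by
  obtain ⟨_, _, _, _⟩ := x
  obtain ⟨_, _, _, _⟩ := y
  obtain rfl := h
  obtain rfl := h'
  rfl

theorem CocycleRep.RestrictsTo.unique {t : unitInterval} {X : CocycleRep α δ.cyl}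
    {x y : CocycleRep α δ} (h : X.RestrictsTo t x) (h' : X.RestrictsTo t y) : x = y :=
  CocycleRep.eq_of (fun a => (h.1 a).unique (h'.1 a)) fun g => (h.2 g).unique (h'.2 g)

theorem CocycleRep.norm_hom_le (x : CocycleRep α δ) (a : A) : ‖x.hom a‖ ≤ ‖a‖ :=
  NonUnitalStarAlgHom.norm_apply_le x.hom a

theorem CocycleRep.norm_cocycle_le (x : CocycleRep α δ) (g : G) : ‖x.cocycle g‖ ≤ 1 :=
  norm_le_one_of_unitary (x.cocycle_unitary g)

/-- A family of cocycle representations indexed by `[0,1]` that defines a cocycle representation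
in `𝓜(D[0,1])`. -/
structure IsRepPath (x : unitInterval → CocycleRep α δ) : Prop where
  hom : ∀ a, StrictlyContinuous fun t => (x t).hom a
  cocycle : StrictlyContinuous fun p : unitInterval × G => (x p.1).cocycle p.2

/-- A family of pairs indexed by `[0,1]` that defines a pair in `𝓜(D[0,1])`. -/
structure IsHomotopy (x : unitInterval → PairIn α δ) : Prop where
  fst : IsRepPath fun t => (x t).fst
  snd : IsRepPath fun t => (x t).snd
  hom_sub : ∀ a, ∃ f : Cyl D, ∀ t, (x t).fst.hom a - (x t).snd.hom a = ((f t : D) : 𝓜(ℂ, D))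
  cocycle_sub : ∀ g, ∃ f : Cyl D, ∀ t,
    (x t).fst.cocycle g - (x t).snd.cocycle g = ((f t : D) : 𝓜(ℂ, D))

namespace IsRepPath

variable {x : unitInterval → CocycleRep α δ}

theorem bounded_hom (x : unitInterval → CocycleRep α δ) (a : A) :
    UniformlyBounded fun t => (x t).hom a := ⟨‖a‖, fun t => (x t).norm_hom_le a⟩

theorem bounded_cocycle (x : unitInterval → CocycleRep α δ) :
    UniformlyBounded fun p : unitInterval × G => (x p.1).cocycle p.2 :=
  ⟨1, fun p => (x p.1).norm_cocycle_le p.2⟩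

theorem cocycle_path (hx : IsRepPath x) (g : G) : StrictlyContinuous fun t => (x t).cocycle g :=
  hx.cocycle.comp (f := fun t => (t, g)) (by fun_prop)

/-- The ⋆-homomorphism into `𝓜(D[0,1])` given by a path. -/
def cylHom (hx : IsRepPath x) : A →⋆ₙₐ[ℂ] 𝓜(ℂ, Cyl D) :=
  { toFun := fun a => multPath (fun t => (x t).hom a) (hx.hom a) (bounded_hom x a)
    map_smul' := fun c a => mult_cyl_ext fun t => ⟨(x t).hom (c • a),
      evaluatesTo_multPath _ _ _ t, by
        rw [map_smul]; exact (evaluatesTo_multPath _ _ _ t).smul c⟩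
    map_zero' := mult_cyl_ext fun t => ⟨(x t).hom 0, evaluatesTo_multPath _ _ _ t, by
      rw [map_zero]; exact .zero⟩
    map_add' := fun a b => mult_cyl_ext fun t => ⟨(x t).hom (a + b),
      evaluatesTo_multPath _ _ _ t, by
        rw [map_add]; exact (evaluatesTo_multPath _ _ _ t).add (evaluatesTo_multPath _ _ _ t)⟩
    map_mul' := fun a b => mult_cyl_ext fun t => ⟨(x t).hom (a * b),
      evaluatesTo_multPath _ _ _ t, by
        rw [map_mul]; exact (evaluatesTo_multPath _ _ _ t).mul (evaluatesTo_multPath _ _ _ t)⟩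
    map_star' := fun a => mult_cyl_ext fun t => ⟨(x t).hom (star a),
      evaluatesTo_multPath _ _ _ t, by
        rw [map_star]; exact (evaluatesTo_multPath _ _ _ t).star⟩ }

theorem evaluatesTo_cylHom (hx : IsRepPath x) (t : unitInterval) (a : A) :
    EvaluatesTo t (hx.cylHom a) ((x t).hom a) := fun _ => ⟨rfl, rfl⟩

/-- The cocycle representation in `𝓜(D[0,1])` given by a path. -/
def cylRep (hx : IsRepPath x) : CocycleRep α δ.cyl where
  hom := hx.cylHom
  cocycle g := multPath (fun t => (x t).cocycle g) (hx.cocycle_path g)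
    ((bounded_cocycle x).comp fun t => (t, g))
  cocycle_unitary g := by
    rw [Unitary.mem_iff]
    constructor
    · refine mult_cyl_ext fun t => ⟨1, ?_, .one⟩
      rw [← (Unitary.mem_iff.1 ((x t).cocycle_unitary g)).1]
      exact (evaluatesTo_multPath _ _ _ t).star.mul (evaluatesTo_multPath _ _ _ t)
    · refine mult_cyl_ext fun t => ⟨1, ?_, .one⟩
      rw [← (Unitary.mem_iff.1 ((x t).cocycle_unitary g)).2]
      exact (evaluatesTo_multPath _ _ _ t).mul (evaluatesTo_multPath _ _ _ t).star
  cocycle_continuous f := by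
    constructor
    -- Norm continuity into `D[0,1]` is joint continuity on `G × [0,1]`; this is why `IsRepPath`
    -- asks for strict continuity of the cocycles in both variables at once.
    · refine ContinuousMap.continuous_of_continuous_uncurry _ ?_
      exact (hx.cocycle.fst_apply (bounded_cocycle x) (f := fun p => f p.1)
        (by fun_prop)).comp continuous_swap
    · refine ContinuousMap.continuous_of_continuous_uncurry _ ?_
      exact (hx.cocycle.snd_apply (bounded_cocycle x) (f := fun p => f p.1)
        (by fun_prop)).comp continuous_swap
  cocycle_mul g h := mult_cyl_ext fun t => ⟨(x t).cocycle (g * h),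
    evaluatesTo_multPath _ _ _ t, by
      rw [(x t).cocycle_mul]
      exact (evaluatesTo_multPath _ _ _ t).mul ((evaluatesTo_multPath _ _ _ t).multAut _)⟩
  covariant g a := mult_cyl_ext fun t => ⟨(x t).hom (α.aut g a), by
    rw [← (x t).covariant]
    exact ((evaluatesTo_multPath _ _ _ t).mul ((hx.evaluatesTo_cylHom t a).multAut _)).mul
      (evaluatesTo_multPath _ _ _ t).star, hx.evaluatesTo_cylHom t _⟩

theorem restrictsTo_cylRep (hx : IsRepPath x) (t : unitInterval) :
    hx.cylRep.RestrictsTo t (x t) :=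
  ⟨hx.evaluatesTo_cylHom t, fun _ _ => ⟨rfl, rfl⟩⟩

end IsRepPath

/-- All identities in `𝓜(D[0,1])` can be checked at each `t` by `mult_cyl_ext`. -/
theorem IsHomotopy.homotopic {x : unitInterval → PairIn α δ} (hx : IsHomotopy x) :
    (x 0).Homotopic (x 1) := by
  refine ⟨⟨hx.fst.cylRep, hx.snd.cylRep, fun a => ?_, fun g => ?_⟩,
    ⟨hx.fst.restrictsTo_cylRep 0, hx.snd.restrictsTo_cylRep 0⟩,
    hx.fst.restrictsTo_cylRep 1, hx.snd.restrictsTo_cylRep 1⟩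
  · obtain ⟨f, hf⟩ := hx.hom_sub a
    refine ⟨f, mult_cyl_ext fun t => ⟨_, ?_, .coe f⟩⟩
    rw [← hf t]
    exact ((hx.fst.restrictsTo_cylRep t).1 a).sub ((hx.snd.restrictsTo_cylRep t).1 a)
  · obtain ⟨f, hf⟩ := hx.cocycle_sub g
    refine ⟨f, mult_cyl_ext fun t => ⟨_, ?_, .coe f⟩⟩
    rw [← hf t]
    exact ((hx.fst.restrictsTo_cylRep t).2 g).sub ((hx.snd.restrictsTo_cylRep t).2 g)

/-- The restriction at `t` of a ⋆-homomorphism into `𝓜(D[0,1])`. -/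
def evalHom (t : unitInterval) (φ : A →⋆ₙₐ[ℂ] 𝓜(ℂ, Cyl D)) : A →⋆ₙₐ[ℂ] 𝓜(ℂ, D) :=
  { toFun := fun a => evalMult t (φ a)
    map_smul' := fun c a => (evaluatesTo_evalMult t _).unique (by
      rw [map_smul]; exact (evaluatesTo_evalMult t _).smul c)
    map_zero' := (evaluatesTo_evalMult t _).unique (by rw [map_zero]; exact .zero)
    map_add' := fun a b => (evaluatesTo_evalMult t _).unique (by
      rw [map_add]; exact (evaluatesTo_evalMult t _).add (evaluatesTo_evalMult t _))
    map_mul' := fun a b => (evaluatesTo_evalMult t _).unique (by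
      rw [map_mul]; exact (evaluatesTo_evalMult t _).mul (evaluatesTo_evalMult t _))
    map_star' := fun a => (evaluatesTo_evalMult t _).unique (by
      rw [map_star]; exact (evaluatesTo_evalMult t _).star) }

theorem evaluatesTo_evalHom (t : unitInterval) (φ : A →⋆ₙₐ[ℂ] 𝓜(ℂ, Cyl D)) (a : A) :
    EvaluatesTo t (φ a) (evalHom t φ a) := evaluatesTo_evalMult t _

/-- The restriction at `t` of a cocycle representation in `𝓜(D[0,1])`. -/
def CocycleRep.restrict (X : CocycleRep α δ.cyl) (t : unitInterval) : CocycleRep α δ where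
  hom := evalHom t X.hom
  cocycle g := evalMult t (X.cocycle g)
  cocycle_unitary g := by
    rw [Unitary.mem_iff]
    have h := evaluatesTo_evalMult t (X.cocycle g)
    constructor
    · refine (h.star.mul h).unique ?_
      rw [(Unitary.mem_iff.1 (X.cocycle_unitary g)).1]; exact .one
    · refine (h.mul h.star).unique ?_
      rw [(Unitary.mem_iff.1 (X.cocycle_unitary g)).2]; exact .one
  cocycle_continuous d :=
    ⟨(continuous_eval_const t).comp (X.cocycle_continuous (ContinuousMap.const _ d)).1,
      (continuous_eval_const t).comp (X.cocycle_continuous (ContinuousMap.const _ d)).2⟩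
  cocycle_mul g h := (evaluatesTo_evalMult t _).unique (by
    rw [X.cocycle_mul]
    exact (evaluatesTo_evalMult t _).mul ((evaluatesTo_evalMult t _).multAut _))
  covariant g a := by
    have h := evaluatesTo_evalMult t (X.cocycle g)
    refine ((h.mul ((evaluatesTo_evalHom t X.hom a).multAut (δ.aut g))).mul h.star).unique ?_
    have h2 := evaluatesTo_evalHom t X.hom (α.aut g a)
    rw [← X.covariant] at h2
    exact h2

theorem CocycleRep.restrictsTo_restrict (X : CocycleRep α δ.cyl) (t : unitInterval) :
    X.RestrictsTo t (X.restrict t) :=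
  ⟨fun _ => evaluatesTo_evalMult t _, fun _ => evaluatesTo_evalMult t _⟩

theorem CocycleRep.isRepPath_restrict (X : CocycleRep α δ.cyl) :
    IsRepPath fun t => X.restrict t where
  hom a d := ⟨(X.hom a).fst (ContinuousMap.const _ d) |>.continuous,
    (X.hom a).snd (ContinuousMap.const _ d) |>.continuous⟩
  cocycle d := by
    have h := X.cocycle_continuous (ContinuousMap.const _ d)
    exact ⟨(h.1.comp continuous_snd).eval continuous_fst,
      (h.2.comp continuous_snd).eval continuous_fst⟩

/-- The restriction at `t` of a pair in `𝓜(D[0,1])`. -/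
def PairIn.restrict (X : PairIn α δ.cyl) (t : unitInterval) : PairIn α δ where
  fst := X.fst.restrict t
  snd := X.snd.restrict t
  hom_sub a := by
    obtain ⟨f, hf⟩ := X.hom_sub a
    refine ⟨f t, ((evaluatesTo_evalMult t _).sub (evaluatesTo_evalMult t _)).unique ?_⟩
    rw [hf]; exact .coe f
  cocycle_sub g := by
    obtain ⟨f, hf⟩ := X.cocycle_sub g
    refine ⟨f t, ((evaluatesTo_evalMult t _).sub (evaluatesTo_evalMult t _)).unique ?_⟩
    rw [hf]; exact .coe f

theorem PairIn.isHomotopy_restrict (X : PairIn α δ.cyl) : IsHomotopy fun t => X.restrict t where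
  fst := X.fst.isRepPath_restrict
  snd := X.snd.isRepPath_restrict
  hom_sub a := by
    obtain ⟨f, hf⟩ := X.hom_sub a
    refine ⟨f, fun t => ((evaluatesTo_evalMult t _).sub (evaluatesTo_evalMult t _)).unique ?_⟩
    rw [hf]; exact .coe f
  cocycle_sub g := by
    obtain ⟨f, hf⟩ := X.cocycle_sub g
    refine ⟨f, fun t => ((evaluatesTo_evalMult t _).sub (evaluatesTo_evalMult t _)).unique ?_⟩
    rw [hf]; exact .coe f

/-- Restricting a pair over `D[0,1]` to all points recovers a path, and uniqueness of evaluation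
identifies its endpoints. From here on homotopies are constructed and combined as paths. -/
theorem PairIn.homotopic_iff {x y : PairIn α δ} :
    x.Homotopic y ↔ ∃ p : unitInterval → PairIn α δ, IsHomotopy p ∧ p 0 = x ∧ p 1 = y := by
  constructor
  · rintro ⟨X, ⟨h0, h0'⟩, h1, h1'⟩
    exact ⟨fun t => X.restrict t, X.isHomotopy_restrict,
      PairIn.eq_of ((X.fst.restrictsTo_restrict 0).unique h0)
        ((X.snd.restrictsTo_restrict 0).unique h0'),
      PairIn.eq_of ((X.fst.restrictsTo_restrict 1).unique h1)
        ((X.snd.restrictsTo_restrict 1).unique h1')⟩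
  · rintro ⟨p, hp, rfl, rfl⟩
    exact hp.homotopic

/-! ### Operations on homotopies -/

theorem IsRepPath.const (x : CocycleRep α δ) : IsRepPath fun _ => x where
  hom _ := .const _
  cocycle := x.cocycle_continuous.comp continuous_snd

theorem IsRepPath.comp {x : unitInterval → CocycleRep α δ} (hx : IsRepPath x)
    {f : unitInterval → unitInterval} (hf : Continuous f) : IsRepPath fun t => x (f t) where
  hom a := (hx.hom a).comp hf
  cocycle := hx.cocycle.comp (f := fun p : unitInterval × G => (f p.1, p.2)) (by fun_prop)

theorem IsHomotopy.comp {x : unitInterval → PairIn α δ} (hx : IsHomotopy x)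
    {f : unitInterval → unitInterval} (hf : Continuous f) : IsHomotopy fun t => x (f t) where
  fst := hx.fst.comp hf
  snd := hx.snd.comp hf
  hom_sub a := by
    obtain ⟨c, hc⟩ := hx.hom_sub a
    exact ⟨c.comp ⟨f, hf⟩, fun t => hc _⟩
  cocycle_sub g := by
    obtain ⟨c, hc⟩ := hx.cocycle_sub g
    exact ⟨c.comp ⟨f, hf⟩, fun t => hc _⟩

theorem IsHomotopy.const (x : PairIn α δ) : IsHomotopy fun _ => x where
  fst := .const _
  snd := .const _
  hom_sub a := by
    obtain ⟨c, hc⟩ := x.hom_sub a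
    exact ⟨ContinuousMap.const _ c, fun _ => hc⟩
  cocycle_sub g := by
    obtain ⟨c, hc⟩ := x.cocycle_sub g
    exact ⟨ContinuousMap.const _ c, fun _ => hc⟩

/-- The pair `((ψ, v), (φ, u))` obtained from `((φ, u), (ψ, v))`. -/
def PairIn.swap (x : PairIn α δ) : PairIn α δ where
  fst := x.snd
  snd := x.fst
  hom_sub a := by
    obtain ⟨c, hc⟩ := x.hom_sub a
    exact ⟨0 - c, by rw [coe_sub, ← hc, coe_zero]; abel⟩
  cocycle_sub g := by
    obtain ⟨c, hc⟩ := x.cocycle_sub g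
    exact ⟨0 - c, by rw [coe_sub, ← hc, coe_zero]; abel⟩

theorem IsHomotopy.swap {x : unitInterval → PairIn α δ} (hx : IsHomotopy x) :
    IsHomotopy fun t => (x t).swap where
  fst := hx.snd
  snd := hx.fst
  hom_sub a := by
    obtain ⟨c, hc⟩ := hx.hom_sub a
    refine ⟨0 - c, fun t => ?_⟩
    rw [ContinuousMap.sub_apply, coe_sub, ← hc, ContinuousMap.zero_apply, coe_zero]
    simp only [PairIn.swap]; abel
  cocycle_sub g := by
    obtain ⟨c, hc⟩ := hx.cocycle_sub g
    refine ⟨0 - c, fun t => ?_⟩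
    rw [ContinuousMap.sub_apply, coe_sub, ← hc, ContinuousMap.zero_apply, coe_zero]
    simp only [PairIn.swap]; abel

theorem IsRepPath.cocyclePart {x : unitInterval → CocycleRep α δ} (hx : IsRepPath x) :
    IsRepPath fun t => (x t).cocyclePart where
  hom _ := .const 0
  cocycle := hx.cocycle

theorem IsHomotopy.cocyclePart {x : unitInterval → PairIn α δ} (hx : IsHomotopy x) :
    IsHomotopy fun t => (x t).cocyclePart where
  fst := hx.fst.cocyclePart
  snd := hx.snd.cocyclePart
  hom_sub _ := ⟨0, fun _ => (sub_self (0 : 𝓜(ℂ, D))).trans coe_zero.symm⟩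
  cocycle_sub := hx.cocycle_sub

theorem IsRepPath.cuntzSum {x y : unitInterval → CocycleRep α δ} (T : CuntzIsometries δ)
    (hx : IsRepPath x) (hy : IsRepPath y) : IsRepPath fun t => (x t).cuntzSum T (y t) where
  hom a := T.strictlyContinuous_sum (hx.hom a) (hy.hom a)
  cocycle := T.strictlyContinuous_sum hx.cocycle hy.cocycle

theorem CuntzIsometries.sum_coe (T : CuntzIsometries δ) (c d : D) :
    T.sum (c : 𝓜(ℂ, D)) (d : 𝓜(ℂ, D)) =
      ((T.t₁.fst ((star T.t₁).snd c) + T.t₂.fst ((star T.t₂).snd d) : D) : 𝓜(ℂ, D)) := by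
  rw [coe_add, ← mul_coe, ← mul_coe, ← coe_mul_mult, ← coe_mul_mult, CuntzIsometries.sum,
    mul_assoc, mul_assoc]

/-- The Cuntz sum of two paths in `D`. -/
def CuntzIsometries.cylSum (T : CuntzIsometries δ) (c d : Cyl D) : Cyl D :=
  ⟨fun t => T.t₁.fst ((star T.t₁).snd (c t)) + T.t₂.fst ((star T.t₂).snd (d t)), by fun_prop⟩

theorem IsHomotopy.cuntzSum {x y : unitInterval → PairIn α δ} (T : CuntzIsometries δ)
    (hx : IsHomotopy x) (hy : IsHomotopy y) : IsHomotopy fun t => (x t).cuntzSum T (y t) where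
  fst := hx.fst.cuntzSum T hy.fst
  snd := hx.snd.cuntzSum T hy.snd
  hom_sub a := by
    obtain ⟨c, hc⟩ := hx.hom_sub a
    obtain ⟨d, hd⟩ := hy.hom_sub a
    refine ⟨T.cylSum c d, fun t => ?_⟩
    change T.sum _ _ - T.sum _ _ = _
    rw [T.sum_sub, hc, hd, T.sum_coe]; rfl
  cocycle_sub g := by
    obtain ⟨c, hc⟩ := hx.cocycle_sub g
    obtain ⟨d, hd⟩ := hy.cocycle_sub g
    refine ⟨T.cylSum c d, fun t => ?_⟩
    change T.sum _ _ - T.sum _ _ = _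
    rw [T.sum_sub, hc, hd, T.sum_coe]; rfl

/-- The concatenation of two families indexed by `[0,1]`. -/
def concat {X : Type*} (x y : unitInterval → X) (t : unitInterval) : X :=
  if (t : ℝ) ≤ 1 / 2 then x (Set.projIcc 0 1 zero_le_one (2 * (t : ℝ)))
  else y (Set.projIcc 0 1 zero_le_one (2 * (t : ℝ) - 1))

/-- Reduces concatenation of pairs and representations to concatenation of functions obtained from
them. -/
theorem map_concat {X Y : Type*} (F : X → Y) (x y : unitInterval → X) (t : unitInterval) :
    F (concat x y t) = concat (fun t => F (x t)) (fun t => F (y t)) t := by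
  unfold concat; split_ifs <;> rfl

theorem concat_zero {X : Type*} (x y : unitInterval → X) : concat x y 0 = x 0 := by
  simp [concat]

theorem concat_one {X : Type*} (x y : unitInterval → X) : concat x y 1 = y 1 := by
  simp [concat]; norm_num

theorem continuous_concat {X Y : Type*} [TopologicalSpace X] [TopologicalSpace Y]
    {x y : unitInterval → Y → X} (hx : Continuous fun p : unitInterval × Y => x p.1 p.2)
    (hy : Continuous fun p : unitInterval × Y => y p.1 p.2) (h : x 1 = y 0) :
    Continuous fun p : unitInterval × Y => concat x y p.1 p.2 := by
  have key : (fun p : unitInterval × Y => concat x y p.1 p.2) = fun p => if (p.1 : ℝ) ≤ 1 / 2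
      then x (Set.projIcc 0 1 zero_le_one (2 * (p.1 : ℝ))) p.2
      else y (Set.projIcc 0 1 zero_le_one (2 * (p.1 : ℝ) - 1)) p.2 := by
    ext p; simp only [concat]; split_ifs <;> rfl
  rw [key]
  have hp : Continuous (Set.projIcc (0 : ℝ) 1 zero_le_one) := continuous_projIcc
  refine Continuous.if_le ?_ ?_ (by fun_prop) continuous_const fun p hp => ?_
  · exact hx.comp (g := fun p : unitInterval × Y => x p.1 p.2)
      ((hp.comp (by fun_prop)).prodMk continuous_snd)
  · exact hy.comp (g := fun p : unitInterval × Y => y p.1 p.2)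
      ((hp.comp (by fun_prop)).prodMk continuous_snd)
  · rw [hp]
    norm_num
    rw [h]

theorem strictlyContinuous_concat {Y : Type*} [TopologicalSpace Y]
    {x y : unitInterval → Y → 𝓜(ℂ, D)}
    (hx : StrictlyContinuous fun p : unitInterval × Y => x p.1 p.2)
    (hy : StrictlyContinuous fun p : unitInterval × Y => y p.1 p.2) (h : x 1 = y 0) :
    StrictlyContinuous fun p : unitInterval × Y => concat x y p.1 p.2 := by
  intro d
  constructor
  · have := continuous_concat (x := fun t q => (x t q).fst d) (y := fun t q => (y t q).fst d)
      (hx d).1 (hy d).1 (by rw [h])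
    refine this.congr fun p => ?_
    exact congr_fun (map_concat (fun (m : Y → 𝓜(ℂ, D)) q => (m q).fst d) x y p.1).symm p.2
  · have := continuous_concat (x := fun t q => (x t q).snd d) (y := fun t q => (y t q).snd d)
      (hx d).2 (hy d).2 (by rw [h])
    refine this.congr fun p => ?_
    exact congr_fun (map_concat (fun (m : Y → 𝓜(ℂ, D)) q => (m q).snd d) x y p.1).symm p.2

theorem IsRepPath.concat {x y : unitInterval → CocycleRep α δ} (hx : IsRepPath x)
    (hy : IsRepPath y) (h : x 1 = y 0) : IsRepPath (concat x y) where
  hom a := by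
    have := strictlyContinuous_concat (Y := Unit) (x := fun t _ => (x t).hom a)
      (y := fun t _ => (y t).hom a) ((hx.hom a).comp continuous_fst)
      ((hy.hom a).comp continuous_fst) (by rw [h])
    have h2 := this.comp (f := fun t : unitInterval => (t, ())) (by fun_prop)
    convert h2 using 2 with t
    exact congr_fun (map_concat (fun (z : CocycleRep α δ) (_ : Unit) => z.hom a) x y t) ()
  cocycle := by
    have := strictlyContinuous_concat (x := fun t g => (x t).cocycle g)
      (y := fun t g => (y t).cocycle g) hx.cocycle hy.cocycle (by rw [h])
    convert this using 2 with p
    exact congr_fun (map_concat (fun z : CocycleRep α δ => z.cocycle) x y p.1) p.2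

theorem exists_concat_coe {x y : unitInterval → 𝓜(ℂ, D)} (hx : ∃ f : Cyl D, ∀ t, x t = (f t : D))
    (hy : ∃ f : Cyl D, ∀ t, y t = (f t : D)) (h : x 1 = y 0) :
    ∃ f : Cyl D, ∀ t, concat x y t = ((f t : D) : 𝓜(ℂ, D)) := by
  obtain ⟨f, hf⟩ := hx
  obtain ⟨k, hk⟩ := hy
  -- The two paths agree at the junction as multipliers; injectivity of `D → 𝓜(D)` makes them agree
  -- in `D`.
  have hfk : f 1 = k 0 := coe_injective (by rw [← hf, ← hk, h])
  have hc := continuous_concat (Y := Unit) (x := fun t _ => f t) (y := fun t _ => k t)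
    (by fun_prop) (by fun_prop) (by rw [hfk])
  refine ⟨⟨fun t => concat (fun t (_ : Unit) => f t) (fun t _ => k t) t (),
    hc.comp (f := fun t => (t, ())) (by fun_prop)⟩, fun t => ?_⟩
  obtain rfl : x = fun t => ((f t : D) : 𝓜(ℂ, D)) := funext hf
  obtain rfl : y = fun t => ((k t : D) : 𝓜(ℂ, D)) := funext hk
  exact (map_concat (fun c : Unit → D => ((c () : D) : 𝓜(ℂ, D))) (fun t _ => f t) (fun t _ => k t) t).symm

theorem IsHomotopy.concat {x y : unitInterval → PairIn α δ} (hx : IsHomotopy x)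
    (hy : IsHomotopy y) (h : x 1 = y 0) : IsHomotopy (concat x y) where
  fst := by
    have := hx.fst.concat hy.fst (by rw [h])
    convert this using 1
    exact funext fun t => map_concat (fun z : PairIn α δ => z.fst) x y t
  snd := by
    have := hx.snd.concat hy.snd (by rw [h])
    convert this using 1
    exact funext fun t => map_concat (fun z : PairIn α δ => z.snd) x y t
  hom_sub a := by
    obtain ⟨f, hf⟩ := exists_concat_coe (hx.hom_sub a) (hy.hom_sub a) (by rw [h])
    refine ⟨f, fun t => ?_⟩
    rw [← hf, ← map_concat (fun z : PairIn α δ => z.fst.hom a - z.snd.hom a) x y t]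
  cocycle_sub g := by
    obtain ⟨f, hf⟩ := exists_concat_coe (hx.cocycle_sub g) (hy.cocycle_sub g) (by rw [h])
    refine ⟨f, fun t => ?_⟩
    rw [← hf, ← map_concat (fun z : PairIn α δ => z.fst.cocycle g - z.snd.cocycle g) x y t]

theorem PairIn.Homotopic.refl (x : PairIn α δ) : x.Homotopic x :=
  (IsHomotopy.const x).homotopic

theorem PairIn.Homotopic.symm {x y : PairIn α δ} (h : x.Homotopic y) : y.Homotopic x := by
  obtain ⟨p, hp, rfl, rfl⟩ := PairIn.homotopic_iff.1 h
  simpa using (hp.comp (f := unitInterval.symm) unitInterval.continuous_symm).homotopic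

theorem PairIn.Homotopic.trans {x y z : PairIn α δ} (h : x.Homotopic y) (h' : y.Homotopic z) :
    x.Homotopic z := by
  obtain ⟨p, hp, rfl, rfl⟩ := PairIn.homotopic_iff.1 h
  obtain ⟨q, hq, hpq, rfl⟩ := PairIn.homotopic_iff.1 h'
  simpa only [concat_zero, concat_one] using (hp.concat hq hpq.symm).homotopic

theorem equivalence_homotopic :
    Equivalence (PairIn.Homotopic : PairIn α δ → PairIn α δ → Prop) :=
  ⟨.refl, .symm, .trans⟩

theorem PairIn.Homotopic.swap {x y : PairIn α δ} (h : x.Homotopic y) :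
    x.swap.Homotopic y.swap := by
  obtain ⟨p, hp, rfl, rfl⟩ := PairIn.homotopic_iff.1 h
  exact hp.swap.homotopic

theorem PairIn.Homotopic.cocyclePart {x y : PairIn α δ} (h : x.Homotopic y) :
    x.cocyclePart.Homotopic y.cocyclePart := by
  obtain ⟨p, hp, rfl, rfl⟩ := PairIn.homotopic_iff.1 h
  exact hp.cocyclePart.homotopic

theorem PairIn.Homotopic.cuntzSum (T : CuntzIsometries δ) {x y x' y' : PairIn α δ}
    (h : x.Homotopic y) (h' : x'.Homotopic y') :
    (x.cuntzSum T x').Homotopic (y.cuntzSum T y') := by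
  obtain ⟨p, hp, rfl, rfl⟩ := PairIn.homotopic_iff.1 h
  obtain ⟨q, hq, rfl, rfl⟩ := PairIn.homotopic_iff.1 h'
  exact (hp.cuntzSum T hq).homotopic

end Paths

/-! ### Compression by isometries -/

section Corner

variable {D : Type w} [NonUnitalCStarAlgebra D]

theorem multAut_sub (s : D ≃⋆ₐ[ℂ] D) (m n : 𝓜(ℂ, D)) :
    multAut s (m - n) = multAut s m - multAut s n :=
  mult_ext (fun d => map_sub s (m.fst (s.symm d)) (n.fst (s.symm d)))
    fun d => map_sub s (m.snd (s.symm d)) (n.snd (s.symm d))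

theorem multAut_smul (s : D ≃⋆ₐ[ℂ] D) (c : ℂ) (m : 𝓜(ℂ, D)) :
    multAut s (c • m) = c • multAut s m :=
  mult_ext (fun d => map_smul s c (m.fst (s.symm d))) fun d => map_smul s c (m.snd (s.symm d))

/-- The element `V m V* + (1 - V V*)`. -/
def corner (V m : 𝓜(ℂ, D)) : 𝓜(ℂ, D) := V * m * star V + (1 - V * star V)

variable {V : 𝓜(ℂ, D)}

/-- The case `V = 0` is admitted here and below so that the degenerate endpoint of a squeeze needs
no separate treatment. -/
theorem conj_mul_conj (hV : star V * V = 1 ∨ V = 0) (m n : 𝓜(ℂ, D)) :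
    V * m * star V * (V * n * star V) = V * (m * n) * star V := by
  rcases hV with hV | rfl
  · have h : ∀ x, star V * (V * x) = x := fun x => by rw [← mul_assoc, hV, one_mul]
    simp only [mul_assoc, h]
  · simp

theorem conj_mul_compl (hV : star V * V = 1 ∨ V = 0) (m : 𝓜(ℂ, D)) :
    V * m * star V * (1 - V * star V) = 0 := by
  rcases hV with hV | rfl
  · have h : ∀ x, star V * (V * x) = x := fun x => by rw [← mul_assoc, hV, one_mul]
    simp only [mul_sub, mul_one, mul_assoc, h, sub_self]
  · simp

theorem compl_mul_conj (hV : star V * V = 1 ∨ V = 0) (m : 𝓜(ℂ, D)) :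
    (1 - V * star V) * (V * m * star V) = 0 := by
  rcases hV with hV | rfl
  · have h : ∀ x, star V * (V * x) = x := fun x => by rw [← mul_assoc, hV, one_mul]
    simp only [sub_mul, one_mul, mul_assoc, h, sub_self]
  · simp

theorem compl_mul_compl (hV : star V * V = 1 ∨ V = 0) :
    (1 - V * star V) * (1 - V * star V) = 1 - V * star V := by
  have h := conj_mul_compl hV 1
  rw [mul_one] at h
  rw [sub_mul, one_mul, h, sub_zero]

/-- The summands `V m V*` and `1 - V V*` live in orthogonal corners, and the second is a projection.
-/
theorem corner_mul_corner (hV : star V * V = 1 ∨ V = 0) (m n : 𝓜(ℂ, D)) :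
    corner V m * corner V n = corner V (m * n) := by
  simp only [corner, add_mul, mul_add, conj_mul_conj hV, conj_mul_compl hV, compl_mul_conj hV,
    compl_mul_compl hV, add_zero, zero_add]

theorem star_conj (V m : 𝓜(ℂ, D)) : star (V * m * star V) = V * star m * star V := by
  simp only [star_mul, star_star, mul_assoc]

theorem star_corner (V m : 𝓜(ℂ, D)) : star (corner V m) = corner V (star m) := by
  simp only [corner, star_add, star_sub, star_one, star_mul, star_star, mul_assoc]

theorem corner_one (V : 𝓜(ℂ, D)) : corner V 1 = 1 := by simp [corner]

theorem corner_mul_conj (hV : star V * V = 1 ∨ V = 0) (m n : 𝓜(ℂ, D)) :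
    corner V m * (V * n * star V) = V * (m * n) * star V := by
  simp only [corner, add_mul, conj_mul_conj hV, compl_mul_conj hV, add_zero]

theorem conj_mul_corner (hV : star V * V = 1 ∨ V = 0) (m n : 𝓜(ℂ, D)) :
    V * m * star V * corner V n = V * (m * n) * star V := by
  simp only [corner, mul_add, conj_mul_conj hV, conj_mul_compl hV, add_zero]

theorem corner_mem_unitary (hV : star V * V = 1 ∨ V = 0) {m : 𝓜(ℂ, D)}
    (hm : m ∈ unitary 𝓜(ℂ, D)) : corner V m ∈ unitary 𝓜(ℂ, D) := by
  have h := Unitary.mem_iff.1 hm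
  rw [Unitary.mem_iff, star_corner, corner_mul_corner hV, corner_mul_corner hV, h.1, h.2,
    corner_one]
  exact ⟨rfl, rfl⟩

theorem multAut_conj {s : D ≃⋆ₐ[ℂ] D} (hs : multAut s V = V) (m : 𝓜(ℂ, D)) :
    multAut s (V * m * star V) = V * multAut s m * star V := by
  simp only [multAut_mul, multAut_star, hs]

theorem multAut_corner {s : D ≃⋆ₐ[ℂ] D} (hs : multAut s V = V) (m : 𝓜(ℂ, D)) :
    multAut s (corner V m) = corner V (multAut s m) := by
  simp only [corner, multAut_add, multAut_sub, multAut_one, multAut_mul, multAut_star, hs]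

theorem corner_sub_corner (V m n : 𝓜(ℂ, D)) :
    corner V m - corner V n = V * (m - n) * star V := by
  simp only [corner]; noncomm_ring

theorem conj_coe (V : 𝓜(ℂ, D)) (c : D) : V * (c : 𝓜(ℂ, D)) * star V
    = ((V.fst ((star V).snd c) : D) : 𝓜(ℂ, D)) := by
  rw [mul_assoc, coe_mul_mult, mul_coe]

end Corner

/-! ### Compression of cocycle representations and pairs. -/

section Compress

variable {G : Type u} [Group G] [TopologicalSpace G]
variable {A : Type v} [NonUnitalCStarAlgebra A] {D : Type w} [NonUnitalCStarAlgebra D]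
variable {α : CStarAction G A} {δ : CStarAction G D}

/-- `V` is a `δ`-fixed multiplier that is an isometry or zero. -/
structure IsFixedIsometryOrZero (δ : CStarAction G D) (V : 𝓜(ℂ, D)) : Prop where
  fixed : ∀ g, multAut (δ.aut g) V = V
  isometry : star V * V = 1 ∨ V = 0

theorem IsFixedIsometryOrZero.norm_le {V : 𝓜(ℂ, D)} (hV : IsFixedIsometryOrZero δ V) :
    ‖V‖ ≤ 1 := by
  rcases hV.isometry with h | rfl
  · exact norm_le_one_of_isometry h
  · simp

/-- The cocycle representation `(V φ V*, V u V* + (1 - V V*))`. -/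
def CocycleRep.compress {V : 𝓜(ℂ, D)} (hV : IsFixedIsometryOrZero δ V) (x : CocycleRep α δ) :
    CocycleRep α δ where
  hom :=
    { toFun := fun a => V * x.hom a * star V
      map_smul' := fun c a => by
        simp only [map_smul, MonoidHom.id_apply, mul_smul_comm, smul_mul_assoc]
      map_zero' := by simp
      map_add' := fun a b => by simp only [map_add, mul_add, add_mul]
      map_mul' := fun a b => by simp only [map_mul, conj_mul_conj hV.isometry]
      map_star' := fun a => by simp only [map_star, star_conj] }
  cocycle g := corner V (x.cocycle g)
  cocycle_unitary g := corner_mem_unitary hV.isometry (x.cocycle_unitary g)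
  cocycle_continuous d :=
    ⟨(V.fst.continuous.comp (x.cocycle_continuous _).1).add continuous_const,
      ((star V).snd.continuous.comp (x.cocycle_continuous _).2).add continuous_const⟩
  cocycle_mul g h := by
    rw [multAut_corner (hV.fixed g), corner_mul_corner hV.isometry, x.cocycle_mul]
  covariant g a := by
    change corner V _ * multAut _ (V * x.hom a * star V) * star (corner V _)
      = V * x.hom (α.aut g a) * star V
    rw [multAut_conj (hV.fixed g), star_corner, corner_mul_conj hV.isometry,
      conj_mul_corner hV.isometry, x.covariant]

theorem CocycleRep.compress_hom {V : 𝓜(ℂ, D)} (hV : IsFixedIsometryOrZero δ V)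
    (x : CocycleRep α δ) (a : A) : (x.compress hV).hom a = V * x.hom a * star V := rfl

theorem CocycleRep.compress_cocycle {V : 𝓜(ℂ, D)} (hV : IsFixedIsometryOrZero δ V)
    (x : CocycleRep α δ) (g : G) : (x.compress hV).cocycle g = corner V (x.cocycle g) := rfl

theorem CocycleRep.cuntzSum_hom (T : CuntzIsometries δ) (x y : CocycleRep α δ) (a : A) :
    (x.cuntzSum T y).hom a = T.sum (x.hom a) (y.hom a) := rfl

theorem CocycleRep.cuntzSum_cocycle (T : CuntzIsometries δ) (x y : CocycleRep α δ) (g : G) :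
    (x.cuntzSum T y).cocycle g = T.sum (x.cocycle g) (y.cocycle g) := rfl

/-- The compression of both entries of a pair by `V`. -/
def PairIn.compress {V : 𝓜(ℂ, D)} (hV : IsFixedIsometryOrZero δ V) (x : PairIn α δ) :
    PairIn α δ where
  fst := x.fst.compress hV
  snd := x.snd.compress hV
  hom_sub a := by
    obtain ⟨c, hc⟩ := x.hom_sub a
    refine ⟨V.fst ((star V).snd c), ?_⟩
    rw [← conj_coe, ← hc, CocycleRep.compress_hom, CocycleRep.compress_hom, ← sub_mul, ← mul_sub]
  cocycle_sub g := by
    obtain ⟨c, hc⟩ := x.cocycle_sub g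
    refine ⟨V.fst ((star V).snd c), ?_⟩
    rw [← conj_coe, ← hc, CocycleRep.compress_cocycle, CocycleRep.compress_cocycle,
      corner_sub_corner]

/-- The pair `(r, r)`. -/
def PairIn.diag (r : CocycleRep α δ) : PairIn α δ where
  fst := r
  snd := r
  hom_sub a := by rw [sub_self]; exact inIdeal_zero
  cocycle_sub g := by rw [sub_self]; exact inIdeal_zero

theorem CocycleRep.compress_one {V : 𝓜(ℂ, D)} (hV : IsFixedIsometryOrZero δ V) (h : V = 1)
    (x : CocycleRep α δ) : x.compress hV = x := by
  subst h
  exact CocycleRep.eq_of (fun a => by simp [compress_hom]) fun g => by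
    simp [compress_cocycle, corner]

theorem CocycleRep.compress_zero {V : 𝓜(ℂ, D)} (hV : IsFixedIsometryOrZero δ V) (h : V = 0)
    (x : CocycleRep α δ) : x.compress hV = .trivial α δ := by
  subst h
  exact CocycleRep.eq_of (fun a => by simp [compress_hom, CocycleRep.trivial]) fun g => by
    simp [compress_cocycle, corner, CocycleRep.trivial]

/-- A path of fixed isometries whose adjoints are strongly continuous and which is strictly
continuous except where it vanishes. -/
structure IsSqueeze (δ : CStarAction G D) (V : unitInterval → 𝓜(ℂ, D)) : Prop where
  isometry : ∀ t, IsFixedIsometryOrZero δ (V t)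
  continuous_star : ∀ d, Continuous fun t => (star (V t)).fst d
  continuousAt : ∀ t, V t = 0 ∨ ∀ d, ContinuousAt (fun s => (V s).fst d) t

/-- A strictly continuous path of fixed isometries. -/
structure IsIsometryPath (δ : CStarAction G D) (V : unitInterval → 𝓜(ℂ, D)) : Prop where
  fixed : ∀ t g, multAut (δ.aut g) (V t) = V t
  isometry : ∀ t, star (V t) * V t = 1
  continuous : StrictlyContinuous V

theorem IsIsometryPath.isSqueeze {V : unitInterval → 𝓜(ℂ, D)} (hV : IsIsometryPath δ V) :
    IsSqueeze δ V where
  isometry t := ⟨hV.fixed t, .inl (hV.isometry t)⟩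
  continuous_star d := (hV.continuous.star d).1
  continuousAt _ := .inr fun d => (hV.continuous d).1.continuousAt

theorem IsSqueeze.uniformlyBounded {V : unitInterval → 𝓜(ℂ, D)} (hV : IsSqueeze δ V) :
    UniformlyBounded V := ⟨1, fun t => (hV.isometry t).norm_le⟩

/-- Strict continuity of `V` fails where `V` vanishes, since `‖V d‖ = ‖d‖` at the isometries nearby.
The conjugates are still continuous there, because `V* d` is small and `V` is a contraction. -/
theorem IsSqueeze.conj {V : unitInterval → 𝓜(ℂ, D)} (hV : IsSqueeze δ V) {Z : Type*}
    [TopologicalSpace Z] {τ : Z → unitInterval} (hτ : Continuous τ) {n : Z → 𝓜(ℂ, D)}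
    (hn : StrictlyContinuous n) (hb : UniformlyBounded n) :
    StrictlyContinuous fun z => V (τ z) * n z * star (V (τ z)) := by
  have key : ∀ n : Z → 𝓜(ℂ, D), StrictlyContinuous n → UniformlyBounded n → ∀ d : D,
      Continuous fun z => (V (τ z) * n z * star (V (τ z))).fst d := by
    intro n hn hb d
    have hk : Continuous fun z => (n z).fst ((star (V (τ z))).fst d) :=
      hn.fst_apply hb ((hV.continuous_star d).comp hτ)
    set k := fun z => (n z).fst ((star (V (τ z))).fst d) with hkdef
    change Continuous fun z => (V (τ z)).fst (k z)
    have hle : ∀ z c, ‖(V (τ z)).fst c‖ ≤ ‖c‖ := fun z c =>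
      (norm_fst_apply_le _ _).trans
        (mul_le_of_le_one_left (norm_nonneg _) (hV.isometry _).norm_le)
    refine continuous_iff_continuousAt.2 fun z => ?_
    rw [ContinuousAt, tendsto_iff_norm_sub_tendsto_zero]
    -- At a zero of `V` the vector `k z` vanishes and `‖V (τ y) (k y)‖ ≤ ‖k y‖` suffices; elsewhere
    -- `V` is strongly continuous and the two limits are combined.
    rcases hV.continuousAt (τ z) with h0 | h
    · have hz : k z = 0 := by simp [hkdef, h0]
      have h1 : Filter.Tendsto (fun y => ‖k y‖) (nhds z) (nhds 0) := by
        have := hk.norm.tendsto z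
        rwa [hz, norm_zero] at this
      refine squeeze_zero (fun _ => norm_nonneg _) (fun y => ?_) h1
      rw [hz, map_zero, sub_zero]
      exact hle y _
    · have h1 : Filter.Tendsto (fun y => ‖k y - k z‖
          + ‖(V (τ y)).fst (k z) - (V (τ z)).fst (k z)‖) (nhds z) (nhds 0) := by
        have e1 : ContinuousAt (fun y => (V (τ y)).fst (k z)) z :=
          ContinuousAt.comp (g := fun s => (V s).fst (k z)) (h (k z)) hτ.continuousAt
        have e2 : ContinuousAt (fun y => ‖k y - k z‖
          + ‖(V (τ y)).fst (k z) - (V (τ z)).fst (k z)‖) z :=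
          (hk.continuousAt.sub continuousAt_const).norm.add (e1.sub continuousAt_const).norm
        simpa [ContinuousAt] using e2
      refine squeeze_zero (fun _ => norm_nonneg _) (fun y => ?_) h1
      refine (norm_sub_le_norm_sub_add_norm_sub _ ((V (τ y)).fst (k z)) _).trans
        (add_le_add ?_ le_rfl)
      rw [← map_sub]
      exact hle y _
  intro d
  refine ⟨key n hn hb d, ?_⟩
  -- The right action follows by taking adjoints, with `n` replaced by `n*`.
  have h := ContinuousStar.continuous_star.comp (key _ hn.star hb.star (star d))
  refine h.congr fun z => ?_
  change star ((V (τ z) * star (n z) * star (V (τ z))).fst (star d)) = _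
  rw [← star_conj, DoubleCentralizer.star_fst, star_star, star_star]

theorem IsSqueeze.corner {V : unitInterval → 𝓜(ℂ, D)} (hV : IsSqueeze δ V) {Z : Type*}
    [TopologicalSpace Z] {τ : Z → unitInterval} (hτ : Continuous τ) {n : Z → 𝓜(ℂ, D)}
    (hn : StrictlyContinuous n) (hb : UniformlyBounded n) :
    StrictlyContinuous fun z => corner (V (τ z)) (n z) := by
  have h1 := hV.conj hτ (.const 1) (.const 1)
  simp only [mul_one] at h1
  exact (hV.conj hτ hn hb).add ((StrictlyContinuous.const 1).sub h1)

theorem IsSqueeze.isRepPath {V : unitInterval → 𝓜(ℂ, D)} (hV : IsSqueeze δ V)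
    (x : CocycleRep α δ) : IsRepPath fun t => x.compress (hV.isometry t) where
  hom _ := hV.conj continuous_id (.const _) (.const _)
  cocycle := hV.corner continuous_fst (x.cocycle_continuous.comp continuous_snd)
    ⟨1, fun p => x.norm_cocycle_le p.2⟩

/-- The differences are identically zero, so no norm continuity is demanded of the path and
degeneration to `V = 0` is harmless. -/
theorem IsSqueeze.isHomotopy_diag {V : unitInterval → 𝓜(ℂ, D)} (hV : IsSqueeze δ V)
    (r : CocycleRep α δ) : IsHomotopy fun t => PairIn.diag (r.compress (hV.isometry t)) where
  fst := hV.isRepPath r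
  snd := hV.isRepPath r
  hom_sub _ := ⟨0, fun _ => (sub_self _).trans coe_zero.symm⟩
  cocycle_sub _ := ⟨0, fun _ => (sub_self _).trans coe_zero.symm⟩

/-- The path `t ↦ V t c (V t)*` in `D`. -/
def IsIsometryPath.conjPath {V : unitInterval → 𝓜(ℂ, D)} (hV : IsIsometryPath δ V) (c : D) :
    Cyl D :=
  ⟨fun t => (V t).fst ((star (V t)).snd c), hV.continuous.fst_apply
    hV.isSqueeze.uniformlyBounded (hV.continuous.star c).2⟩

theorem IsIsometryPath.conjPath_apply {V : unitInterval → 𝓜(ℂ, D)} (hV : IsIsometryPath δ V)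
    (c : D) (t : unitInterval) :
    ((hV.conjPath c t : D) : 𝓜(ℂ, D)) = V t * (c : 𝓜(ℂ, D)) * star (V t) := (conj_coe _ _).symm

/-- Here the differences are `V c V*` with `c ∈ D`. Strict continuity of `V` makes this path norm
continuous, which a squeeze would not give at its zero. -/
theorem IsIsometryPath.isHomotopy {V : unitInterval → 𝓜(ℂ, D)} (hV : IsIsometryPath δ V)
    (x : PairIn α δ) : IsHomotopy fun t => x.compress (hV.isSqueeze.isometry t) where
  fst := hV.isSqueeze.isRepPath x.fst
  snd := hV.isSqueeze.isRepPath x.snd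
  hom_sub a := by
    obtain ⟨c, hc⟩ := x.hom_sub a
    refine ⟨hV.conjPath c, fun t => ?_⟩
    rw [hV.conjPath_apply, ← hc, mul_sub, sub_mul]; rfl
  cocycle_sub g := by
    obtain ⟨c, hc⟩ := x.cocycle_sub g
    refine ⟨hV.conjPath c, fun t => ?_⟩
    rw [hV.conjPath_apply, ← hc, ← corner_sub_corner]; rfl

/-! ### Homotopies in the presence of a squeeze -/

/-- The fixed multipliers of `δ` contain a squeeze from `0` to `1`, and a path of isometries from
the first of two Cuntz isometries to `1`. -/
structure IsAbsorbing (δ : CStarAction G D) : Prop where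
  exists_squeeze : ∃ E : unitInterval → 𝓜(ℂ, D), IsSqueeze δ E ∧ E 0 = 0 ∧ E 1 = 1
  exists_path : ∃ (T : CuntzIsometries δ) (V : unitInterval → 𝓜(ℂ, D)),
    IsIsometryPath δ V ∧ V 0 = T.t₁ ∧ V 1 = 1

/-- Compression by `E` leaves `r` unchanged at `E = 1` and gives the trivial representation at `E =
0`. -/
theorem PairIn.diag_homotopic_trivial (hδ : IsAbsorbing δ) (r : CocycleRep α δ) :
    (PairIn.diag r).Homotopic (PairIn.trivial α δ) := by
  obtain ⟨E, hE, h0, h1⟩ := hδ.exists_squeeze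
  have h := (hE.isHomotopy_diag r).homotopic
  rw [CocycleRep.compress_zero _ h0, CocycleRep.compress_one _ h1] at h
  exact h.symm

/-- The path is `E W E* + 1 - E E*` for the squeeze `E`: it is `1` where `E = 0` and `W` where `E =
1`. In this way a squeeze makes the fixed unitary group strictly path connected. -/
theorem exists_unitary_path (hδ : IsAbsorbing δ) {W : 𝓜(ℂ, D)} (hW : W ∈ unitary 𝓜(ℂ, D))
    (hfix : ∀ g, multAut (δ.aut g) W = W) :
    ∃ V : unitInterval → 𝓜(ℂ, D), IsIsometryPath δ V ∧ V 0 = 1 ∧ V 1 = W := by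
  obtain ⟨E, hE, h0, h1⟩ := hδ.exists_squeeze
  refine ⟨fun t => corner (E t) W, ⟨fun t g => ?_, fun t => ?_, ?_⟩, ?_, ?_⟩
  · rw [multAut_corner ((hE.isometry t).fixed g), hfix]
  · exact (Unitary.mem_iff.1 (corner_mem_unitary (hE.isometry t).isometry hW)).1
  · exact hE.corner continuous_id (.const _) (.const _)
  · simp [corner, h0]
  · simp [corner, h1]

theorem PairIn.compress_one {V : 𝓜(ℂ, D)} (hV : IsFixedIsometryOrZero δ V) (h : V = 1)
    (x : PairIn α δ) : x.compress hV = x :=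
  PairIn.eq_of (CocycleRep.compress_one hV h _) (CocycleRep.compress_one hV h _)

theorem PairIn.compress_congr {V W : 𝓜(ℂ, D)} (hV : IsFixedIsometryOrZero δ V)
    (hW : IsFixedIsometryOrZero δ W) (h : V = W) (x : PairIn α δ) :
    x.compress hV = x.compress hW := by
  subst h; rfl

theorem PairIn.homotopic_compress (hδ : IsAbsorbing δ) {W : 𝓜(ℂ, D)}
    (hW : W ∈ unitary 𝓜(ℂ, D)) (hW' : IsFixedIsometryOrZero δ W) (x : PairIn α δ) :
    x.Homotopic (x.compress hW') := by
  obtain ⟨V, hV, h0, h1⟩ := exists_unitary_path hδ hW hW'.fixed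
  have h := (hV.isHomotopy x).homotopic
  rwa [PairIn.compress_one _ h0, PairIn.compress_congr _ hW' h1] at h

/-- If a fixed unitary conjugates the entries of `x` to those of `y`, then `x` and `y` are
homotopic. -/
theorem PairIn.homotopic_of_unitary (hδ : IsAbsorbing δ) {W : 𝓜(ℂ, D)}
    (hW : W ∈ unitary 𝓜(ℂ, D)) (hfix : ∀ g, multAut (δ.aut g) W = W) {x y : PairIn α δ}
    (h1 : ∀ a, y.fst.hom a = W * x.fst.hom a * star W)
    (h2 : ∀ g, y.fst.cocycle g = W * x.fst.cocycle g * star W)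
    (h3 : ∀ a, y.snd.hom a = W * x.snd.hom a * star W)
    (h4 : ∀ g, y.snd.cocycle g = W * x.snd.cocycle g * star W) : x.Homotopic y := by
  have hu := Unitary.mem_iff.1 hW
  have h := PairIn.homotopic_compress hδ hW ⟨hfix, .inl hu.1⟩ x
  convert h
  exact PairIn.eq_of
    (CocycleRep.eq_of (fun a => h1 a) fun g => by
      -- For a unitary `W` the complement `1 - W W*` vanishes, so the compressed cocycle is the
      -- plain conjugate.
      rw [h2]; simp [PairIn.compress, CocycleRep.compress_cocycle, corner, hu.2])
    (CocycleRep.eq_of (fun a => h3 a) fun g => by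
      rw [h4]; simp [PairIn.compress, CocycleRep.compress_cocycle, corner, hu.2])

/-! ### Unitaries and rotations built from Cuntz isometries. -/

namespace CuntzIsometries

variable (T S : CuntzIsometries δ)

theorem isometry₁_mul (x : 𝓜(ℂ, D)) : star T.t₁ * (T.t₁ * x) = x := by
  rw [← mul_assoc, T.isometry₁, one_mul]

theorem isometry₂_mul (x : 𝓜(ℂ, D)) : star T.t₂ * (T.t₂ * x) = x := by
  rw [← mul_assoc, T.isometry₂, one_mul]

theorem orth₁₂_mul (x : 𝓜(ℂ, D)) : star T.t₁ * (T.t₂ * x) = 0 := by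
  rw [← mul_assoc, T.orth₁₂, zero_mul]

theorem orth₂₁_mul (x : 𝓜(ℂ, D)) : star T.t₂ * (T.t₁ * x) = 0 := by
  rw [← mul_assoc, T.orth₂₁, zero_mul]

theorem sum_range_mul (x : 𝓜(ℂ, D)) : T.t₁ * (star T.t₁ * x) + T.t₂ * (star T.t₂ * x) = x := by
  rw [← mul_assoc, ← mul_assoc, ← add_mul, T.sum_range, one_mul]

/-- The unitary intertwining the Cuntz sums for `T` and `S`. -/
def transition : 𝓜(ℂ, D) := S.t₁ * star T.t₁ + S.t₂ * star T.t₂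

theorem transition_mem_unitary : transition T S ∈ unitary 𝓜(ℂ, D) := by
  rw [Unitary.mem_iff]
  constructor <;>
  simp only [transition, star_add, star_mul, star_star, mul_add, add_mul, mul_assoc,
    isometry₁_mul, isometry₂_mul, orth₁₂_mul, orth₂₁_mul, mul_zero, add_zero, zero_add, sum_range]

theorem multAut_transition (g : G) : multAut (δ.aut g) (transition T S) = transition T S := by
  simp only [transition, multAut_add, multAut_mul, multAut_star, fixed₁, fixed₂]

theorem transition_conj (m n : 𝓜(ℂ, D)) :
    transition T S * T.sum m n * star (transition T S) = S.sum m n := by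
  simp only [transition, sum, star_add, star_mul, star_star, mul_add, add_mul, mul_assoc,
    isometry₁_mul, isometry₂_mul, orth₁₂_mul, orth₂₁_mul, mul_zero, add_zero, zero_add]

/-- The Cuntz isometries in the opposite order. -/
def flip : CuntzIsometries δ where
  t₁ := T.t₂
  t₂ := T.t₁
  fixed₁ := T.fixed₂
  fixed₂ := T.fixed₁
  isometry₁ := T.isometry₂
  isometry₂ := T.isometry₁
  sum_range := by rw [add_comm, T.sum_range]

theorem flip_sum (m n : 𝓜(ℂ, D)) : T.flip.sum m n = T.sum n m := add_comm _ _

/-- The unitary intertwining `T.sum m (T.sum n k)` and `T.sum (T.sum m n) k`. -/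
def associator : 𝓜(ℂ, D) :=
  T.t₁ * T.t₁ * star T.t₁ + T.t₁ * T.t₂ * star (T.t₂ * T.t₁) + T.t₂ * star (T.t₂ * T.t₂)

theorem associator_mem_unitary : T.associator ∈ unitary 𝓜(ℂ, D) := by
  rw [Unitary.mem_iff]
  constructor
  · simp only [associator, star_add, star_mul, star_star, mul_add, add_mul, mul_assoc,
      isometry₁_mul, isometry₂_mul, orth₁₂_mul, orth₂₁_mul, mul_zero, add_zero, zero_add]
    rw [add_assoc, ← mul_add, sum_range_mul, sum_range]
  · simp only [associator, star_add, star_mul, star_star, mul_add, add_mul, mul_assoc,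
      isometry₁_mul, isometry₂_mul, orth₁₂_mul, orth₂₁_mul, mul_zero, add_zero, zero_add]
    rw [← mul_add, sum_range_mul, sum_range]

theorem multAut_associator (g : G) : multAut (δ.aut g) T.associator = T.associator := by
  simp only [associator, multAut_add, multAut_mul, multAut_star, fixed₁, fixed₂]

theorem associator_conj (m n k : 𝓜(ℂ, D)) :
    T.associator * T.sum m (T.sum n k) * star T.associator = T.sum (T.sum m n) k := by
  simp only [associator, sum, star_add, star_mul, star_star, mul_add, add_mul, mul_assoc,
    isometry₁_mul, isometry₂_mul, orth₁₂_mul, orth₂₁_mul, mul_zero, add_zero, zero_add]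

/-- The generator `t₂ t₁* - t₁ t₂*` of the rotations. -/
def rotGen : 𝓜(ℂ, D) := T.t₂ * star T.t₁ - T.t₁ * star T.t₂

theorem star_rotGen : star T.rotGen = -T.rotGen := by
  simp only [rotGen, star_sub, star_mul, star_star, neg_sub]

theorem rotGen_mul_self : T.rotGen * T.rotGen = -1 := by
  rw [← T.sum_range]
  simp only [rotGen, mul_sub, sub_mul, mul_assoc,
    isometry₁_mul, isometry₂_mul, orth₁₂_mul, orth₂₁_mul, mul_zero]
  abel

/-- Through `t₁, t₂`, the multiplier algebra becomes 2 × 2 matrices over itself; `rotGen` is a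
scalar matrix there and `T.sum m m` is `m` times the identity. -/
theorem rotGen_comm (m : 𝓜(ℂ, D)) : T.rotGen * T.sum m m = T.sum m m * T.rotGen := by
  simp only [rotGen, sum, mul_sub, sub_mul, mul_add, add_mul, mul_assoc,
    isometry₁_mul, isometry₂_mul, orth₁₂_mul, orth₂₁_mul, mul_zero]
  abel

theorem rotGen_conj (m n : 𝓜(ℂ, D)) :
    T.rotGen * T.sum m n * star T.rotGen = T.sum n m := by
  simp only [rotGen, sum, star_sub, star_mul, star_star, mul_sub, sub_mul, mul_add, add_mul,
    mul_assoc, isometry₁_mul, isometry₂_mul, orth₁₂_mul, orth₂₁_mul, mul_zero]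
  abel

/-- The rotation by the angle `π t / 2`. -/
def rot (t : unitInterval) : 𝓜(ℂ, D) :=
  (Real.cos (Real.pi / 2 * t) : ℂ) • (1 : 𝓜(ℂ, D)) + (Real.sin (Real.pi / 2 * t) : ℂ) • T.rotGen

theorem rot_zero : T.rot 0 = 1 := by simp [rot]

theorem rot_one : T.rot 1 = T.rotGen := by simp [rot]

theorem star_rot (t : unitInterval) : star (T.rot t) = (Real.cos (Real.pi / 2 * t) : ℂ) •
    (1 : 𝓜(ℂ, D)) - (Real.sin (Real.pi / 2 * t) : ℂ) • T.rotGen := by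
  simp only [rot, star_add, star_smul, star_one, star_rotGen, smul_neg, RCLike.star_def,
    Complex.conj_ofReal, sub_eq_add_neg]

/-- With `J = rotGen` skew-adjoint and `J² = -1`, this is `(cos - sin J)(cos + sin J) = cos² + sin²
= 1`. -/
theorem rot_star_mul (t : unitInterval) : star (T.rot t) * T.rot t = 1 := by
  have h : ((Real.cos (Real.pi / 2 * t) : ℂ) * (Real.cos (Real.pi / 2 * t) : ℂ) +
    (Real.sin (Real.pi / 2 * t) : ℂ) * (Real.sin (Real.pi / 2 * t) : ℂ)) = 1 := by
    rw [← sq, ← sq]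
    exact_mod_cast Real.cos_sq_add_sin_sq (Real.pi / 2 * t)
  rw [star_rot, rot]
  simp only [sub_mul, mul_add, smul_mul_smul_comm, T.rotGen_mul_self, mul_one, one_mul, smul_neg]
  rw [mul_comm (Real.sin _ : ℂ) (Real.cos _ : ℂ)]
  rw [show ∀ a b c : 𝓜(ℂ, D), a - b + (b - -c) = a + c by intros; abel, ← add_smul, h, one_smul]

theorem rot_mul_star (t : unitInterval) : T.rot t * star (T.rot t) = 1 := by
  rw [← T.rot_star_mul t, star_rot, rot]
  simp only [sub_mul, mul_add, mul_sub, add_mul, smul_mul_smul_comm, mul_one, one_mul]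
  rw [mul_comm (Real.sin _ : ℂ) (Real.cos _ : ℂ)]
  abel

theorem isIsometryPath_rot : IsIsometryPath δ T.rot where
  fixed t g := by
    simp only [rot, rotGen, multAut_add, multAut_sub, multAut_smul, multAut_one, multAut_mul,
      multAut_star, fixed₁, fixed₂]
  isometry := T.rot_star_mul
  continuous := .of_continuous (by unfold rot; fun_prop)

theorem rot_conj_sum (t : unitInterval) (m : 𝓜(ℂ, D)) :
    T.rot t * T.sum m m * star (T.rot t) = T.sum m m := by
  have h : T.rot t * T.sum m m = T.sum m m * T.rot t := by
    simp only [rot, add_mul, mul_add, smul_mul_assoc, mul_smul_comm, one_mul, mul_one, rotGen_comm]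
  rw [h, mul_assoc, rot_mul_star, mul_one]

/-- Both sums are perturbations of `T.sum n n`, which the rotation fixes; only the perturbations,
supported in one corner each, remain. -/
theorem sum_sub_rot_conj (t : unitInterval) (m n : 𝓜(ℂ, D)) :
    T.sum m n - T.rot t * T.sum n m * star (T.rot t)
      = T.t₁ * (m - n) * star T.t₁
        - T.rot t * (T.t₂ * (m - n) * star T.t₂) * star (T.rot t) := by
  have h1 : T.sum m n = T.sum n n + T.t₁ * (m - n) * star T.t₁ := by
    simp only [sum]; noncomm_ring
  have h2 : T.sum n m = T.sum n n + T.t₂ * (m - n) * star T.t₂ := by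
    simp only [sum]; noncomm_ring
  rw [h1, h2, mul_add, add_mul, rot_conj_sum]
  abel

/-- This keeps the rotation homotopy inside the set of pairs: since `m - n ∈ D`, both surviving
terms are norm-continuous paths in `D`. -/
theorem exists_sum_sub_rot_conj {m n : 𝓜(ℂ, D)} (h : InIdeal (m - n)) : ∃ f : Cyl D, ∀ t,
    T.sum m n - T.rot t * T.sum n m * star (T.rot t) = ((f t : D) : 𝓜(ℂ, D)) := by
  obtain ⟨c, hc⟩ := h
  refine ⟨ContinuousMap.const _ (T.t₁.fst ((star T.t₁).snd c))
    - T.isIsometryPath_rot.conjPath (T.t₂.fst ((star T.t₂).snd c)), fun t => ?_⟩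
  rw [sum_sub_rot_conj, ContinuousMap.sub_apply, coe_sub, IsIsometryPath.conjPath_apply, hc,
    conj_coe, conj_coe, ContinuousMap.const_apply]

end CuntzIsometries

/-- The fixed unitary `s₁ t₁* + s₂ t₂*` conjugates one sum into the other. -/
theorem PairIn.cuntzSum_homotopic_cuntzSum (hδ : IsAbsorbing δ) (T S : CuntzIsometries δ)
    (x y : PairIn α δ) : (x.cuntzSum T y).Homotopic (x.cuntzSum S y) :=
  PairIn.homotopic_of_unitary hδ (T.transition_mem_unitary S) (T.multAut_transition S)
    (fun _ => (T.transition_conj S _ _).symm) (fun _ => (T.transition_conj S _ _).symm)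
    (fun _ => (T.transition_conj S _ _).symm) (fun _ => (T.transition_conj S _ _).symm)

theorem PairIn.cuntzSum_flip (T : CuntzIsometries δ) (x y : PairIn α δ) :
    x.cuntzSum T.flip y = y.cuntzSum T x :=
  PairIn.eq_of (CocycleRep.eq_of (fun _ => T.flip_sum _ _) fun _ => T.flip_sum _ _)
    (CocycleRep.eq_of (fun _ => T.flip_sum _ _) fun _ => T.flip_sum _ _)

/-- Exchanging the summands amounts to exchanging the isometries, so this is a case of independence
of the choice of isometries. -/
theorem PairIn.cuntzSum_comm (hδ : IsAbsorbing δ) (T : CuntzIsometries δ) (x y : PairIn α δ) :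
    (x.cuntzSum T y).Homotopic (y.cuntzSum T x) := by
  rw [← PairIn.cuntzSum_flip]
  exact PairIn.cuntzSum_homotopic_cuntzSum hδ _ _ _ _

theorem PairIn.cuntzSum_assoc (hδ : IsAbsorbing δ) (T : CuntzIsometries δ) (x y z : PairIn α δ) :
    (x.cuntzSum T (y.cuntzSum T z)).Homotopic ((x.cuntzSum T y).cuntzSum T z) :=
  PairIn.homotopic_of_unitary hδ T.associator_mem_unitary T.multAut_associator
    (fun _ => (T.associator_conj _ _ _).symm) (fun _ => (T.associator_conj _ _ _).symm)
    (fun _ => (T.associator_conj _ _ _).symm) (fun _ => (T.associator_conj _ _ _).symm)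

/-- The complement `1 - t₁ t₁*` is `t₂ t₂*`, on which the trivial representation acts. -/
theorem CocycleRep.compress_t₁ (T : CuntzIsometries δ) (hT : IsFixedIsometryOrZero δ T.t₁)
    (x : CocycleRep α δ) : x.compress hT = x.cuntzSum T (.trivial α δ) := by
  refine CocycleRep.eq_of (fun a => ?_) fun g => ?_
  · simp [compress_hom, cuntzSum_hom, CuntzIsometries.sum, CocycleRep.trivial]
  · have h : 1 - T.t₁ * star T.t₁ = T.t₂ * star T.t₂ := by
      rw [← T.sum_range, add_sub_cancel_left]
    simp [compress_cocycle, cuntzSum_cocycle, CuntzIsometries.sum, CocycleRep.trivial, corner, h]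

/-- After changing to the isometries supplied by `IsAbsorbing`, the sum is compression by `t₁`, and
the path from `t₁` to `1` undoes the compression. -/
theorem PairIn.cuntzSum_trivial (hδ : IsAbsorbing δ) (S : CuntzIsometries δ) (x : PairIn α δ) :
    (x.cuntzSum S (.trivial α δ)).Homotopic x := by
  obtain ⟨T, V, hV, h0, h1⟩ := hδ.exists_path
  refine (PairIn.cuntzSum_homotopic_cuntzSum hδ S T _ _).trans ?_
  have h := (hV.isHomotopy x).homotopic
  have hT : IsFixedIsometryOrZero δ T.t₁ := ⟨T.fixed₁, .inl T.isometry₁⟩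
  rw [PairIn.compress_one _ h1, PairIn.compress_congr _ hT h0] at h
  convert h
  exact PairIn.eq_of (CocycleRep.compress_t₁ T hT _).symm (CocycleRep.compress_t₁ T hT _).symm

/-- The homotopy rotating the second entry of `x ⊕ x.swap`. -/
theorem PairIn.exists_rotation (T : CuntzIsometries δ) (x : PairIn α δ) :
    ∃ p : unitInterval → PairIn α δ, IsHomotopy p ∧ p 0 = x.cuntzSum T x.swap ∧
      p 1 = PairIn.diag (x.fst.cuntzSum T x.snd) := by
  have hR := T.isIsometryPath_rot
  have hh := fun a => T.exists_sum_sub_rot_conj (x.hom_sub a)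
  have hc : ∀ g, ∃ f : Cyl D, ∀ t, T.sum (x.fst.cocycle g) (x.snd.cocycle g)
      - corner (T.rot t) (T.sum (x.snd.cocycle g) (x.fst.cocycle g)) = ((f t : D) : 𝓜(ℂ, D)) := by
    intro g
    obtain ⟨f, hf⟩ := T.exists_sum_sub_rot_conj (x.cocycle_sub g)
    refine ⟨f, fun t => ?_⟩
    rw [corner, T.rot_mul_star, sub_self, add_zero, hf]
  -- The first entry stays fixed; the second is conjugated by the rotation, which at its end
  -- interchanges the two summands.
  refine ⟨fun t => ⟨x.fst.cuntzSum T x.snd,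
    (x.snd.cuntzSum T x.fst).compress (hR.isSqueeze.isometry t), fun a => ?_, fun g => ?_⟩,
    ⟨.const _, hR.isSqueeze.isRepPath _, hh, hc⟩, ?_, ?_⟩
  · obtain ⟨f, hf⟩ := hh a
    exact ⟨f t, hf t⟩
  · obtain ⟨f, hf⟩ := hc g
    exact ⟨f t, hf t⟩
  · exact PairIn.eq_of rfl (CocycleRep.compress_one (hR.isSqueeze.isometry 0) T.rot_zero _)
  · refine PairIn.eq_of rfl (CocycleRep.eq_of (fun a => ?_) fun g => ?_)
    · change T.rot 1 * T.sum _ _ * star (T.rot 1) = T.sum _ _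
      rw [T.rot_one, T.rotGen_conj]
    · change corner (T.rot 1) (T.sum _ _) = T.sum _ _
      rw [corner, T.rot_mul_star, sub_self, add_zero, T.rot_one, T.rotGen_conj]

/-- The rotation makes the two entries equal, and diagonal pairs are squeezed to the trivial pair.
-/
theorem PairIn.cuntzSum_swap (hδ : IsAbsorbing δ) (T : CuntzIsometries δ) (x : PairIn α δ) :
    (x.cuntzSum T x.swap).Homotopic (.trivial α δ) := by
  obtain ⟨p, hp, h0, h1⟩ := PairIn.exists_rotation T x
  have h := hp.homotopic
  rw [h0, h1] at h
  exact h.trans (PairIn.diag_homotopic_trivial hδ _)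

end Compress

/-! ### The Cayley path of an isometry -/

section Cayley

open Filter Topology

variable {M : Type w} [CStarAlgebra M]

theorem norm_isometry_le {V : M} (h : star V * V = 1) : ‖V‖ ≤ 1 := by
  rcases subsingleton_or_nontrivial M with h0 | h0
  · rw [Subsingleton.elim V 0]; simp
  · have h1 := CStarRing.norm_star_mul_self (x := V)
    rw [h, CStarRing.norm_one] at h1
    nlinarith [norm_nonneg V]

theorem isUnit_one_add_smul {S : M} (hS : ‖S‖ ≤ 1) {a : ℝ} (h0 : 0 ≤ a) (h1 : a < 1) :
    IsUnit (1 + (a : ℂ) • S) := by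
  have h : ‖-((a : ℂ) • S)‖ < 1 := by
    rw [norm_neg, norm_smul, Complex.norm_real, Real.norm_of_nonneg h0]
    exact (mul_le_of_le_one_right h0 hS).trans_lt h1
  simpa using isUnit_one_sub_of_norm_lt_one h

/-- The path `a ↦ (S + a) (1 + a S)⁻¹`, which extends strictly continuously by `1` to `a = 1`. -/
def cayley (S : M) (a : ℝ) : M :=
  if a < 1 then (S + (a : ℂ) • 1) * Ring.inverse (1 + (a : ℂ) • S) else 1

theorem cayley_of_one_le (S : M) {a : ℝ} (h : 1 ≤ a) : cayley S a = 1 := if_neg h.not_gt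

theorem cayley_zero (S : M) : cayley S 0 = S := by simp [cayley]

theorem star_cayley_mul_self {S : M} (hS : star S * S = 1) {a : ℝ} (h0 : 0 ≤ a) :
    star (cayley S a) * cayley S a = 1 := by
  unfold cayley
  split_ifs with h1
  · have hu := isUnit_one_add_smul (norm_isometry_le hS) h0 h1
    have hr := Ring.mul_inverse_cancel _ hu
    set r := Ring.inverse (1 + (a : ℂ) • S)
    have hr' : star r * (1 + (a : ℂ) • star S) = 1 := by
      have := congr_arg star hr
      simpa using this
    -- Both sides equal `1 + a² + a (S + S*)`, because `S* S = 1` and `a` is real.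
    have key : (star S + (a : ℂ) • 1) * (S + (a : ℂ) • 1)
        = (1 + (a : ℂ) • star S) * (1 + (a : ℂ) • S) := by
      simp only [mul_add, add_mul, hS, smul_mul_assoc, mul_smul_comm, one_mul, mul_one, smul_add]
      abel
    have e : star ((S + (a : ℂ) • 1) * r) = star r * (star S + (a : ℂ) • 1) := by simp
    rw [e, mul_assoc, ← mul_assoc _ _ r, key, ← mul_assoc, ← mul_assoc, hr', one_mul, hr]
  · simp

theorem continuousAt_cayley {S : M} (hS : ‖S‖ ≤ 1) {a : ℝ} (h0 : 0 ≤ a) (h1 : a < 1) :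
    ContinuousAt (cayley S) a := by
  have h : (fun a : ℝ => (S + (a : ℂ) • 1) * Ring.inverse (1 + (a : ℂ) • S)) =ᶠ[𝓝 a]
      cayley S := by
    filter_upwards [Iio_mem_nhds h1] with b hb
    exact (if_pos hb).symm
  refine ContinuousAt.congr ?_ h
  have hu := isUnit_one_add_smul hS h0 h1
  have h2 : ContinuousAt (Ring.inverse : M → M) (1 + (a : ℂ) • S) := by
    have := NormedRing.inverse_continuousAt hu.unit
    simpa using this
  have h3 : ContinuousAt (fun a : ℝ => 1 + (a : ℂ) • S) a := by fun_prop
  have h4 : ContinuousAt (fun a : ℝ => Ring.inverse (1 + (a : ℂ) • S)) a :=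
    ContinuousAt.comp (g := Ring.inverse) h2 h3
  have h5 : ContinuousAt (fun a : ℝ => S + (a : ℂ) • (1 : M)) a := by fun_prop
  exact h5.mul h4

/-! ### Resolvent estimates as `a` tends to 1. -/

section Estimates

variable {S r : M} {a : ℝ}

/-- Iterating `r* x = x - a r* S* x` trades each step for one summand `‖x‖` and another power of
`S*`; the crude bound `(1 - a) ‖r* y‖ ≤ ‖y‖` ends the iteration. If `S*ⁿ x → 0`, choosing `N` first
and then `a` close to `1` makes the right-hand side small. -/
theorem norm_star_resolvent_le (hS : ‖S‖ ≤ 1) (h0 : 0 ≤ a) (h1 : a < 1)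
    (hr : r * (1 + (a : ℂ) • S) = 1) (hr' : (1 + (a : ℂ) • S) * r = 1) (N : ℕ) (x : M) :
    (1 - a) * ‖star r * x‖ ≤ N * ((1 - a) * ‖x‖) + ‖star S ^ N * x‖ := by
  have hs : (1 + (a : ℂ) • star S) * star r = 1 := by simpa using congr_arg star hr
  have hs' : star r * (1 + (a : ℂ) • star S) = 1 := by simpa using congr_arg star hr'
  have hle : ∀ y : M, ‖star S * y‖ ≤ ‖y‖ := fun y =>
    (norm_mul_le _ _).trans (mul_le_of_le_one_left (norm_nonneg _) (by rwa [norm_star]))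
  have ha : ‖(a : ℂ)‖ = a := by rw [Complex.norm_real, Real.norm_of_nonneg h0]
  induction N generalizing x with
  | zero =>
    -- The base case places `S*` in front of the resolvent, so that the norm of `r* x` can be
    -- absorbed on the left.
    have e : star r * x = x - (a : ℂ) • (star S * (star r * x)) := by
      have : (1 + (a : ℂ) • star S) * (star r * x) = x := by rw [← mul_assoc, hs, one_mul]
      rw [add_mul, one_mul, smul_mul_assoc] at this
      exact eq_sub_of_add_eq this
    have : ‖star r * x‖ ≤ ‖x‖ + a * ‖star r * x‖ := by
      conv_lhs => rw [e]
      refine (norm_sub_le _ _).trans (add_le_add le_rfl ?_)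
      rw [norm_smul, ha]
      exact mul_le_mul_of_nonneg_left (hle _) h0
    simp only [Nat.cast_zero, zero_mul, zero_add, pow_zero, one_mul]
    linarith
  | succ N ih =>
    have e : star r * x = x - (a : ℂ) • (star r * (star S * x)) := by
      have : star r * (1 + (a : ℂ) • star S) * x = x := by rw [hs', one_mul]
      rw [mul_add, mul_one, mul_smul_comm, add_mul, smul_mul_assoc, mul_assoc] at this
      exact eq_sub_of_add_eq this
    have h2 : ‖star r * x‖ ≤ ‖x‖ + ‖star r * (star S * x)‖ := by
      conv_lhs => rw [e]
      refine (norm_sub_le _ _).trans (add_le_add le_rfl ?_)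
      rw [norm_smul, ha]
      exact mul_le_of_le_one_left (norm_nonneg _) h1.le
    have h3 := ih (star S * x)
    rw [← mul_assoc (star S ^ N), ← pow_succ] at h3
    have h4 : (N : ℝ) * ((1 - a) * ‖star S * x‖) ≤ N * ((1 - a) * ‖x‖) := by
      have := hle x
      have h5 : 0 ≤ 1 - a := by linarith
      gcongr
    have h5 := mul_le_mul_of_nonneg_left h2 (by linarith : (0 : ℝ) ≤ 1 - a)
    push_cast
    linarith

/-- Transfers smallness from `r* x` to `r x`. For an isometry `(1 - a²) r* r = r + r* - 1`;
sandwiching between `x*` and `x` bounds `‖r x‖²` linearly in `‖r* x‖`. -/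
theorem norm_resolvent_sq_le (hS : star S * S = 1) (h0 : 0 ≤ a) (h1 : a < 1)
    (hr' : (1 + (a : ℂ) • S) * r = 1) (x : M) :
    ((1 - a) * ‖r * x‖) ^ 2 ≤ 2 * ‖x‖ * ((1 - a) * ‖star r * x‖) + (1 - a) * ‖x‖ ^ 2 := by
  have hs' : star r * (1 + (a : ℂ) • star S) = 1 := by simpa using congr_arg star hr'
  have key : ((1 - a ^ 2 : ℝ) : ℂ) • (star r * r) = star r + r - 1 := by
    -- Multiplying this identity by `r*` on the left and `r` on the right gives `key`.
    have e : (1 + (a : ℂ) • S) + (1 + (a : ℂ) • star S)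
        = (1 + (a : ℂ) • star S) * (1 + (a : ℂ) • S) + ((1 - a ^ 2 : ℝ) : ℂ) • 1 := by
      simp only [mul_add, add_mul, hS, smul_mul_assoc, mul_smul_comm, one_mul, mul_one, smul_add]
      push_cast
      rw [sub_smul, one_smul, sq, mul_smul]
      abel
    have e3 : star r * ((1 + (a : ℂ) • S) * r) = star r := by rw [hr', mul_one]
    have e4 : star r * (1 + (a : ℂ) • star S) * r = r := by rw [hs', one_mul]
    have e5 : star r * ((1 + (a : ℂ) • star S) * (1 + (a : ℂ) • S)) * r = 1 := by
      rw [← mul_assoc, hs', one_mul, hr']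
    have e6 := congr_arg (fun z => star r * z * r) e
    generalize 1 + (a : ℂ) • S = P at *
    generalize 1 + (a : ℂ) • star S = Q at *
    rw [mul_add, mul_add, add_mul, add_mul, e5, e4, mul_assoc, e3, mul_smul_comm, smul_mul_assoc,
      mul_one] at e6
    rw [e6, add_sub_cancel_left]
  have hn : (1 - a ^ 2) * ‖r * x‖ ^ 2 ≤ 2 * ‖x‖ * ‖star r * x‖ + ‖x‖ ^ 2 := by
    have e1 : ‖((1 - a ^ 2 : ℝ) : ℂ) • (star (r * x) * (r * x))‖ = (1 - a ^ 2) * ‖r * x‖ ^ 2 := by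
      rw [norm_smul, CStarRing.norm_star_mul_self, Complex.norm_real, Real.norm_of_nonneg, sq ‖_‖]
      nlinarith
    have e2 : ((1 - a ^ 2 : ℝ) : ℂ) • (star (r * x) * (r * x))
        = star x * (star r * x) + star (star r * x) * x - star x * x := by
      have : star (r * x) * (r * x) = star x * (star r * r) * x := by
        simp only [star_mul, mul_assoc]
      rw [this, ← smul_mul_assoc, ← mul_smul_comm, key]
      simp only [star_mul, star_star, mul_sub, mul_add, add_mul, sub_mul, mul_one, mul_assoc]
    rw [← e1, e2]
    refine (norm_sub_le _ _).trans ?_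
    refine (add_le_add (norm_add_le _ _) le_rfl).trans ?_
    have f1 : ‖star x * (star r * x)‖ ≤ ‖x‖ * ‖star r * x‖ :=
      (norm_mul_le _ _).trans (by rw [norm_star])
    have f2 : ‖star (star r * x) * x‖ ≤ ‖x‖ * ‖star r * x‖ :=
      (norm_mul_le _ _).trans (by rw [norm_star, mul_comm])
    rw [CStarRing.norm_star_mul_self, ← sq]
    linarith
  have h2 : (1 - a) * ‖r * x‖ ^ 2 ≤ (1 - a ^ 2) * ‖r * x‖ ^ 2 := by
    refine mul_le_mul_of_nonneg_right ?_ (sq_nonneg _)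
    nlinarith
  have h3 := mul_le_mul_of_nonneg_left (h2.trans hn) (by linarith : (0 : ℝ) ≤ 1 - a)
  linarith

theorem cayley_sub_one (h1 : a < 1) (hu : IsUnit (1 + (a : ℂ) • S)) :
    cayley S a - 1 = -(((1 - a : ℝ) : ℂ) • ((1 - S) * Ring.inverse (1 + (a : ℂ) • S))) := by
  have hr := Ring.mul_inverse_cancel _ hu
  rw [cayley, if_pos h1]
  set r := Ring.inverse (1 + (a : ℂ) • S)
  have e : S + (a : ℂ) • (1 : M) - (1 + (a : ℂ) • S) = -(((1 - a : ℝ) : ℂ) • (1 - S)) := by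
    push_cast
    rw [sub_smul, one_smul, smul_sub]
    abel
  calc _ = (S + (a : ℂ) • (1 : M)) * r - (1 + (a : ℂ) • S) * r := by rw [hr]
    _ = _ := by rw [← sub_mul, e, neg_mul, smul_mul_assoc]

end Estimates

/-- The difference from `1` is `-(1 - a)(1 - S) r`, so both limits reduce to `(1 - a) r x → 0` and
`(1 - a) r* x → 0`. The decay of `S*ⁿ x` gives the second, and the second gives the first. -/
theorem tendsto_cayley {S : M} (hS : star S * S = 1) {x : M}
    (hx : Tendsto (fun n : ℕ => star S ^ n * x) atTop (𝓝 0)) :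
    Tendsto (fun a => ‖(cayley S a - 1) * x‖) (𝓝 1) (𝓝 0) ∧
      Tendsto (fun a => ‖star (cayley S a - 1) * x‖) (𝓝 1) (𝓝 0) := by
  have hS1 := norm_isometry_le hS
  set R : ℝ → M := fun a => Ring.inverse (1 + (a : ℂ) • S) with hR
  have hev : ∀ᶠ a : ℝ in 𝓝[<] 1, 0 ≤ a ∧ a < 1 := by
    filter_upwards [Ioo_mem_nhdsLT (zero_lt_one' ℝ)] with a ha
    exact ⟨ha.1.le, ha.2⟩
  have hlim : Tendsto (fun a : ℝ => 1 - a) (𝓝[<] 1) (𝓝 0) := by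
    have : Continuous fun a : ℝ => 1 - a := by fun_prop
    simpa using (this.tendsto 1).mono_left nhdsWithin_le_nhds
  have hf : Tendsto (fun a : ℝ => (1 - a) * ‖star (R a) * x‖) (𝓝[<] 1) (𝓝 0) := by
    rw [Metric.tendsto_nhds]
    intro ε hε
    obtain ⟨N, hN⟩ := ((Metric.tendsto_nhds.1 hx) (ε / 2) (half_pos hε)).exists
    rw [dist_zero_right] at hN
    have h2 : Tendsto (fun a : ℝ => N * ((1 - a) * ‖x‖)) (𝓝[<] 1) (𝓝 0) := by
      simpa using (hlim.mul_const ‖x‖).const_mul (N : ℝ)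
    filter_upwards [hev, h2.eventually_lt_const (half_pos hε)] with a ha h3
    have hu := isUnit_one_add_smul hS1 ha.1 ha.2
    have h4 := norm_star_resolvent_le hS1 ha.1 ha.2 (Ring.inverse_mul_cancel _ hu)
      (Ring.mul_inverse_cancel _ hu) N x
    rw [Real.dist_eq, sub_zero, abs_of_nonneg (mul_nonneg (by linarith [ha.2]) (norm_nonneg _))]
    exact h4.trans_lt (by linarith)
  have hg : Tendsto (fun a : ℝ => (1 - a) * ‖R a * x‖) (𝓝[<] 1) (𝓝 0) := by
    have h2 : Tendsto (fun a : ℝ => √(2 * ‖x‖ * ((1 - a) * ‖star (R a) * x‖)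
        + (1 - a) * ‖x‖ ^ 2)) (𝓝[<] 1) (𝓝 0) := by
      have := ((hf.const_mul (2 * ‖x‖)).add (hlim.mul_const (‖x‖ ^ 2))).sqrt
      simpa using this
    refine tendsto_of_tendsto_of_tendsto_of_le_of_le' tendsto_const_nhds h2 ?_ ?_
    · filter_upwards [hev] with a ha
      exact mul_nonneg (by linarith [ha.2]) (norm_nonneg _)
    · filter_upwards [hev] with a ha
      have hu := isUnit_one_add_smul hS1 ha.1 ha.2
      exact Real.le_sqrt_of_sq_le
        (norm_resolvent_sq_le hS ha.1 ha.2 (Ring.mul_inverse_cancel _ hu) x)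
  have h1S : ‖1 - S‖ ≤ 2 := by
    have h1 : ‖(1 : M)‖ ≤ 1 := norm_isometry_le (by simp)
    exact (norm_sub_le _ _).trans (by linarith)
  -- To the right of `a = 1` the path is constantly `1`, so only the left limits carry content.
  rw [← nhdsLT_sup_nhdsGE]
  refine ⟨.sup ?_ ?_, .sup ?_ ?_⟩
  · refine squeeze_zero' (.of_forall fun _ => norm_nonneg _) ?_ (by simpa using hg.const_mul 2)
    filter_upwards [hev] with a ha
    have hu := isUnit_one_add_smul hS1 ha.1 ha.2
    rw [cayley_sub_one ha.2 hu, neg_mul, norm_neg, smul_mul_assoc, norm_smul, Complex.norm_real,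
      Real.norm_of_nonneg (by linarith [ha.2]), mul_assoc]
    have := norm_mul_le (1 - S) (R a * x)
    have h3 : ‖1 - S‖ * ‖R a * x‖ ≤ 2 * ‖R a * x‖ := by gcongr
    have h4 := mul_le_mul_of_nonneg_left (this.trans h3) (by linarith [ha.2] : (0 : ℝ) ≤ 1 - a)
    linarith
  · refine tendsto_const_nhds.congr' ?_
    filter_upwards [self_mem_nhdsWithin] with a ha
    rw [cayley_of_one_le S ha]; simp
  · refine squeeze_zero' (.of_forall fun _ => norm_nonneg _) ?_ (by simpa using hf.const_mul 2)
    filter_upwards [hev] with a ha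
    have hu := isUnit_one_add_smul hS1 ha.1 ha.2
    -- After commuting, the adjoint puts `(R a)*` directly in front of `x`, where the estimate
    -- applies.
    have hcomm : (1 - S) * R a = R a * (1 - S) := by
      have hc : Commute (1 - S) (1 + (a : ℂ) • S) := by
        refine Commute.sub_left (Commute.one_left _) (Commute.add_right (Commute.one_right _) ?_)
        exact (Commute.refl S).smul_right _
      have e1 := Ring.mul_inverse_cancel _ hu
      have e2 := Ring.inverse_mul_cancel _ hu
      calc (1 - S) * R a = R a * (1 + (a : ℂ) • S) * (1 - S) * R a := by rw [e2, one_mul]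
        _ = R a * ((1 - S) * (1 + (a : ℂ) • S)) * R a := by rw [mul_assoc (R a), hc.eq]
        _ = R a * (1 - S) := by rw [mul_assoc, mul_assoc, e1, mul_one]
    rw [cayley_sub_one ha.2 hu, hcomm, star_neg, star_smul, star_mul, neg_mul, norm_neg,
      smul_mul_assoc, norm_smul, norm_star, Complex.norm_real,
      Real.norm_of_nonneg (by linarith [ha.2]), mul_assoc]
    have := norm_mul_le (star (1 - S)) (star (R a) * x)
    rw [norm_star] at this
    have h3 : ‖1 - S‖ * ‖star (R a) * x‖ ≤ 2 * ‖star (R a) * x‖ := by gcongr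
    have h4 := mul_le_mul_of_nonneg_left (this.trans h3) (by linarith [ha.2] : (0 : ℝ) ≤ 1 - a)
    linarith
  · refine tendsto_const_nhds.congr' ?_
    filter_upwards [self_mem_nhdsWithin] with a ha
    rw [cayley_of_one_le S ha]; simp

end Cayley

/-! ### Paths of isometries in the multiplier algebra -/

section Step

open Filter Topology

variable {G : Type u} [Group G] [TopologicalSpace G]
variable {D : Type w} [NonUnitalCStarAlgebra D] {δ : CStarAction G D}

/-- Lets the estimates in the unital algebra `𝓜(D)` be applied with `x = d ∈ D` and read off as
norms in `D`. -/
theorem norm_mul_coe (m : 𝓜(ℂ, D)) (d : D) : ‖m * (d : 𝓜(ℂ, D))‖ = ‖m.fst d‖ := by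
  rw [mul_coe]
  exact NonUnitalStarAlgHom.norm_map (DoubleCentralizer.coeHom (𝕜 := ℂ) (A := D))
    (fun _ _ h => coe_injective h) _

/-- A `δ`-fixed isometry whose powers' range projections tend strictly to zero. -/
structure IsFixedShift (δ : CStarAction G D) (S : 𝓜(ℂ, D)) : Prop where
  fixed : ∀ g, multAut (δ.aut g) S = S
  isometry : star S * S = 1
  tendsto : ∀ d, Tendsto (fun n : ℕ => (star S ^ n).fst d) atTop (𝓝 0)

/-- An automorphism fixing `1 + a S` fixes its inverse. -/
theorem multAut_cayley {s : D ≃⋆ₐ[ℂ] D} {S : 𝓜(ℂ, D)} (hS : star S * S = 1)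
    (hs : multAut s S = S) {a : ℝ} (h0 : 0 ≤ a) : multAut s (cayley S a) = cayley S a := by
  unfold cayley
  split_ifs with h1
  · have hu := isUnit_one_add_smul (norm_isometry_le hS) h0 h1
    have hr := Ring.mul_inverse_cancel _ hu
    have hr' := Ring.inverse_mul_cancel _ hu
    set r := Ring.inverse (1 + (a : ℂ) • S)
    have h2 : multAut s (1 + (a : ℂ) • S) = 1 + (a : ℂ) • S := by
      rw [multAut_add, multAut_one, multAut_smul, hs]
    have h3 : multAut s r = r := by
      have h4 : multAut s r * (1 + (a : ℂ) • S) = 1 := by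
        have h5 := congr_arg (multAut s) hr'
        rwa [multAut_mul, h2, multAut_one] at h5
      calc multAut s r = multAut s r * ((1 + (a : ℂ) • S) * r) := by rw [hr, mul_one]
        _ = r := by rw [← mul_assoc, h4, one_mul]
    rw [multAut_mul, multAut_add, multAut_smul, multAut_one, hs, h3]
  · exact multAut_one s

/-- The path of isometries with value `1` for `t ≤ 0` and `S` for `1 ≤ t`. -/
def step (S : 𝓜(ℂ, D)) (t : ℝ) : 𝓜(ℂ, D) := cayley S (max 0 (1 - t))

theorem step_of_nonpos (S : 𝓜(ℂ, D)) {t : ℝ} (h : t ≤ 0) : step S t = 1 :=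
  cayley_of_one_le S (le_max_of_le_right (by linarith))

theorem step_of_one_le (S : 𝓜(ℂ, D)) {t : ℝ} (h : 1 ≤ t) : step S t = S := by
  rw [step, max_eq_left (by linarith), cayley_zero]

variable {S : 𝓜(ℂ, D)}

theorem IsFixedShift.star_step_mul_self (hS : IsFixedShift δ S) (t : ℝ) :
    star (step S t) * step S t = 1 := star_cayley_mul_self hS.isometry (le_max_left _ _)

theorem IsFixedShift.multAut_step (hS : IsFixedShift δ S) (g : G) (t : ℝ) :
    multAut (δ.aut g) (step S t) = step S t :=
  multAut_cayley hS.isometry (hS.fixed g) (le_max_left _ _)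

/-- In the Cayley parameter the path is norm continuous below `1` and constant above `1`; at `1`
itself the shift property enters through `tendsto_cayley`. -/
theorem IsFixedShift.strictlyContinuous_step (hS : IsFixedShift δ S) :
    StrictlyContinuous (step S) := by
  have key : ∀ b : ℝ, 0 ≤ b → ∀ d : D, ContinuousAt (fun a => (cayley S a).fst d) b ∧
      ContinuousAt (fun a => (star (cayley S a)).fst d) b := by
    intro b hb d
    have hlim : Tendsto (fun n : ℕ => star S ^ n * (d : 𝓜(ℂ, D))) atTop (𝓝 0) := by
      rw [tendsto_zero_iff_norm_tendsto_zero]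
      simp only [norm_mul_coe]
      exact tendsto_zero_iff_norm_tendsto_zero.1 (hS.tendsto d)
    rcases lt_trichotomy b 1 with h | rfl | h
    · have hc := continuousAt_cayley (norm_isometry_le hS.isometry) hb h
      have e : ∀ f : ℝ → 𝓜(ℂ, D), ContinuousAt f b → ContinuousAt (fun a => (f a).fst d) b := by
        intro f hf
        rw [ContinuousAt, tendsto_iff_norm_sub_tendsto_zero] at hf ⊢
        refine squeeze_zero (fun _ => norm_nonneg _)
          (fun a => norm_fst_apply_le (f a - f b) d) ?_
        simpa using hf.mul_const ‖d‖
      exact ⟨e _ hc, e _ hc.star⟩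
    · obtain ⟨h1, h2⟩ := tendsto_cayley hS.isometry hlim
      simp only [norm_mul_coe] at h1 h2
      constructor
      · rw [ContinuousAt, tendsto_iff_norm_sub_tendsto_zero, cayley_of_one_le S le_rfl]
        exact h1
      · rw [ContinuousAt, tendsto_iff_norm_sub_tendsto_zero, cayley_of_one_le S le_rfl]
        simp only [star_sub] at h2
        exact h2
    · have e : cayley S =ᶠ[𝓝 b] fun _ => 1 := by
        filter_upwards [Ioi_mem_nhds h] with a ha
        exact cayley_of_one_le S (le_of_lt ha)
      exact ⟨continuousAt_const.congr (e.fun_comp fun m => m.fst d).symm,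
        continuousAt_const.congr (e.fun_comp fun m => (star m).fst d).symm⟩
  have hm : Continuous fun t : ℝ => max 0 (1 - t) := by fun_prop
  intro d
  constructor
  · refine continuous_iff_continuousAt.2 fun t => ?_
    exact ContinuousAt.comp (g := fun a => (cayley S a).fst d)
      (key _ (le_max_left _ _) d).1 hm.continuousAt
  · refine continuous_iff_continuousAt.2 fun t => ?_
    have h : ContinuousAt (fun t => (star (step S t)).fst (star d)) t :=
      ContinuousAt.comp (g := fun a => (star (cayley S a)).fst (star d))
        (key _ (le_max_left _ _) _).2 hm.continuousAt
    have h2 := h.star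
    simpa only [DoubleCentralizer.star_fst, star_star] using h2

theorem IsFixedShift.isIsometryPath (hS : IsFixedShift δ S) :
    IsIsometryPath δ fun t => step S (1 - t) where
  fixed _ _ := hS.multAut_step _ _
  isometry _ := hS.star_step_mul_self _
  continuous := hS.strictlyContinuous_step.comp (by fun_prop)

/-- The product of the first `N` translates of `step S`. -/
def stepProd (S : 𝓜(ℂ, D)) : ℕ → ℝ → 𝓜(ℂ, D)
  | 0, _ => 1
  | N + 1, t => stepProd S N t * step S (t - N)

theorem IsFixedShift.star_stepProd_mul_self (hS : IsFixedShift δ S) (N : ℕ) (t : ℝ) :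
    star (stepProd S N t) * stepProd S N t = 1 := by
  induction N with
  | zero => simp [stepProd]
  | succ N ih =>
    rw [stepProd, star_mul, mul_assoc, ← mul_assoc _ _ (step S _), ih, one_mul,
      hS.star_step_mul_self]

theorem IsFixedShift.multAut_stepProd (hS : IsFixedShift δ S) (g : G) (N : ℕ) (t : ℝ) :
    multAut (δ.aut g) (stepProd S N t) = stepProd S N t := by
  induction N with
  | zero => exact multAut_one _
  | succ N ih => rw [stepProd, multAut_mul, ih, hS.multAut_step]

theorem IsFixedShift.strictlyContinuous_stepProd (hS : IsFixedShift δ S) (N : ℕ) :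
    StrictlyContinuous (stepProd S N) := by
  induction N with
  | zero => exact .const 1
  | succ N ih =>
    exact ih.mul ⟨1, fun t => norm_le_one_of_isometry (hS.star_stepProd_mul_self N t)⟩
      (hS.strictlyContinuous_step.comp (f := fun t : ℝ => t - N) (by fun_prop))
      ⟨1, fun t => norm_le_one_of_isometry (hS.star_step_mul_self _)⟩

/-- At a time `t ≤ N` the factors of index at least `N` have not started and equal `1`. -/
theorem stepProd_eq_of_le {N M : ℕ} (h : N ≤ M) {t : ℝ} (ht : t ≤ N) :
    stepProd S M t = stepProd S N t := by
  induction M, h using Nat.le_induction with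
  | base => rfl
  | succ M hM ih =>
    have : (N : ℝ) ≤ M := by exact_mod_cast hM
    rw [stepProd, step_of_nonpos S (by linarith), mul_one, ih]

theorem stepProd_eq_pow {N : ℕ} {t : ℝ} (ht : N ≤ t) : stepProd S N t = S ^ N := by
  induction N with
  | zero => simp [stepProd]
  | succ N ih =>
    push_cast at ht
    rw [stepProd, ih (by linarith), step_of_one_le S (by linarith), pow_succ]

/-- Later factors are multiplied on the right, hence their adjoints act last and can only decrease
the norm of `(stepProd S N t)* d`. -/
theorem IsFixedShift.exists_stepProd_eq_mul (hS : IsFixedShift δ S) {N M : ℕ} (h : N ≤ M) (t : ℝ) :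
    ∃ m : 𝓜(ℂ, D), ‖m‖ ≤ 1 ∧ stepProd S M t = stepProd S N t * m := by
  induction M, h using Nat.le_induction with
  | base => exact ⟨1, mult_norm_one_le, (mul_one _).symm⟩
  | succ M hM ih =>
    obtain ⟨m, hm, h⟩ := ih
    refine ⟨m * step S (t - M), ?_, by rw [stepProd, h, mul_assoc]⟩
    exact (norm_mul_le _ _).trans (mul_le_one₀ hm (norm_nonneg _)
      (norm_le_one_of_isometry (hS.star_step_mul_self _)))

/-- The infinite product of the translates of `step S`. -/
def stepLim (S : 𝓜(ℂ, D)) (t : ℝ) : 𝓜(ℂ, D) := stepProd S ⌈t⌉₊ t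

theorem stepLim_eq {N : ℕ} {t : ℝ} (ht : t ≤ N) : stepLim S t = stepProd S N t :=
  (stepProd_eq_of_le (Nat.ceil_le.2 ht) (Nat.le_ceil t)).symm

/-- Near any given time the infinite product agrees with one finite product. -/
theorem IsFixedShift.strictlyContinuous_stepLim (hS : IsFixedShift δ S) :
    StrictlyContinuous (stepLim S) := by
  have key : ∀ t : ℝ, ∃ N : ℕ, stepProd S N =ᶠ[𝓝 t] stepLim S := by
    intro t
    refine ⟨⌈t⌉₊ + 1, ?_⟩
    have h : t < (⌈t⌉₊ + 1 : ℕ) := by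
      push_cast
      linarith [Nat.le_ceil t]
    filter_upwards [Iio_mem_nhds h] with s hs
    exact (stepLim_eq (le_of_lt hs)).symm
  intro d
  constructor <;> refine continuous_iff_continuousAt.2 fun t => ?_
  · obtain ⟨N, hN⟩ := key t
    exact (hS.strictlyContinuous_stepProd N d).1.continuousAt.congr (hN.fun_comp fun m => m.fst d)
  · obtain ⟨N, hN⟩ := key t
    exact (hS.strictlyContinuous_stepProd N d).2.continuousAt.congr (hN.fun_comp fun m => m.snd d)

/-- After time `N` the first `N` steps are complete, so the path has the form `S ^ N * m` with `m` a
contraction. -/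
theorem IsFixedShift.norm_star_stepLim_le (hS : IsFixedShift δ S) {N : ℕ} {t : ℝ} (ht : N ≤ t)
    (d : D) : ‖(star (stepLim S t)).fst d‖ ≤ ‖(star S ^ N).fst d‖ := by
  have h : N ≤ ⌈t⌉₊ := by exact_mod_cast ht.trans (Nat.le_ceil t)
  obtain ⟨m, hm, he⟩ := hS.exists_stepProd_eq_mul h t
  rw [stepLim, he, stepProd_eq_pow ht, star_mul, star_pow, mult_fst_apply]
  exact (norm_fst_apply_le _ _).trans (mul_le_of_le_one_left (norm_nonneg _) (by rwa [norm_star]))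

/-- The path `s ↦ stepLim S (1 / s - 1)`, extended by `0` to `s = 0`. -/
def squeeze (S : 𝓜(ℂ, D)) (s : unitInterval) : 𝓜(ℂ, D) :=
  if s = 0 then 0 else stepLim S ((s : ℝ)⁻¹ - 1)

theorem IsFixedShift.continuousAt_squeeze (hS : IsFixedShift δ S) {s : unitInterval} (hs : s ≠ 0)
    (d : D) : ContinuousAt (fun s => (squeeze S s).fst d) s ∧
      ContinuousAt (fun s => (star (squeeze S s)).fst d) s := by
  have hs' : (s : ℝ) ≠ 0 := fun h => hs (Subtype.ext h)
  have e : (fun s : unitInterval => stepLim S ((s : ℝ)⁻¹ - 1)) =ᶠ[𝓝 s] squeeze S := by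
    filter_upwards [isOpen_ne.mem_nhds hs] with r hr
    exact (if_neg hr).symm
  have hc : ContinuousAt (fun s : unitInterval => (s : ℝ)⁻¹ - 1) s :=
    (continuous_subtype_val.continuousAt.inv₀ hs').sub continuousAt_const
  constructor
  · refine ContinuousAt.congr ?_ (e.fun_comp fun m => m.fst d)
    exact ContinuousAt.comp (g := fun t => (stepLim S t).fst d)
      (hS.strictlyContinuous_stepLim d).1.continuousAt hc
  · refine ContinuousAt.congr ?_ (e.fun_comp fun m => (star m).fst d)
    exact ContinuousAt.comp (g := fun t => (star (stepLim S t)).fst d)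
      (hS.strictlyContinuous_stepLim.star d).1.continuousAt hc

theorem IsFixedShift.isSqueeze (hS : IsFixedShift δ S) : IsSqueeze δ (squeeze S) where
  isometry s := by
    rw [squeeze]
    split_ifs
    · exact ⟨fun g => multAut_zero _, .inr rfl⟩
    · exact ⟨fun g => hS.multAut_stepProd g _ _, .inl (hS.star_stepProd_mul_self _ _)⟩
  continuous_star d := by
    refine continuous_iff_continuousAt.2 fun s => ?_
    by_cases hs : s = 0
    · subst hs
      rw [Metric.continuousAt_iff']
      intro ε hε
      obtain ⟨N, hN⟩ := ((Metric.tendsto_nhds.1 (hS.tendsto d)) ε hε).exists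
      rw [dist_zero_right] at hN
      -- For `s > 0`, the condition `s < 1 / (N + 1)` says exactly that the time `1 / s - 1` exceeds
      -- `N`.
      have hpos : (0 : ℝ) < ((N : ℝ) + 1)⁻¹ := by positivity
      have hev : ∀ᶠ s : unitInterval in 𝓝 0, (s : ℝ) < ((N : ℝ) + 1)⁻¹ :=
        continuous_subtype_val.continuousAt.eventually_lt continuousAt_const (by simpa using hpos)
      filter_upwards [hev] with s hs
      have h0 : squeeze S 0 = 0 := if_pos rfl
      rw [h0, star_zero, DoubleCentralizer.zero_fst, zero_apply, dist_zero_right]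
      by_cases h : s = 0
      · rw [h, h0, star_zero, DoubleCentralizer.zero_fst, zero_apply, norm_zero]
        exact hε
      · rw [squeeze, if_neg h]
        refine (hS.norm_star_stepLim_le ?_ d).trans_lt hN
        have hs0 : 0 < (s : ℝ) := lt_of_le_of_ne s.2.1 fun e => h (Subtype.ext e.symm)
        have := (lt_inv_comm₀ hs0 (by positivity)).1 hs
        linarith
    · exact (hS.continuousAt_squeeze hs d).2
  continuousAt s := by
    by_cases hs : s = 0
    · exact .inl (if_pos hs)
    · exact .inr fun d => (hS.continuousAt_squeeze hs d).1

/-- At `s = 1` the squeeze is at time `0`, where the product is empty; the path from `t₁` to `1` is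
a single Cayley step run backwards. -/
theorem IsFixedShift.isAbsorbing {T : CuntzIsometries δ} (hT : IsFixedShift δ T.t₁) :
    IsAbsorbing δ where
  exists_squeeze := ⟨squeeze T.t₁, hT.isSqueeze, if_pos rfl, by
    rw [squeeze, if_neg one_ne_zero, stepLim_eq (N := 0) (by simp)]; rfl⟩
  exists_path := ⟨T, _, hT.isIsometryPath, step_of_one_le _ (by simp),
    step_of_nonpos _ (by simp)⟩

end Step

/-! ### Isometries on `ℓ²(ℕ)` -/

section EllTwo

open Filter Topology

theorem summable_norm_sq (y : EllTwo) : Summable fun n => ‖y n‖ ^ 2 := by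
  simpa using (memℓp_gen_iff (p := 2) (by simp)).1 (lp.memℓp y)

theorem ellTwo_norm_sq (y : EllTwo) : ‖y‖ ^ 2 = ∑' n, ‖y n‖ ^ 2 := by
  simpa using lp.norm_rpow_eq_tsum (p := 2) (by simp) y

/-- The contraction `y ↦ y ∘ f` for an injective map `f` of `ℕ`. -/
def pull (f : ℕ → ℕ) (hf : Function.Injective f) : EllTwo →L[ℂ] EllTwo :=
  LinearMap.mkContinuous
    { toFun := fun y => (⟨fun n => y (f n), (memℓp_gen_iff (p := 2) (by simp)).2 (by
        simpa [Function.comp_def] using (summable_norm_sq y).comp_injective hf)⟩ : EllTwo)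
      map_add' := fun x y => rfl
      map_smul' := fun c y => rfl } 1 (fun y => by
    rw [one_mul]
    refine le_of_sq_le_sq ?_ (norm_nonneg _)
    rw [ellTwo_norm_sq, ellTwo_norm_sq]
    exact tsum_comp_le_tsum_of_inj (summable_norm_sq y) (fun _ => sq_nonneg _) hf)

variable {f g : ℕ → ℕ} (hf : Function.Injective f) (hg : Function.Injective g)

theorem pull_apply (y : EllTwo) (n : ℕ) : pull f hf y n = y (f n) := rfl

/-- Tested on basis vectors: `pull f` sends the basis vector at `f n` to the one at `n`. -/
theorem pull_mul_star : pull f hf * star (pull f hf) = 1 := by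
  ext x n
  have h1 : pull f hf (lp.single 2 (f n) (1 : ℂ)) = lp.single 2 n (1 : ℂ) := by
    ext m
    rw [pull_apply]
    by_cases h : m = n
    · subst h; simp
    · rw [lp.single_apply_ne _ _ _ h, lp.single_apply_ne _ _ _ (fun e => h (hf e))]
  have h2 := lp.inner_single_left (𝕜 := ℂ) (G := fun _ : ℕ => ℂ) (f n) 1 (star (pull f hf) x)
  rw [ContinuousLinearMap.star_eq_adjoint, ContinuousLinearMap.adjoint_inner_right, h1,
    lp.inner_single_left] at h2
  change (star (pull f hf) x) (f n) = x n
  simpa [ContinuousLinearMap.star_eq_adjoint] using h2.symm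

/-- An inner product over `ℕ` splits into its sums over even and odd indices. -/
theorem star_pull_mul_add (h : ∀ n, f n = 2 * n) (h' : ∀ n, g n = 2 * n + 1) :
    star (pull g hg) * pull g hg + star (pull f hf) * pull f hf = 1 := by
  refine ContinuousLinearMap.ext fun x => ext_inner_left ℂ fun y => ?_
  change inner ℂ y (star (pull g hg) (pull g hg x) + star (pull f hf) (pull f hf x)) = inner ℂ y x
  rw [inner_add_right, ContinuousLinearMap.star_eq_adjoint, ContinuousLinearMap.star_eq_adjoint,
    ContinuousLinearMap.adjoint_inner_right, ContinuousLinearMap.adjoint_inner_right, add_comm]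
  have h1 := lp.hasSum_inner (𝕜 := ℂ) (pull f hf y) (pull f hf x)
  have h2 := lp.hasSum_inner (𝕜 := ℂ) (pull g hg y) (pull g hg x)
  simp only [pull_apply, h, h'] at h1 h2
  exact (HasSum.even_add_odd (f := fun n => inner ℂ (y n) (x n)) h1 h2).unique (lp.hasSum_inner y x)

theorem pull_pow_apply (k : ℕ) (y : EllTwo) (n : ℕ) : (pull f hf ^ k) y n = y (f^[k] n) := by
  induction k generalizing n with
  | zero => rfl
  | succ k ih =>
    rw [pow_succ', Function.iterate_succ_apply, ← ih]
    rfl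

/-- Since `f` is strictly above the identity, the `k`-th iterate lands in `[k, ∞)`, so the norm is
controlled by a tail of a convergent series. -/
theorem tendsto_pull_pow (hlt : ∀ n, n < f n) (y : EllTwo) :
    Tendsto (fun k : ℕ => (pull f hf ^ k) y) atTop (𝓝 0) := by
  rw [tendsto_zero_iff_norm_tendsto_zero]
  have h1 := (tendsto_sum_nat_add fun n => ‖y n‖ ^ 2).sqrt
  rw [Real.sqrt_zero] at h1
  refine squeeze_zero (fun _ => norm_nonneg _) (fun k => Real.le_sqrt_of_sq_le ?_) h1
  rw [ellTwo_norm_sq]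
  simp only [pull_pow_apply]
  have hle : ∀ n, k ≤ f^[k] n := by
    intro n
    induction k with
    | zero => exact Nat.zero_le _
    | succ k ih => rw [Function.iterate_succ_apply']; exact (ih.trans_lt (hlt _))
  -- Shifting by `k` embeds the indices hit by the iterate into those of the tail starting at `k`.
  have hinj : Function.Injective fun n => f^[k] n - k := by
    intro a b hab
    have h1 := hle a
    have h2 := hle b
    exact hf.iterate k (by simp only at hab; omega)
  have h2 : Summable fun n => ‖y (n + k)‖ ^ 2 :=
    (summable_norm_sq y).comp_injective (add_left_injective k)
  refine le_of_eq_of_le ?_ (tsum_comp_le_tsum_of_inj h2 (fun _ => sq_nonneg _) hinj)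
  refine tsum_congr fun n => ?_
  simp only [Function.comp_apply, Nat.sub_add_cancel (hle n)]

/-- Strong convergence of contractions is uniform on totally bounded sets, in particular on the
image of a ball under `c`. -/
theorem tendsto_norm_pow_mul_of_isCompactOperator {p c : EllTwo →L[ℂ] EllTwo} (hp : ‖p‖ ≤ 1)
    (hlim : ∀ y, Tendsto (fun k : ℕ => (p ^ k) y) atTop (𝓝 0)) (hc : IsCompactOperator c) :
    Tendsto (fun k : ℕ => ‖p ^ k * c‖) atTop (𝓝 0) := by
  have hpk : ∀ k : ℕ, ‖p ^ k‖ ≤ 1 := fun k => by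
    induction k with
    | zero => exact ContinuousLinearMap.norm_id_le
    | succ k ih =>
      rw [pow_succ]
      exact (norm_mul_le _ _).trans (mul_le_one₀ ih (norm_nonneg _) hp)
  -- Radius `2` makes the open ball contain the unit sphere, on which the operator norm is tested.
  have hK := hc.isCompact_closure_image_ball (𝕜₁ := ℂ) (f := c.toLinearMap) 2
  have hTB : TotallyBounded (c '' Metric.ball 0 2) := hK.totallyBounded.subset subset_closure
  rw [Metric.tendsto_nhds]
  intro ε hε
  obtain ⟨t, htfin, hcov⟩ := Metric.totallyBounded_iff.1 hTB (ε / 3) (by positivity)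
  have hev : ∀ᶠ k : ℕ in atTop, ∀ y ∈ t, ‖(p ^ k) y‖ < ε / 3 := by
    refine htfin.eventually_all.2 fun y _ => ?_
    have := Metric.tendsto_nhds.1 (hlim y) (ε / 3) (by positivity)
    simpa only [dist_zero_right] using this
  filter_upwards [hev] with k hk
  rw [dist_zero_right, norm_norm]
  have : ‖p ^ k * c‖ ≤ 2 * (ε / 3) := by
    refine ContinuousLinearMap.opNorm_le_of_unit_norm (by positivity) fun x hx => ?_
    have hx' := hcov ⟨x, by simp [hx], rfl⟩
    simp only [Set.mem_iUnion, Metric.mem_ball, exists_prop] at hx'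
    obtain ⟨y, hy, hxy⟩ := hx'
    rw [dist_eq_norm] at hxy
    have e : (p ^ k * c) x = (p ^ k) (c x - y) + (p ^ k) y := by
      rw [map_sub, sub_add_cancel]; rfl
    rw [e]
    refine (norm_add_le _ _).trans ?_
    have h1 := ((p ^ k).le_opNorm (c x - y)).trans
      (mul_le_of_le_one_left (norm_nonneg _) (hpk k))
    linarith [hk y hy]
  linarith

end EllTwo

/-! ### The multipliers `1 ⊗ s` -/

section OneTensor

open Filter Topology

variable {B : Type v} [NonUnitalCStarAlgebra B]

/-- Left multiplication by `s` on the compact operators. -/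
def compactsMulLeft (s : EllTwo →L[ℂ] EllTwo) : Compacts →ₗ[ℂ] Compacts where
  toFun c := ⟨s * c.1, IsCompactOperator.clm_comp c.2 s⟩
  map_add' c d := Subtype.ext (mul_add s c.1 d.1)
  map_smul' a c := Subtype.ext (mul_smul_comm a s c.1)

/-- Right multiplication by `s` on the compact operators. -/
def compactsMulRight (s : EllTwo →L[ℂ] EllTwo) : Compacts →ₗ[ℂ] Compacts where
  toFun c := ⟨c.1 * s, IsCompactOperator.comp_clm c.2 s⟩
  map_add' c d := Subtype.ext (add_mul c.1 d.1 s)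
  map_smul' a c := Subtype.ext (smul_mul_assoc a c.1 s)

/-! ### Multiplication by `1 ⊗ s` on the algebraic tensor product. -/

namespace AlgTensor

/-- Left multiplication by `1 ⊗ s` on `B ⊙ 𝓚`. -/
def mulLeft (s : EllTwo →L[ℂ] EllTwo) : AlgTensor B Compacts →ₗ[ℂ] AlgTensor B Compacts :=
  TensorProduct.map LinearMap.id (compactsMulLeft s)

/-- Right multiplication by `1 ⊗ s` on `B ⊙ 𝓚`. -/
def mulRight (s : EllTwo →L[ℂ] EllTwo) : AlgTensor B Compacts →ₗ[ℂ] AlgTensor B Compacts :=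
  TensorProduct.map LinearMap.id (compactsMulRight s)

theorem mulLeft_tmul (s : EllTwo →L[ℂ] EllTwo) (b : B) (c : Compacts) :
    mulLeft s (tmul b c) = tmul b (compactsMulLeft s c) := rfl

theorem mulRight_tmul (s : EllTwo →L[ℂ] EllTwo) (b : B) (c : Compacts) :
    mulRight s (tmul b c) = tmul b (compactsMulRight s c) := rfl

theorem tmul_add (b : B) (c d : Compacts) : tmul b (c + d) = tmul b c + tmul b d :=
  TensorProduct.tmul_add b c d

theorem tmul_smul (a : ℂ) (b : B) (c : Compacts) : tmul b (a • c) = a • tmul b c :=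
  TensorProduct.tmul_smul a b c

variable (s s' : EllTwo →L[ℂ] EllTwo) (x y : AlgTensor B Compacts)

theorem mulLeft_mulLeft : mulLeft s (mulLeft s' x) = mulLeft (s * s') x := by
  induction x using induction with
  | h0 => simp
  | ha x y hx hy => simp only [map_add, hx, hy]
  | ht b c =>
    simp only [mulLeft_tmul]
    exact congr_arg (tmul b) (Subtype.ext (mul_assoc s s' c.1).symm)

theorem mulLeft_one : mulLeft 1 x = x := by
  induction x using induction with
  | h0 => simp
  | ha x y hx hy => simp only [map_add, hx, hy]
  | ht b c =>
    rw [mulLeft_tmul]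
    exact congr_arg (tmul b) (Subtype.ext (one_mul c.1))

theorem mulLeft_add : mulLeft (s + s') x = mulLeft s x + mulLeft s' x := by
  induction x using induction with
  | h0 => simp
  | ha x y hx hy => simp only [map_add, hx, hy]; abel
  | ht b c =>
    rw [mulLeft_tmul, mulLeft_tmul, mulLeft_tmul, ← tmul_add]
    exact congr_arg (tmul b) (Subtype.ext (add_mul s s' c.1))

theorem mulLeft_smul (a : ℂ) : mulLeft (a • s) x = a • mulLeft s x := by
  induction x using induction with
  | h0 => simp
  | ha x y hx hy => simp only [map_add, hx, hy, smul_add]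
  | ht b c =>
    rw [mulLeft_tmul, mulLeft_tmul, ← tmul_smul]
    exact congr_arg (tmul b) (Subtype.ext (smul_mul_assoc a s c.1))

theorem star_mulLeft : star (mulLeft s x) = mulRight (star s) (star x) := by
  induction x using induction with
  | h0 => simp
  | ha x y hx hy => simp only [map_add, star_add, hx, hy]
  | ht b c =>
    rw [mulLeft_tmul, star_tmul, star_tmul, mulRight_tmul]
    exact congr_arg (tmul _) (Subtype.ext (star_mul s c.1))

theorem mulRight_mul : mulRight s x * y = x * mulLeft s y := by
  induction x using induction with
  | h0 => simp
  | ha x x' hx hx' => rw [map_add, add_mul, hx, hx', add_mul]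
  | ht b c =>
    induction y using induction with
    | h0 => simp
    | ha y y' hy hy' => rw [map_add, mul_add, hy, hy', mul_add]
    | ht b' c' =>
      rw [mulRight_tmul, mulLeft_tmul, tmul_mul_tmul, tmul_mul_tmul]
      exact congr_arg (tmul _) (Subtype.ext (mul_assoc c.1 s c'.1))

theorem star_mulLeft_mul : star (mulLeft s x) * mulLeft s y
    = star x * mulLeft (star s * s) y := by
  rw [star_mulLeft, mulRight_mul, mulLeft_mulLeft]

theorem mapLeft_mulLeft (σ : B →⋆ₙₐ[ℂ] B) : mapLeft σ (mulLeft s x) = mulLeft s (mapLeft σ x) := by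
  induction x using induction with
  | h0 => simp
  | ha x y hx hy => simp only [map_add, hx, hy]
  | ht b c => simp only [mulLeft_tmul, mapLeft_tmul]

variable {s}

/-- `‖s x‖² ≤ ‖x* s* s x‖ = ‖x* x‖ ≤ ‖x‖²`, using only the C⋆-inequality of the maximal norm. -/
theorem norm_mulLeft_le_of_isometry (h : star s * s = 1) : ‖mulLeft s x‖ ≤ ‖x‖ := by
  have h1 := norm_sq_le (mulLeft s x)
  rw [star_mulLeft_mul, h, mulLeft_one] at h1
  have h2 := norm_mul_le (star x) x
  rw [norm_star] at h2
  exact (mul_self_le_mul_self_iff (norm_nonneg _) (norm_nonneg _)).2 (h1.trans h2)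

/-- Here `s s*` is only a projection `q`. As `2q - 1` is a unitary, the isometry case shows that `q
= ((2q - 1) + 1) / 2` is contractive, and then `‖s* x‖² ≤ ‖x* (q x)‖ ≤ ‖x‖²`. -/
theorem norm_mulLeft_star_le_of_isometry (h : star s * s = 1) : ‖mulLeft (star s) x‖ ≤ ‖x‖ := by
  set q := s * star s with hq
  have hqq : q * q = q := by
    rw [hq, mul_assoc, ← mul_assoc (star s), h, one_mul]
  have hqs : star q = q := by rw [hq, star_mul, star_star]
  have hu : star ((2 : ℂ) • q + (-1 : ℂ) • 1) * ((2 : ℂ) • q + (-1 : ℂ) • 1) = 1 := by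
    rw [star_add, star_smul, star_smul, hqs, star_one]
    simp only [add_mul, mul_add, smul_mul_smul_comm, hqq, one_mul, mul_one, star_neg, star_one]
    rw [show star (2 : ℂ) = 2 by simp]
    module
  have h1 := norm_mulLeft_le_of_isometry x hu
  have h2 : mulLeft q x = (2⁻¹ : ℂ) • (mulLeft ((2 : ℂ) • q + (-1 : ℂ) • 1) x + x) := by
    rw [mulLeft_add, mulLeft_smul, mulLeft_smul, mulLeft_one]
    module
  have h3 : ‖mulLeft q x‖ ≤ ‖x‖ := by
    have h4 := norm_add_le (mulLeft ((2 : ℂ) • q + (-1 : ℂ) • 1) x) x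
    have h5 : ‖(2⁻¹ : ℂ)‖ = 2⁻¹ := by simp
    rw [h2, norm_smul, h5]
    linarith
  have h4 := norm_sq_le (mulLeft (star s) x)
  rw [star_mulLeft_mul, star_star, ← hq] at h4
  have h5 := norm_mul_le (star x) (mulLeft q x)
  rw [norm_star] at h5
  have h6 := mul_le_mul_of_nonneg_left h3 (norm_nonneg x)
  exact (mul_self_le_mul_self_iff (norm_nonneg _) (norm_nonneg _)).2 ((h4.trans h5).trans h6)

theorem norm_mulRight_le (h : ∀ x : AlgTensor B Compacts, ‖mulLeft (star s) x‖ ≤ ‖x‖) :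
    ‖mulRight s x‖ ≤ ‖x‖ := by
  have e := star_mulLeft (star s) (star x)
  rw [star_star, star_star] at e
  rw [← e, norm_star, ← norm_star x]
  exact h _

end AlgTensor

/-! ### Extension to the multipliers `1 ⊗ s` of the completed tensor product. -/

namespace CStarTensor

/-- The continuous extension of a contraction of `B ⊙ 𝓚` to `B ⊗ 𝓚`. -/
def extendContraction (f : AlgTensor B Compacts →ₗ[ℂ] AlgTensor B Compacts)
    (hf : ∀ x, ‖f x‖ ≤ ‖x‖) : Stab B →L[ℂ] Stab B :=
  (ofAlg.comp (f.mkContinuous 1 fun x => by rw [one_mul]; exact hf x)).extend ofAlg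

theorem isUniformInducing_ofAlg :
    IsUniformInducing (ofAlg : AlgTensor B Compacts →L[ℂ] CStarTensor B Compacts) :=
  UniformSpace.Completion.isUniformInducing_coe _

theorem extendContraction_ofAlg (f : AlgTensor B Compacts →ₗ[ℂ] AlgTensor B Compacts)
    (hf : ∀ x, ‖f x‖ ≤ ‖x‖) (x : AlgTensor B Compacts) :
    extendContraction f hf (ofAlg x) = ofAlg (f x) :=
  ContinuousLinearMap.extend_eq _ denseRange_ofAlg isUniformInducing_ofAlg x

end CStarTensor

open CStarTensor

variable (B) in
/-- The operator `s` acts contractively on `B ⊙ 𝓚`, as does its adjoint. -/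
structure IsTensorContraction (s : EllTwo →L[ℂ] EllTwo) : Prop where
  norm_le : ∀ x : AlgTensor B Compacts, ‖AlgTensor.mulLeft s x‖ ≤ ‖x‖
  norm_star_le : ∀ x : AlgTensor B Compacts, ‖AlgTensor.mulLeft (star s) x‖ ≤ ‖x‖

theorem IsTensorContraction.of_isometry {s : EllTwo →L[ℂ] EllTwo} (h : star s * s = 1) :
    IsTensorContraction B s :=
  ⟨fun x => AlgTensor.norm_mulLeft_le_of_isometry x h,
    fun x => AlgTensor.norm_mulLeft_star_le_of_isometry x h⟩

variable {s : EllTwo →L[ℂ] EllTwo}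

theorem IsTensorContraction.star (hs : IsTensorContraction B s) :
    IsTensorContraction B (star s) :=
  ⟨hs.norm_star_le, by rw [star_star]; exact hs.norm_le⟩

/-- The multiplier `1 ⊗ s` of `B ⊗ 𝓚`. -/
def oneTensor (hs : IsTensorContraction B s) : 𝓜(ℂ, Stab B) where
  fst := extendContraction (AlgTensor.mulLeft s) hs.norm_le
  snd := extendContraction (AlgTensor.mulRight s) fun x =>
    AlgTensor.norm_mulRight_le x hs.norm_star_le
  central := induction₂ (isClosed_eq (by fun_prop) (by fun_prop)) fun x y => by
    rw [extendContraction_ofAlg, extendContraction_ofAlg, ← ofAlg_mul, ← ofAlg_mul,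
      AlgTensor.mulRight_mul]

theorem oneTensor_fst (hs : IsTensorContraction B s) (x : AlgTensor B Compacts) :
    (oneTensor hs).fst (ofAlg x) = ofAlg (AlgTensor.mulLeft s x) :=
  extendContraction_ofAlg _ hs.norm_le x

theorem oneTensor_snd (hs : IsTensorContraction B s) (x : AlgTensor B Compacts) :
    (oneTensor hs).snd (ofAlg x) = ofAlg (AlgTensor.mulRight s x) :=
  extendContraction_ofAlg _ (fun x => AlgTensor.norm_mulRight_le x hs.norm_star_le) x

theorem mult_stab_ext {m n : 𝓜(ℂ, Stab B)} (h : ∀ x, m.fst (ofAlg x) = n.fst (ofAlg x)) : m = n :=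
  mult_ext_fst (CStarTensor.induction (isClosed_eq m.fst.continuous n.fst.continuous) h)

theorem star_oneTensor (hs : IsTensorContraction B s) : star (oneTensor hs) = oneTensor hs.star :=
  mult_stab_ext fun x => by
    have e := AlgTensor.star_mulLeft (star s) x
    rw [star_star] at e
    rw [DoubleCentralizer.star_fst, ← ofAlg_star, oneTensor_snd, ← e, ofAlg_star, star_star,
      oneTensor_fst]

variable {G : Type u} [Group G] [TopologicalSpace G]

/-- `β ⊗ id` acts on the first tensor factor and `1 ⊗ s` on the second, so they commute. -/
theorem multAut_oneTensor (β : CStarAction G B) (hs : IsTensorContraction B s) (g : G) :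
    multAut (β.stab.aut g) (oneTensor hs) = oneTensor hs := by
  have key : ∀ d, β.stab.aut g ((oneTensor hs).fst d) = (oneTensor hs).fst (β.stab.aut g d) := by
    refine CStarTensor.induction (isClosed_eq ?_ ?_) fun x => ?_
    · exact (isometry_aut (β.stab.aut g)).continuous.comp (oneTensor hs).fst.continuous
    · exact (oneTensor hs).fst.continuous.comp (isometry_aut (β.stab.aut g)).continuous
    · have e : ∀ y : AlgTensor B Compacts, β.stab.aut g (ofAlg y)
          = ofAlg (AlgTensor.mapLeft (β.aut g : B →⋆ₙₐ[ℂ] B) y) := fun y =>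
        CStarTensor.mapLeft_ofAlg (β.aut g : B →⋆ₙₐ[ℂ] B) y
      rw [oneTensor_fst, e, e, oneTensor_fst, AlgTensor.mapLeft_mulLeft]
  refine mult_ext_fst fun d => ?_
  rw [multAut_fst, key, StarAlgEquiv.apply_symm_apply]

theorem star_oneTensor_mul (h : star s * s = 1) (hs : IsTensorContraction B s) :
    star (oneTensor hs) * oneTensor hs = 1 :=
  mult_stab_ext fun x => by
    rw [star_oneTensor, mult_fst_apply, oneTensor_fst, oneTensor_fst, AlgTensor.mulLeft_mulLeft, h,
      AlgTensor.mulLeft_one]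
    rfl

theorem oneTensor_mul_star_add {s' : EllTwo →L[ℂ] EllTwo} (h : s * star s + s' * star s' = 1)
    (hs : IsTensorContraction B s) (hs' : IsTensorContraction B s') :
    oneTensor hs * star (oneTensor hs) + oneTensor hs' * star (oneTensor hs') = 1 :=
  mult_stab_ext fun x => by
    rw [star_oneTensor, star_oneTensor, DoubleCentralizer.add_fst, add_apply, mult_fst_apply,
      mult_fst_apply, oneTensor_fst, oneTensor_fst, oneTensor_fst, oneTensor_fst,
      AlgTensor.mulLeft_mulLeft, AlgTensor.mulLeft_mulLeft, ← map_add, ← AlgTensor.mulLeft_add, h,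
      AlgTensor.mulLeft_one]
    rfl

theorem oneTensor_pow_fst (hs : IsTensorContraction B s) (n : ℕ) (x : AlgTensor B Compacts) :
    (oneTensor hs ^ n).fst (ofAlg x) = ofAlg (AlgTensor.mulLeft (s ^ n) x) := by
  induction n generalizing x with
  | zero => rw [pow_zero, pow_zero, AlgTensor.mulLeft_one]; rfl
  | succ n ih => rw [pow_succ, mult_fst_apply, oneTensor_fst, ih, AlgTensor.mulLeft_mulLeft,
      pow_succ]

/-- The powers are contractions, so the vectors on which they tend to `0` form a closed subspace; on
an elementary tensor the claim is the statement about compact operators. -/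
theorem tendsto_oneTensor_pow (hs : IsTensorContraction B s) (hs1 : ‖s‖ ≤ 1)
    (hlim : ∀ y, Tendsto (fun k : ℕ => (s ^ k) y) atTop (𝓝 0)) (d : Stab B) :
    Tendsto (fun n : ℕ => (oneTensor hs ^ n).fst d) atTop (𝓝 0) := by
  have hle : ∀ c, ‖(oneTensor hs).fst c‖ ≤ ‖c‖ :=
    CStarTensor.induction (isClosed_le (by fun_prop) (by fun_prop)) fun x => by
      rw [oneTensor_fst, norm_ofAlg, norm_ofAlg]; exact hs.norm_le x
  have hle' : ∀ (n : ℕ) c, ‖(oneTensor hs ^ n).fst c‖ ≤ ‖c‖ := by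
    intro n c
    induction n generalizing c with
    | zero => rw [pow_zero]; exact le_rfl
    | succ n ih => rw [pow_succ, mult_fst_apply]; exact (ih _).trans (hle c)
  induction d using CStarTensor.tmul_induction with
  | hp =>
    refine isClosed_of_closure_subset fun x hx => ?_
    rw [Metric.mem_closure_iff] at hx
    rw [Set.mem_ofPred_eq, Metric.tendsto_nhds]
    intro ε hε
    obtain ⟨y, hy, hxy⟩ := hx (ε / 2) (by positivity)
    filter_upwards [Metric.tendsto_nhds.1 hy (ε / 2) (by positivity)] with n hn
    rw [dist_zero_right] at hn ⊢
    rw [dist_eq_norm] at hxy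
    have e : (oneTensor hs ^ n).fst x
        = (oneTensor hs ^ n).fst (x - y) + (oneTensor hs ^ n).fst y := by
      rw [map_sub, sub_add_cancel]
    rw [e]
    refine (norm_add_le _ _).trans_lt ?_
    linarith [hle' n (x - y)]
  | ht b c =>
    rw [tendsto_zero_iff_norm_tendsto_zero]
    have h1 := (tendsto_norm_pow_mul_of_isCompactOperator hs1 hlim c.2).const_mul ‖b‖
    rw [mul_zero] at h1
    refine squeeze_zero (fun _ => norm_nonneg _) (fun n => ?_) h1
    rw [CStarTensor.tmul, oneTensor_pow_fst, norm_ofAlg, AlgTensor.mulLeft_tmul]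
    exact AlgTensor.norm_tmul_le _ _
  | h0 => simp
  | ha x y hx hy => simpa using hx.add hy

theorem exists_cuntzIsometries (β : CStarAction G B) :
    ∃ T : CuntzIsometries β.stab, IsFixedShift β.stab T.t₁ := by
  -- The odd map must supply `t₁`: it satisfies `n < 2n + 1`, whereas `n ↦ 2n` fixes `0` and the
  -- powers of its pullback preserve the first coordinate.
  have hg : Function.Injective fun n : ℕ => 2 * n + 1 := fun a b h => by simpa using h
  have hf : Function.Injective fun n : ℕ => 2 * n := fun a b h => by simpa using h
  have h1 : star (star (pull _ hg)) * star (pull _ hg) = 1 := by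
    rw [star_star, pull_mul_star]
  have h2 : star (star (pull _ hf)) * star (pull _ hf) = 1 := by
    rw [star_star, pull_mul_star]
  have hs1 : IsTensorContraction B (star (pull _ hg)) := .of_isometry h1
  have hs2 : IsTensorContraction B (star (pull _ hf)) := .of_isometry h2
  let T : CuntzIsometries β.stab :=
    { t₁ := oneTensor hs1
      t₂ := oneTensor hs2
      fixed₁ := multAut_oneTensor β hs1
      fixed₂ := multAut_oneTensor β hs2
      isometry₁ := star_oneTensor_mul h1 hs1
      isometry₂ := star_oneTensor_mul h2 hs2
      sum_range := oneTensor_mul_star_add (by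
        rw [star_star, star_star]
        exact star_pull_mul_add hf hg (fun _ => rfl) fun _ => rfl) hs1 hs2 }
  refine ⟨T, T.fixed₁, T.isometry₁, fun d => ?_⟩
  change Tendsto (fun n : ℕ => (star (oneTensor hs1) ^ n).fst d) atTop (𝓝 0)
  rw [star_oneTensor]
  refine tendsto_oneTensor_pow hs1.star ?_ ?_ d
  · rw [star_star]
    exact LinearMap.mkContinuous_norm_le _ zero_le_one _
  · rw [star_star]
    exact tendsto_pull_pow hg fun n => by omega

theorem isAbsorbing_stab (β : CStarAction G B) : IsAbsorbing β.stab :=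
  have ⟨_, hT⟩ := exists_cuntzIsometries β
  hT.isAbsorbing

end OneTensor

/-! ### The groups of homotopy classes -/

section Groups

variable {G : Type u} [Group G] [TopologicalSpace G]
variable {A : Type v} [NonUnitalCStarAlgebra A] {D : Type w} [NonUnitalCStarAlgebra D]
variable {α : CStarAction G A} {δ : CStarAction G D}

theorem PairIn.cuntzSum_trivial_trivial (T : CuntzIsometries δ) :
    (PairIn.trivial α δ).cuntzSum T (.trivial α δ) = .trivial α δ :=
  have h : (CocycleRep.trivial α δ).cuntzSum T (.trivial α δ) = .trivial α δ :=
    CocycleRep.eq_of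
      (fun a => by simp [CocycleRep.cuntzSum_hom, CocycleRep.trivial, CuntzIsometries.sum])
      fun _ => T.sum_one
  PairIn.eq_of h h

theorem PairIn.cocyclePart_cuntzSum (T : CuntzIsometries δ) (x y : PairIn α δ) :
    (x.cuntzSum T y).cocyclePart = x.cocyclePart.cuntzSum T y.cocyclePart :=
  have h : ∀ r s : CocycleRep α δ,
      (r.cuntzSum T s).cocyclePart = r.cocyclePart.cuntzSum T s.cocyclePart := fun r s =>
    CocycleRep.eq_of
      (fun a => by simp [CocycleRep.cuntzSum_hom, CocycleRep.cocyclePart, CuntzIsometries.sum])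
      fun _ => rfl
  PairIn.eq_of (h _ _) (h _ _)

/-- Passing to cocycle parts commutes with Cuntz sums, and the sum of two trivial pairs is exactly
trivial. -/
theorem PairIn.IsAnchored.cuntzSum (T : CuntzIsometries δ) {x y : PairIn α δ} (hx : x.IsAnchored)
    (hy : y.IsAnchored) : (x.cuntzSum T y).IsAnchored := by
  have h := PairIn.Homotopic.cuntzSum T hx hy
  rwa [PairIn.cuntzSum_trivial_trivial, ← PairIn.cocyclePart_cuntzSum] at h

theorem PairIn.isCocyclePair_cocyclePart (x : PairIn α δ) : x.cocyclePart.IsCocyclePair :=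
  ⟨rfl, rfl⟩

theorem PairIn.IsCocyclePair.cocyclePart_eq {x : PairIn α δ} (hx : x.IsCocyclePair) :
    x.cocyclePart = x :=
  PairIn.eq_of (CocycleRep.eq_of (fun _ => by rw [hx.1]; rfl) fun _ => rfl)
    (CocycleRep.eq_of (fun _ => by rw [hx.2]; rfl) fun _ => rfl)

theorem PairIn.isCocyclePair_trivial : (PairIn.trivial α δ).IsCocyclePair := ⟨rfl, rfl⟩

theorem homotopic_iff_mk_eq {x y : PairIn α δ} :
    x.Homotopic y ↔ Quot.mk PairIn.Homotopic x = Quot.mk PairIn.Homotopic y :=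
  (equivalence_homotopic.quot_mk_eq_iff _ _).symm

/-- The group of homotopy classes, with addition given by the Cuntz sum. -/
@[reducible]
def homotopyGroup (hδ : IsAbsorbing δ) (T : CuntzIsometries δ) :
    AddCommGroup (Quot (PairIn.Homotopic : PairIn α δ → PairIn α δ → Prop)) :=
  letI : Add (Quot (PairIn.Homotopic : PairIn α δ → PairIn α δ → Prop)) :=
    ⟨Quot.map₂ (fun x y => x.cuntzSum T y) (fun _ _ _ h => .cuntzSum T (.refl _) h)
      fun _ _ _ h => .cuntzSum T h (.refl _)⟩
  letI : Neg (Quot (PairIn.Homotopic : PairIn α δ → PairIn α δ → Prop)) :=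
    ⟨Quot.map PairIn.swap fun _ _ h => h.swap⟩
  letI : Zero (Quot (PairIn.Homotopic : PairIn α δ → PairIn α δ → Prop)) :=
    ⟨Quot.mk _ (.trivial α δ)⟩
  { AddGroup.ofLeftAxioms (G := Quot (PairIn.Homotopic : PairIn α δ → PairIn α δ → Prop))
      (by
        rintro ⟨x⟩ ⟨y⟩ ⟨z⟩
        exact (Quot.sound (PairIn.cuntzSum_assoc hδ T x y z)).symm)
      (by
        rintro ⟨x⟩
        exact Quot.sound ((PairIn.cuntzSum_comm hδ T _ _).trans (PairIn.cuntzSum_trivial hδ T x)))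
      (by
        rintro ⟨x⟩
        exact Quot.sound ((PairIn.cuntzSum_comm hδ T _ _).trans (PairIn.cuntzSum_swap hδ T x))) with
    add_comm := by
      rintro ⟨x⟩ ⟨y⟩
      exact Quot.sound (PairIn.cuntzSum_comm hδ T x y) }

/-- The group structure is built from one fixed `T`, but any other `S` computes the same addition.
-/
theorem homotopyGroup_mk_add (hδ : IsAbsorbing δ) (T S : CuntzIsometries δ) (x y : PairIn α δ) :
    letI := homotopyGroup (α := α) hδ T
    Quot.mk PairIn.Homotopic x + Quot.mk PairIn.Homotopic y
      = Quot.mk PairIn.Homotopic (x.cuntzSum S y) :=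
  Quot.sound (PairIn.cuntzSum_homotopic_cuntzSum hδ T S x y)

theorem homotopyGroup_zero (hδ : IsAbsorbing δ) (T : CuntzIsometries δ) :
    letI := homotopyGroup (α := α) hδ T
    (0 : Quot (PairIn.Homotopic : PairIn α δ → PairIn α δ → Prop))
      = Quot.mk PairIn.Homotopic (.trivial α δ) := rfl

/-- The endomorphism `[x] ↦ [x.cocyclePart]` of the group of homotopy classes. -/
def cocycleProj (hδ : IsAbsorbing δ) (T : CuntzIsometries δ) :
    letI := homotopyGroup (α := α) hδ T
    Quot (PairIn.Homotopic : PairIn α δ → PairIn α δ → Prop) →+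
      Quot (PairIn.Homotopic : PairIn α δ → PairIn α δ → Prop) :=
  letI := homotopyGroup (α := α) hδ T
  AddMonoidHom.mk' (Quot.map PairIn.cocyclePart fun _ _ h => h.cocyclePart) (by
    rintro ⟨x⟩ ⟨y⟩
    exact congr_arg (Quot.mk _) (PairIn.cocyclePart_cuntzSum T x y))

theorem cocycleProj_cocycleProj (hδ : IsAbsorbing δ) (T : CuntzIsometries δ)
    (c : Quot (PairIn.Homotopic : PairIn α δ → PairIn α δ → Prop)) :
    cocycleProj hδ T (cocycleProj hδ T c) = cocycleProj hδ T c := by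
  obtain ⟨x⟩ := c
  exact congr_arg (Quot.mk _) x.isCocyclePair_cocyclePart.cocyclePart_eq

theorem mem_range_cocycleProj (hδ : IsAbsorbing δ) (T : CuntzIsometries δ)
    (c : Quot (PairIn.Homotopic : PairIn α δ → PairIn α δ → Prop)) :
    letI := homotopyGroup (α := α) hδ T
    c ∈ (cocycleProj hδ T).range ↔
      ∃ d : PairIn α δ, d.IsCocyclePair ∧ Quot.mk PairIn.Homotopic d = c := by
  constructor
  · rintro ⟨⟨x⟩, rfl⟩
    exact ⟨x.cocyclePart, x.isCocyclePair_cocyclePart, rfl⟩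
  · rintro ⟨d, hd, rfl⟩
    exact ⟨Quot.mk _ d, congr_arg (Quot.mk _) hd.cocyclePart_eq⟩

/-- The kernel of an idempotent endomorphism is isomorphic to the quotient by its range. -/
def kerEquivQuotientRange {H : Type*} [AddCommGroup H] (P : H →+ H) (hP : ∀ x, P (P x) = P x) :
    P.ker ≃+ H ⧸ P.range :=
  AddEquiv.ofBijective ((QuotientAddGroup.mk' P.range).comp P.ker.subtype) (by
    constructor
    · rw [injective_iff_map_eq_zero]
      rintro ⟨x, hx⟩ h
      obtain ⟨y, rfl⟩ := (QuotientAddGroup.eq_zero_iff x).1 h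
      have h2 : P (P y) = 0 := hx
      rw [hP] at h2
      exact Subtype.ext h2
    · intro q
      obtain ⟨x, rfl⟩ := QuotientAddGroup.mk'_surjective P.range q
      -- Subtracting `P x` moves `x` into the kernel without changing its class modulo the range.
      refine ⟨⟨x - P x, by rw [AddMonoidHom.mem_ker, map_sub, hP, sub_self]⟩, ?_⟩
      refine QuotientAddGroup.eq.2 ?_
      exact ⟨x, by simp⟩)

/-- Forwards, classes of cocycle pairs die in the quotient. Backwards, equality modulo the range
gives a cocycle pair `d` with `-[x] + [y] = [d]`, so `x ⊕ d` is homotopic to `y` plus the trivial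
pair. -/
theorem thomsenEquiv_iff (hδ : IsAbsorbing δ) (T : CuntzIsometries δ) {x y : PairIn α δ} :
    letI := homotopyGroup (α := α) hδ T
    x.ThomsenEquiv y ↔ QuotientAddGroup.mk' (cocycleProj (α := α) hδ T).range (Quot.mk _ x)
      = QuotientAddGroup.mk' (cocycleProj (α := α) hδ T).range (Quot.mk _ y) := by
  let _ := homotopyGroup (α := α) hδ T
  constructor
  · rintro ⟨S, d₁, d₂, h₁, h₂, h⟩
    have h := homotopic_iff_mk_eq.1 h
    rw [← homotopyGroup_mk_add hδ T S, ← homotopyGroup_mk_add hδ T S] at h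
    have e : ∀ d : PairIn α δ, d.IsCocyclePair →
        QuotientAddGroup.mk' (cocycleProj (α := α) hδ T).range (Quot.mk _ d) = 0 := fun d hd =>
      (QuotientAddGroup.eq_zero_iff _).2 ((mem_range_cocycleProj hδ T _).2 ⟨d, hd, rfl⟩)
    have h3 := congr_arg (QuotientAddGroup.mk' (cocycleProj (α := α) hδ T).range) h
    rwa [map_add, map_add, e d₁ h₁, e d₂ h₂, add_zero, add_zero] at h3
  · intro h
    obtain ⟨d, hd, he⟩ := (mem_range_cocycleProj hδ T _).1 (QuotientAddGroup.eq.1 h)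
    refine ⟨T, d, .trivial α δ, hd, PairIn.isCocyclePair_trivial, homotopic_iff_mk_eq.2 ?_⟩
    rw [← homotopyGroup_mk_add hδ T T, ← homotopyGroup_mk_add hδ T T, he,
      ← homotopyGroup_zero hδ T, add_zero, add_neg_cancel_left]

/-- The relation is the pullback of equality in a quotient group, which in particular settles
transitivity. -/
theorem equivalence_thomsenEquiv (hδ : IsAbsorbing δ) (T : CuntzIsometries δ) :
    Equivalence (PairIn.ThomsenEquiv : PairIn α δ → PairIn α δ → Prop) :=
  ⟨fun _ => (thomsenEquiv_iff hδ T).2 rfl,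
    fun h => (thomsenEquiv_iff hδ T).2 ((thomsenEquiv_iff hδ T).1 h).symm,
    fun h h' => (thomsenEquiv_iff hδ T).2
      (((thomsenEquiv_iff hδ T).1 h).trans ((thomsenEquiv_iff hδ T).1 h'))⟩

/-- Homotopy classes of anchored pairs are the kernel of `cocycleProj`. -/
def anchoredEquivKer (hδ : IsAbsorbing δ) (T : CuntzIsometries δ) :
    letI := homotopyGroup (α := α) hδ T
    Quot (fun x y : {x : PairIn α δ // x.IsAnchored} => x.1.Homotopic y.1)
      ≃ (cocycleProj (α := α) hδ T).ker :=
  letI := homotopyGroup (α := α) hδ T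
  Equiv.ofBijective
    -- Being anchored means precisely that the class of the cocycle part is the class of the trivial
    -- pair, which is the zero of the group.
    (Quot.lift (fun x => ⟨Quot.mk _ x.1, (homotopic_iff_mk_eq.1 x.2 :)⟩)
      fun _ _ h => Subtype.ext (Quot.sound h)) (by
    constructor
    · rintro ⟨x⟩ ⟨y⟩ h
      exact Quot.sound (homotopic_iff_mk_eq.2 (congr_arg Subtype.val h))
    · rintro ⟨⟨x⟩, hx⟩
      exact ⟨Quot.mk _ ⟨x, homotopic_iff_mk_eq.2 hx⟩, rfl⟩)

/-- Thomsen's quotient is the quotient by the range of `cocycleProj`. -/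
def thomsenEquivQuotient (hδ : IsAbsorbing δ) (T : CuntzIsometries δ) :
    letI := homotopyGroup (α := α) hδ T
    Quot (PairIn.ThomsenEquiv : PairIn α δ → PairIn α δ → Prop)
      ≃ (Quot (PairIn.Homotopic : PairIn α δ → PairIn α δ → Prop)
        ⧸ (cocycleProj (α := α) hδ T).range) :=
  letI := homotopyGroup (α := α) hδ T
  Equiv.ofBijective
    (Quot.lift (fun x => QuotientAddGroup.mk' (cocycleProj (α := α) hδ T).range (Quot.mk _ x))
      fun _ _ h => (thomsenEquiv_iff hδ T).1 h) (by
    constructor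
    · rintro ⟨x⟩ ⟨y⟩ h
      exact Quot.sound ((thomsenEquiv_iff hδ T).2 h)
    · intro q
      obtain ⟨⟨x⟩, rfl⟩ := QuotientAddGroup.mk'_surjective (cocycleProj (α := α) hδ T).range q
      exact ⟨Quot.mk _ x, rfl⟩)

end Groups

end CuntzThomsen

end

/-! ### Assembly of the proposition for `β ⊗ id` on `B ⊗ 𝓚`. -/

theorem proposition1p9 {G : Type*} [Group G] [TopologicalSpace G] [IsTopologicalGroup G]
    [LocallyCompactSpace G] [SecondCountableTopology G]
    {A : Type*} [NonUnitalCStarAlgebra A] [TopologicalSpace.SeparableSpace A]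
    {B : Type*} [NonUnitalCStarAlgebra B] (hB : IsSigmaUnital B)
    (α : CStarAction G A) (β : CStarAction G B) :
    -- `∼ₕ` and `∼` are equivalence relations, and Cuntz sums exist and preserve anchored pairs
    Equivalence (PairIn.Homotopic : CuntzPair α β → CuntzPair α β → Prop) ∧
    Equivalence (PairIn.ThomsenEquiv : CuntzPair α β → CuntzPair α β → Prop) ∧
    Nonempty (CuntzIsometries β.stab) ∧
    (∀ (T : CuntzIsometries β.stab) (x y : CuntzPair α β),
      x.IsAnchored → y.IsAnchored → (x.cuntzSum T y).IsAnchored) ∧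
    -- the three quotients are abelian groups under Cuntz addition
    ∃ (_ : AddCommGroup (HomotopyClasses α β)) (_ : AddCommGroup (AnchoredClasses α β))
      (_ : AddCommGroup (KKG α β)),
      (∀ (T : CuntzIsometries β.stab) (x y : CuntzPair α β),
        homotopyClass x + homotopyClass y = homotopyClass (x.cuntzSum T y)) ∧
      (∀ (T : CuntzIsometries β.stab) (x y z : AnchoredPair α β), z.1 = x.1.cuntzSum T y.1 →
        anchoredClass x + anchoredClass y = anchoredClass z) ∧
      (∀ (T : CuntzIsometries β.stab) (x y : CuntzPair α β),
        kkClass x + kkClass y = kkClass (x.cuntzSum T y)) ∧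
      -- (i) the classes of cocycle pairs form a subgroup
      (∃ H : AddSubgroup (HomotopyClasses α β), ∀ c : HomotopyClasses α β,
        c ∈ H ↔ ∃ d : CuntzPair α β, d.IsCocyclePair ∧ homotopyClass d = c) ∧
      -- (ii) the inclusion of the anchored pairs induces an isomorphism
      (∃ Φ : AnchoredClasses α β ≃+ KKG α β, ∀ x : AnchoredPair α β,
        Φ (anchoredClass x) = kkClass x.1) ∧
      -- (iii) anchored pairs have the same class if and only if they are homotopic; this holds in
      -- Thomsen's quotient and in any group `K` to which it is identified by an isomorphism `π`
      (∀ x y : AnchoredPair α β, kkClass x.1 = kkClass y.1 ↔ x.1.Homotopic y.1) ∧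
      (∀ (K : Type*) [AddCommGroup K] (π : KKG α β ≃+ K) (x y : AnchoredPair α β),
        π (kkClass x.1) = π (kkClass y.1) ↔ x.1.Homotopic y.1) := by
  have hδ := isAbsorbing_stab β
  obtain ⟨T, -⟩ := exists_cuntzIsometries β
  let iH : AddCommGroup (HomotopyClasses α β) := homotopyGroup (α := α) hδ T
  let P := cocycleProj (α := α) hδ T
  let e : AnchoredClasses α β ≃ P.ker := anchoredEquivKer hδ T
  let f : KKG α β ≃ HomotopyClasses α β ⧸ P.range := thomsenEquivQuotient hδ T
  -- The group structures on the other two quotients are transported from the kernel and the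
  -- quotient by the range, so the bijections become isomorphisms by construction.
  let iA : AddCommGroup (AnchoredClasses α β) := e.addCommGroup
  let iK : AddCommGroup (KKG α β) := f.addCommGroup
  let e' : AnchoredClasses α β ≃+ P.ker := e.addEquiv
  let f' : KKG α β ≃+ HomotopyClasses α β ⧸ P.range := f.addEquiv
  let Φ : AnchoredClasses α β ≃+ KKG α β :=
    (e'.trans (kerEquivQuotientRange P (cocycleProj_cocycleProj hδ T))).trans f'.symm
  have hΦ : ∀ x : AnchoredPair α β, Φ (anchoredClass x) = kkClass x.1 := fun x =>
    -- The kernel-to-quotient map sends `[x]` to its own residue class, which is by definition `f'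
    -- (kkClass x.1)`.
    f'.symm_apply_apply (kkClass x.1)
  have hadd : ∀ (S : CuntzIsometries β.stab) (x y : CuntzPair α β),
      homotopyClass x + homotopyClass y = homotopyClass (x.cuntzSum S y) :=
    homotopyGroup_mk_add hδ T
  have hiff : ∀ x y : AnchoredPair α β, kkClass x.1 = kkClass y.1 ↔ x.1.Homotopic y.1 := by
    intro x y
    -- Injectivity of `Φ` and of the embedding into the kernel turns equality in Thomsen's quotient
    -- into equality of homotopy classes.
    rw [← hΦ, ← hΦ, Φ.injective.eq_iff, ← e'.injective.eq_iff, Subtype.ext_iff]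
    exact homotopic_iff_mk_eq.symm
  refine ⟨equivalence_homotopic, equivalence_thomsenEquiv hδ T, ⟨T⟩,
    fun S _ _ hx hy => hx.cuntzSum S hy, iH, iA, iK, hadd, fun S x y z hz => ?_, fun S x y => ?_,
    ⟨P.range, mem_range_cocycleProj hδ T⟩, ⟨Φ, hΦ⟩, hiff, fun K _ π x y => ?_⟩
  · refine e'.injective (Subtype.ext ?_)
    rw [map_add]
    refine (hadd S x.1 y.1).trans ?_
    rw [← hz]
    rfl
  · refine f'.injective ?_
    rw [map_add]
    exact congr_arg (QuotientAddGroup.mk' P.range) (hadd S x y)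
  · rw [π.injective.eq_iff, hiff]
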